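/- **Setting.** Let $1\le r\le n\le m$. Matrices carry the trace inner product and the Frobenius norm $\|\cdot\|_F$; pairs in $\mathbb{X}_r=\mathbb{R}^{n\times r}\times\mathbb{R}^{m\times r}$ carry $\|(U,V)\|^2=\|U\|_F^2+\|V\|_F^2$; $\|\cdot\|$ is the spectral norm of a matrix and the Euclidean norm of a vector; $\sigma_1(X)\ge\sigma_2(X)\ge\cdots$ are the singular values of $X$. Let $f:\mathbb{R}^{n\times m}\to\mathbb{R}$ be bounded below and $C^1$, with $\nabla f$ Lipschitz of modulus $L_f$; let $\lambda,\mu>0$; let $\theta:\mathbb{R}\to(-\infty,\infty]$ be lower semicontinuous with $\theta(0)=0$, $0<\theta(t)<\infty$ for $t>0$, $\theta(t)=\infty$ for $t<0$, and $\theta$ differentiable on $(0,\infty)$. Put $\vartheta(W)=\sum_i\theta(\|W_i\|)$ (sum over the columns of $W$), $$\Phi(U,V)=f(UV^\top)+\lambda[\vartheta(U)+\vartheta(V)]+\tfrac{\mu}{2}(\|U\|_F^2+\|V\|_F^2),$$ $$\widehat\Phi(U,V,U',V')=f(U'V'^\top)+\langle\nabla f(U'V'^\top),UV^\top-U'V'^\top\rangle+\tfrac{L_f}{2}\|UV^\top-U'V'^\top\|_F^2+\lambda[\vartheta(U)+\vartheta(V)]+\tfrac{\mu}{2}(\|U\|_F^2+\|V\|_F^2).$$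 $\partial\Phi$ is the limiting (Mordukhovich) subdifferential, and $\mathcal{P}_\gamma\theta(t)=\arg\min_{x\in\mathbb{R}}\{\frac1{2\gamma}(t-x)^2+\theta(x)\}$. **Algorithm.** Given $\varrho\in(0,1)$ and $\underline{\gamma_1},\underline{\gamma_2},\gamma_{1,0},\gamma_{2,0}>0$, choose $\overline P^0\in\mathbb{R}^{m\times r}$ and $\widehat P^0\in\mathbb{R}^{n\times r}$ with orthonormal columns, and put $\overline Q^0=\overline D^0=I_r$, $\overline U^0=\widehat P^0$, $\overline V^0=\overline P^0$, $\overline X^0=\overline U^0(\overline V^0)^\top$. For $k=0,1,2,\dots$: 1. $U^{k+1}\in\arg\min_U\{\widehat\Phi(U,\overline V^k,\overline U^k,\overline V^k)+\frac{\gamma_{1,k}}2\|U-\overline U^k\|_F^2\}$. 2. Take a thin SVD $U^{k+1}\overline D^k=\widehat P^{k+1}(\widehat D^{k+1})^2(\widehat Q^{k+1})^\top$ (singular values in descending order, $\widehat D^{k+1}\ge 0$ diagonal); set $\widehat U^{k+1}=\widehat P^{k+1}\widehat D^{k+1}$, $\widehat V^{k+1}=\overline P^k\widehat Q^{k+1}\widehat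 D^{k+1}$, $\widehat X^{k+1}=\widehat U^{k+1}(\widehat V^{k+1})^\top$. 3. $V^{k+1}\in\arg\min_V\{\widehat\Phi(\widehat U^{k+1},V,\widehat U^{k+1},\widehat V^{k+1})+\frac{\gamma_{2,k}}2\|V-\widehat V^{k+1}\|_F^2\}$. 4. Take a thin SVD $V^{k+1}\widehat D^{k+1}=\overline P^{k+1}(\overline D^{k+1})^2(\overline Q^{k+1})^\top$ (same convention); set $\overline U^{k+1}=\widehat P^{k+1}\overline Q^{k+1}\overline D^{k+1}$, $\overline V^{k+1}=\overline P^{k+1}\overline D^{k+1}$, $\overline X^{k+1}=\overline U^{k+1}(\overline V^{k+1})^\top$. 5. $\gamma_{i,k+1}=\max(\underline{\gamma_i},\varrho\gamma_{i,k})$ for $i=1,2$. **Assumption 1.** For every $X\in\mathbb{R}^{n\times m}$ with $\operatorname{rank}X\le r$ and all orthogonal $P,Q$ with $X=P[\operatorname{Diag}(\sigma(X))\ 0]Q^\top$, if $P_1,Q_1$ are the first $r$ columns of $P,Q$ and $\Sigma_r=\operatorname{Diag}(\sigma_1(X),\dots,\sigma_r(X))$, then $\vartheta(P_1\Sigma_r^{1/2})+\vartheta(Q_1\Sigma_r^{1/2})=\inf\{\vartheta(U)+\vartheta(V):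 (U,V)\in\mathbb{X}_r,\ X=UV^\top\}$. **Assumption 2.** There is $\widehat\beta>0$ such that $L_f(\overline D^k_{ii})^2+\mu+\gamma_{1,k}\le\widehat\beta$ and $L_f(\widehat D^{k+1}_{ii})^2+\mu+\gamma_{2,k}\le\widehat\beta$ for all $k\ge0$ and $i\in\{1,\dots,r\}$, and such that for every $\gamma$ with $\lambda\widehat\beta^{-1}\le\gamma\le\lambda(\mu+\min\{\underline{\gamma_1},\underline{\gamma_2}\})^{-1}$ there is $c_p>0$ with $\mathcal{P}_\gamma\theta(t)\subset\{0\}\cup[c_p,\infty)$ for all $t\ge0$. **Proposition.** Let the sequences be generated by the algorithm and suppose that Assumptions 1 and 2 hold. (a) There are $\overline r\in\mathbb{N}$, $\alpha>0$ and $\widetilde k\ge1$ such that $$\operatorname{rank}\overline X^k=\operatorname{rank}\widehat X^k=\overline r\quad\text{and}\quad \min\{\sigma_{i}(\overline X^k),\sigma_{i}(\widehat X^k)\}\ge\alpha\quad(1\le i\le\overline r)\qquad\text{for all }k\ge\widetilde k.\tag{$*$}$$ (b) Let $\overline r$, $\alpha>0$, $\widetilde k\ge1$ be any numbers satisfying $(*)$.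 Put $J=\{1,\dots,\overline r\}$; let $Z_J$ be the matrix of the first $\overline r$ columns of $Z$, $\vartheta_J(Z_J)=\sum_{i\in J}\theta(\|Z_i\|)$, and $\widehat D_1^k,\overline D_1^k$ the leading $\overline r\times\overline r$ blocks of $\widehat D^k,\overline D^k$; let $\overline\beta=\sup_{k\ge 0}\max\{\|\overline V^k\|,\|\widehat U^{k+1}\|\}$. For orthogonal $\overline r\times\overline r$ matrices $R_1^{k+1},R_2^k$ write $A_1^{k+1}=(\widehat D_1^{k+1})^{-1}R_1^{k+1}\widehat D_1^{k+1}$, $B_1^k=(\overline D_1^k)^{-1}R_2^k\overline D_1^k$, $A^{k+1}=\operatorname{BlkDiag}(A_1^{k+1},0)$ and $B^k=\operatorname{BlkDiag}(B_1^k,0)$ in $\mathbb{R}^{r\times r}$. For each $k\ge\widetilde k$ there are orthogonal $R_1^{k+1},R_2^k$ with $$\max\{\|\overline U^{k+1}-\widehat U^{k+1}A^{k+1}\|_F,\|\overline V^{k+1}-\widehat V^{k+1}A^{k+1}\|_F\}\le\tfrac{\sqrt\alpha+4\overline\beta}{2\alpha}\|\overline X^{k+1}-\widehat X^{k+1}\|_F,\tag{1}$$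 $$\max\{\|\overline U^{k+1}-\overline U^kB^k\|_F,\|\overline V^{k+1}-\overline V^kB^k\|_F\}\le\tfrac{\sqrt\alpha+4\overline\beta}{2\alpha}\|\overline X^{k+1}-\overline X^k\|_F.\tag{2}$$ For every choice of orthogonal matrices $R_1^{k+1},R_2^k$ ($k\ge\widetilde k$) satisfying (1) and (2) for all $k\ge\widetilde k$, if the gradient-gap conditions $$\|\nabla\vartheta_J(\overline U_J^{k+1})-\nabla\vartheta_J(U_J^{k+1})B_1^k\|_F\le\|\overline U_J^{k+1}-U_J^{k+1}B_1^k\|_F,$$ $$\|\nabla\vartheta_J(\overline V_J^{k+1})-\nabla\vartheta_J(V_J^{k+1})A_1^{k+1}\|_F\le\|\overline V_J^{k+1}-V_J^{k+1}A_1^{k+1}\|_F$$ hold for all $k\ge\widetilde k$, then there is $c_s>0$ such that for all $k\ge\widetilde k$ $$\operatorname{dist}\big(0,\partial\Phi(\overline U^{k+1},\overline V^{k+1})\big)\le c_s\big(\|\overline X^{k+1}-\overline X^k\|_F+\|\widehat X^{k+1}-\overline X^{k+1}\|_F+\|U^{k+1}-\overline U^k\|_F+\|V^{k+1}-\widehat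 V^{k+1}\|_F\big).$$ -/

import Mathlib

open Set Filter Topology
open scoped Matrix NNReal ENNReal Matrix.Norms.Frobenius

noncomputable section

/-- The trace inner product `⟨A, B⟩ = tr (Aᵀ B)` on real matrices; its norm is the Frobenius norm,
so that from here on `‖A‖` is the Frobenius norm of a matrix `A`. -/
instance traceInnerProductSpace {ι κ : Type*} [Fintype ι] [Fintype κ] :
    InnerProductSpace ℝ (Matrix ι κ ℝ) where
  inner A B := (Aᵀ * B).trace
  norm_sq_eq_re_inner A := by
    have h0 : (0 : ℝ) ≤ ∑ i, ∑ j, ‖A i j‖ ^ (2 : ℝ) := by positivity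
    rw [Matrix.frobenius_norm_def, ← Real.rpow_natCast, ← Real.rpow_mul h0]
    simp only [Matrix.trace, Matrix.diag, Matrix.mul_apply, Matrix.transpose_apply]
    rw [Finset.sum_comm]
    simp [sq]
  conj_inner_symm A B := by
    simp only [conj_trivial]
    rw [← Matrix.trace_transpose, Matrix.transpose_mul, Matrix.transpose_transpose]
  add_left A B C := by
    rw [Matrix.transpose_add, Matrix.add_mul, Matrix.trace_add]
  smul_left A B c := by
    rw [Matrix.transpose_smul, Matrix.smul_mul, Matrix.trace_smul]
    simp

instance completeSpace_matrix {ι κ : Type*} [Fintype ι] [Fintype κ] :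
    CompleteSpace (Matrix ι κ ℝ) :=
  FiniteDimensional.complete ℝ (Matrix ι κ ℝ)

namespace LowRankFactor

/-! ### Matrices -/

/-- Real `a × b` matrices. -/
abbrev Mat (a b : ℕ) := Matrix (Fin a) (Fin b) ℝ

/-- The space `ℝ^{n×r} × ℝ^{m×r}` of factor pairs, with the Euclidean product structure
`‖(U, V)‖² = ‖U‖² + ‖V‖²`. -/
abbrev Pair (n m r : ℕ) := WithLp 2 (Mat n r × Mat m r)

/-- The `i`-th singular value of `X`, in descending order and counted from `0`:
`sv X 0 ≥ sv X 1 ≥ ⋯`. -/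
def sv {a b : ℕ} (X : Mat a b) (i : ℕ) : ℝ := (Matrix.toEuclideanLin X).singularValues i

/-- The spectral norm. -/
def specNorm {a b : ℕ} (X : Mat a b) : ℝ :=
  ‖LinearMap.toContinuousLinearMap (Matrix.toEuclideanLin X)‖

/-- The Euclidean norm of the `i`-th column. -/
def colNorm {l : ℕ} {ι : Type*} (W : Matrix (Fin l) ι ℝ) (i : ι) : ℝ :=
  ‖(WithLp.toLp 2 (fun a => W a i) : EuclideanSpace ℝ (Fin l))‖

/-- `(P, Q)` are orthogonal matrices with `X = P [Diag(σ(X)) 0] Qᵀ`. -/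
def IsFullSVD {n m : ℕ} (X : Mat n m) (P : Mat n n) (Q : Mat m m) : Prop :=
  P ∈ Matrix.orthogonalGroup (Fin n) ℝ ∧ Q ∈ Matrix.orthogonalGroup (Fin m) ℝ ∧
    X = P * (Matrix.of fun (i : Fin n) (j : Fin m) =>
      if (i : ℕ) = (j : ℕ) then sv X i else 0 : Mat n m) * Qᵀ

/-- Thin singular value decomposition `Y = P D² Qᵀ` of an `l × r` matrix (`r ≤ l`), with `P` having
orthonormal columns, `Q` orthogonal, `D = Diag(d)`, `d ≥ 0` and `D² = Diag(σ(Y))`. -/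
structure IsThinSVD {l r : ℕ} (Y : Mat l r) (P : Mat l r) (d : Fin r → ℝ) (Q : Mat r r) :
    Prop where
  orthP : Pᵀ * P = 1
  orthQ : Q ∈ Matrix.orthogonalGroup (Fin r) ℝ
  nonneg : ∀ i, 0 ≤ d i
  sq : ∀ i : Fin r, d i ^ 2 = sv Y i
  eq : Y = P * Matrix.diagonal d ^ 2 * Qᵀ

/-! ### Limiting subdifferential and proximal mapping -/

/-- Regular subdifferential of `h` at a point `x` where `h` is finite:
`v` with `h x' ≥ h x + ⟨v, x' - x⟩ - o(‖x' - x‖)` as `x' → x`. -/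
def regularSubdiff {E : Type*} [NormedAddCommGroup E] [InnerProductSpace ℝ E]
    (h : E → EReal) (x : E) : Set E :=
  {v | h x ≠ ⊤ ∧ h x ≠ ⊥ ∧ ∀ ε > 0, ∀ᶠ x' in 𝓝 x,
    h x + ((inner ℝ v (x' - x) - ε * ‖x' - x‖ : ℝ) : EReal) ≤ h x'}

/-- Limiting (Mordukhovich) subdifferential. -/
def limitingSubdiff {E : Type*} [NormedAddCommGroup E] [InnerProductSpace ℝ E]
    (h : E → EReal) (x : E) : Set E :=
  {v | h x ≠ ⊤ ∧ h x ≠ ⊥ ∧ ∃ (y w : ℕ → E),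
    Tendsto y atTop (𝓝 x) ∧ Tendsto (fun k => h (y k)) atTop (𝓝 (h x)) ∧
    Tendsto w atTop (𝓝 v) ∧ ∀ k, w k ∈ regularSubdiff h (y k)}

/-- The proximal mapping `argmin_x { (z - x)² / (2γ) + θ x }`. -/
def prox (γ : ℝ) (θ : ℝ → EReal) (z : ℝ) : Set ℝ :=
  {x | ∀ y, ((1 / (2 * γ) * (z - x) ^ 2 : ℝ) : EReal) + θ x
    ≤ ((1 / (2 * γ) * (z - y) ^ 2 : ℝ) : EReal) + θ y}

/-! ### The model -/

/-- `ϑ(W) = ∑ᵢ θ(‖Wᵢ‖)`, the sum running over the columns of `W`; applied to the submatrix of the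
columns in `J` it is `ϑ_J`. -/
def vartheta (θ : ℝ → EReal) {l : ℕ} {ι : Type*} [Fintype ι] (W : Matrix (Fin l) ι ℝ) : EReal :=
  ∑ i, θ (colNorm W i)

/-- The gradient of `ϑ` (with respect to the trace inner product) at a matrix whose columns are all
nonzero; `ϑ` is finite everywhere under the conditions imposed on `θ`. -/
def gradVartheta (θ : ℝ → EReal) {l : ℕ} {ι : Type*} [Fintype ι] (W : Matrix (Fin l) ι ℝ) :
    Matrix (Fin l) ι ℝ :=
  gradient (fun Z : Matrix (Fin l) ι ℝ => (vartheta θ Z).toReal) W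

/-- The data of the composite factorization model. -/
structure Model (n m : ℕ) where
  f : Mat n m → ℝ
  /-- the Lipschitz modulus of `∇f` -/
  L : ℝ≥0
  θ : ℝ → EReal
  lam : ℝ
  mu : ℝ

/-- The standing assumptions on the model. -/
structure Model.Valid {n m : ℕ} (M : Model n m) : Prop where
  contDiff : ContDiff ℝ 1 M.f
  lipschitz : LipschitzWith M.L (gradient M.f)
  bddBelow : BddBelow (range M.f)
  lam_pos : 0 < M.lam
  mu_pos : 0 < M.mu
  lsc : LowerSemicontinuous M.θ
  theta_zero : M.θ 0 = 0
  theta_pos : ∀ t, 0 < t → 0 < M.θ t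
  theta_neg : ∀ t, t < 0 → M.θ t = ⊤
  theta_finite : ∀ t, 0 < t → M.θ t ≠ ⊤
  theta_diff : ∀ t, 0 < t → DifferentiableAt ℝ (fun s => (M.θ s).toReal) t

/-- The objective
`Φ(U,V) = f(UVᵀ) + λ [ϑ(U) + ϑ(V)] + (μ/2) (‖U‖² + ‖V‖²)`. -/
def Model.Phi {n m : ℕ} (M : Model n m) {r : ℕ} (p : Pair n m r) : EReal :=
  (M.f (p.fst * p.sndᵀ) : EReal) + (M.lam : EReal) * (vartheta M.θ p.fst + vartheta M.θ p.snd)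
    + ((M.mu / 2 * (‖p.fst‖ ^ 2 + ‖p.snd‖ ^ 2) : ℝ) : EReal)

/-- The quadratic majorization `F̂(U,V,U',V')` of `f(UVᵀ)` at `(U',V')`. -/
def Model.Fhat {n m : ℕ} (M : Model n m) {r : ℕ} (U : Mat n r) (V : Mat m r) (U' : Mat n r)
    (V' : Mat m r) : ℝ :=
  M.f (U' * V'ᵀ) + inner ℝ (gradient M.f (U' * V'ᵀ)) (U * Vᵀ - U' * V'ᵀ)
    + M.L / 2 * ‖U * Vᵀ - U' * V'ᵀ‖ ^ 2

/-- The majorization `Φ̂(U,V,U',V')` of `Φ` at `(U',V')`. -/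
def Model.PhiHat {n m : ℕ} (M : Model n m) {r : ℕ} (U : Mat n r) (V : Mat m r) (U' : Mat n r)
    (V' : Mat m r) : EReal :=
  (M.Fhat U V U' V' : EReal) + (M.lam : EReal) * (vartheta M.θ U + vartheta M.θ V)
    + ((M.mu / 2 * (‖U‖ ^ 2 + ‖V‖ ^ 2) : ℝ) : EReal)

/-! ### The algorithm -/

/-- The input parameters `ϱ`, `γ̲₁`, `γ̲₂`, `γ₁,₀`, `γ₂,₀`. -/
structure AlgParams where
  rho : ℝ
  lo1 : ℝ
  lo2 : ℝ
  init1 : ℝ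
  init2 : ℝ

structure AlgParams.Valid (a : AlgParams) : Prop where
  rho_pos : 0 < a.rho
  rho_lt : a.rho < 1
  lo1_pos : 0 < a.lo1
  lo2_pos : 0 < a.lo2
  init1_pos : 0 < a.init1
  init2_pos : 0 < a.init2

/-- The sequences produced by a run. Diagonal matrices are stored through their diagonals. The
algorithm produces `U`, `V`, `Uhat`, `Vhat`, `Xhat`, `Dhat` and `Qhat` from index `1` on; their
values at index `0` are never used. -/
structure Iterates (n m r : ℕ) where
  U : ℕ → Mat n r
  V : ℕ → Mat m r
  Uhat : ℕ → Mat n r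
  Vhat : ℕ → Mat m r
  Ubar : ℕ → Mat n r
  Vbar : ℕ → Mat m r
  Xhat : ℕ → Mat n m
  Xbar : ℕ → Mat n m
  Phat : ℕ → Mat n r
  Qhat : ℕ → Mat r r
  Dhat : ℕ → Fin r → ℝ
  Pbar : ℕ → Mat m r
  Qbar : ℕ → Mat r r
  Dbar : ℕ → Fin r → ℝ
  gam1 : ℕ → ℝ
  gam2 : ℕ → ℝ

/-- `s` is a run of the majorized proximal alternating minimization algorithm with subspace
correction. -/
structure IsRun {n m r : ℕ} (M : Model n m) (a : AlgParams) (s : Iterates n m r) : Prop where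
  init_Pbar : (s.Pbar 0)ᵀ * s.Pbar 0 = 1
  init_Phat : (s.Phat 0)ᵀ * s.Phat 0 = 1
  init_Qbar : s.Qbar 0 = 1
  init_Dbar : s.Dbar 0 = fun _ => 1
  init_Ubar : s.Ubar 0 = s.Phat 0
  init_Vbar : s.Vbar 0 = s.Pbar 0
  init_gam1 : s.gam1 0 = a.init1
  init_gam2 : s.gam2 0 = a.init2
  /-- step 1 -/
  step1 : ∀ k, ∀ U : Mat n r,
    M.PhiHat (s.U (k + 1)) (s.Vbar k) (s.Ubar k) (s.Vbar k)
        + ((s.gam1 k / 2 * ‖s.U (k + 1) - s.Ubar k‖ ^ 2 : ℝ) : EReal)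
      ≤ M.PhiHat U (s.Vbar k) (s.Ubar k) (s.Vbar k)
        + ((s.gam1 k / 2 * ‖U - s.Ubar k‖ ^ 2 : ℝ) : EReal)
  /-- step 2 -/
  step2_svd : ∀ k, IsThinSVD (s.U (k + 1) * Matrix.diagonal (s.Dbar k))
    (s.Phat (k + 1)) (s.Dhat (k + 1)) (s.Qhat (k + 1))
  step2_Uhat : ∀ k, s.Uhat (k + 1) = s.Phat (k + 1) * Matrix.diagonal (s.Dhat (k + 1))
  step2_Vhat : ∀ k, s.Vhat (k + 1) =
    s.Pbar k * s.Qhat (k + 1) * Matrix.diagonal (s.Dhat (k + 1))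
  step2_Xhat : ∀ k, s.Xhat (k + 1) = s.Uhat (k + 1) * (s.Vhat (k + 1))ᵀ
  /-- step 3 -/
  step3 : ∀ k, ∀ V : Mat m r,
    M.PhiHat (s.Uhat (k + 1)) (s.V (k + 1)) (s.Uhat (k + 1)) (s.Vhat (k + 1))
        + ((s.gam2 k / 2 * ‖s.V (k + 1) - s.Vhat (k + 1)‖ ^ 2 : ℝ) : EReal)
      ≤ M.PhiHat (s.Uhat (k + 1)) V (s.Uhat (k + 1)) (s.Vhat (k + 1))
        + ((s.gam2 k / 2 * ‖V - s.Vhat (k + 1)‖ ^ 2 : ℝ) : EReal)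
  /-- step 4 -/
  step4_svd : ∀ k, IsThinSVD (s.V (k + 1) * Matrix.diagonal (s.Dhat (k + 1)))
    (s.Pbar (k + 1)) (s.Dbar (k + 1)) (s.Qbar (k + 1))
  step4_Ubar : ∀ k, s.Ubar (k + 1) =
    s.Phat (k + 1) * s.Qbar (k + 1) * Matrix.diagonal (s.Dbar (k + 1))
  step4_Vbar : ∀ k, s.Vbar (k + 1) = s.Pbar (k + 1) * Matrix.diagonal (s.Dbar (k + 1))
  /-- this includes the starting point `k = 0` -/
  step4_Xbar : ∀ k, s.Xbar k = s.Ubar k * (s.Vbar k)ᵀ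
  /-- step 5 -/
  step5_gam1 : ∀ k, s.gam1 (k + 1) = max a.lo1 (a.rho * s.gam1 k)
  step5_gam2 : ∀ k, s.gam2 (k + 1) = max a.lo2 (a.rho * s.gam2 k)

/-! ### The two assumptions -/

/-- For every `X` of rank at most `r`, the balanced pair
`(P₁ Σ_r(X)^{1/2}, Q₁ Σ_r(X)^{1/2})` built from a singular value decomposition of `X` minimizes
`ϑ(U) + ϑ(V)` over all factorizations `X = U Vᵀ` with `r` columns. -/
def Assumption1 {n m r : ℕ} (hrn : r ≤ n) (hnm : n ≤ m) (θ : ℝ → EReal) : Prop :=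
  ∀ (X : Mat n m) (P : Mat n n) (Q : Mat m m), X.rank ≤ r → IsFullSVD X P Q →
    vartheta θ (P.submatrix id (Fin.castLE hrn)
        * Matrix.diagonal fun i : Fin r => Real.sqrt (sv X i))
      + vartheta θ (Q.submatrix id (Fin.castLE (hrn.trans hnm))
        * Matrix.diagonal fun i : Fin r => Real.sqrt (sv X i))
    = ⨅ p : {p : Mat n r × Mat m r // X = p.1 * p.2ᵀ},
        (vartheta θ p.1.1 + vartheta θ p.1.2)

/-- Gap at zero of the proximal mapping of `θ`: the constant `βhat` bounds all
`(Λᵏᵢᵢ)² = L (D̄ᵏᵢᵢ)² + μ + γ₁,ₖ` and `(Δᵏ⁺¹ᵢᵢ)² = L (D̂ᵏ⁺¹ᵢᵢ)² + μ + γ₂,ₖ`, and for every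
`γ` between `λ / βhat` and `λ / (μ + min(γ̲₁, γ̲₂))` the nonzero proximal points of `θ` with
parameter `γ` are bounded away from zero. -/
def Assumption2 {n m r : ℕ} (M : Model n m) (a : AlgParams) (s : Iterates n m r) : Prop :=
  ∃ βhat : ℝ, 0 < βhat ∧
    (∀ (k : ℕ) (i : Fin r), M.L * s.Dbar k i ^ 2 + (M.mu + s.gam1 k) ≤ βhat ∧
      M.L * s.Dhat (k + 1) i ^ 2 + (M.mu + s.gam2 k) ≤ βhat) ∧
    ∀ γ : ℝ, M.lam * βhat⁻¹ ≤ γ → γ ≤ M.lam * (M.mu + min a.lo1 a.lo2)⁻¹ →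
      ∃ cp : ℝ, 0 < cp ∧ ∀ t : ℝ, 0 ≤ t → ∀ x ∈ prox γ M.θ t, x = 0 ∨ cp ≤ x

/-! ### Objects of the relative-error condition -/

/-- `J = {1, …, r̄}` as a set of column indices. -/
abbrev Lead (r rbar : ℕ) := {i : Fin r // (i : ℕ) < rbar}

/-- `Z_J`, the first `r̄` columns of `Z`. -/
def leadCols {l r : ℕ} (rbar : ℕ) (Z : Mat l r) : Matrix (Fin l) (Lead r rbar) ℝ :=
  Z.submatrix id Subtype.val

/-- `BlkDiag(A, 0)`. -/
def blk {r rbar : ℕ} (A : Matrix (Lead r rbar) (Lead r rbar) ℝ) : Mat r r :=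
  Matrix.of fun i j =>
    if h : (i : ℕ) < rbar ∧ (j : ℕ) < rbar then A ⟨i, h.1⟩ ⟨j, h.2⟩ else 0

/-- `D₁⁻¹ R D₁`, where `D₁` is the leading `r̄ × r̄` block of `Diag(d)`. -/
def conjD {r rbar : ℕ} (d : Fin r → ℝ) (R : Matrix (Lead r rbar) (Lead r rbar) ℝ) :
    Matrix (Lead r rbar) (Lead r rbar) ℝ :=
  (Matrix.diagonal fun i : Lead r rbar => d i)⁻¹ * R
    * Matrix.diagonal fun i : Lead r rbar => d i

/-- From the index `kt` on, all `X̄ᵏ` and `X̂ᵏ` have rank `r̄` and their `r̄`-th (smallest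
nonzero) singular value is at least `α > 0`. -/
structure StableFrom {n m r : ℕ} (s : Iterates n m r) (rbar : ℕ) (α : ℝ) (kt : ℕ) : Prop where
  one_le : 1 ≤ kt
  alpha_pos : 0 < α
  rank_bar : ∀ k ≥ kt, (s.Xbar k).rank = rbar
  rank_hat : ∀ k ≥ kt, (s.Xhat k).rank = rbar
  sv_bar : ∀ k ≥ kt, ∀ i < rbar, α ≤ sv (s.Xbar k) i
  sv_hat : ∀ k ≥ kt, ∀ i < rbar, α ≤ sv (s.Xhat k) i

/-- `β̄ = sup_k max(‖V̄ᵏ‖, ‖Ûᵏ‖)` (spectral norms); `Û` starts at index `1`. -/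
def betaBar {n m r : ℕ} (s : Iterates n m r) : ℝ :=
  ⨆ k : ℕ, max (specNorm (s.Vbar k)) (specNorm (s.Uhat (k + 1)))

/-- `R = R₁ᵏ⁺¹` is an orthogonal matrix which, through `A = BlkDiag(D̂₁⁻¹ R D̂₁, 0)`, aligns
`(Ûᵏ⁺¹, V̂ᵏ⁺¹)` with `(Ūᵏ⁺¹, V̄ᵏ⁺¹)`. -/
def AlignHat {n m r : ℕ} (s : Iterates n m r) (rbar : ℕ) (α : ℝ) (k : ℕ)
    (R : Matrix (Lead r rbar) (Lead r rbar) ℝ) : Prop :=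
  R ∈ Matrix.orthogonalGroup (Lead r rbar) ℝ ∧
    max ‖s.Ubar (k + 1) - s.Uhat (k + 1) * blk (conjD (s.Dhat (k + 1)) R)‖
        ‖s.Vbar (k + 1) - s.Vhat (k + 1) * blk (conjD (s.Dhat (k + 1)) R)‖
      ≤ (Real.sqrt α + 4 * betaBar s) / (2 * α) * ‖s.Xbar (k + 1) - s.Xhat (k + 1)‖

/-- `R = R₂ᵏ` is an orthogonal matrix which, through `B = BlkDiag(D̄₁⁻¹ R D̄₁, 0)`, aligns
`(Ūᵏ, V̄ᵏ)` with `(Ūᵏ⁺¹, V̄ᵏ⁺¹)`. -/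
def AlignBar {n m r : ℕ} (s : Iterates n m r) (rbar : ℕ) (α : ℝ) (k : ℕ)
    (R : Matrix (Lead r rbar) (Lead r rbar) ℝ) : Prop :=
  R ∈ Matrix.orthogonalGroup (Lead r rbar) ℝ ∧
    max ‖s.Ubar (k + 1) - s.Ubar k * blk (conjD (s.Dbar k) R)‖
        ‖s.Vbar (k + 1) - s.Vbar k * blk (conjD (s.Dbar k) R)‖
      ≤ (Real.sqrt α + 4 * betaBar s) / (2 * α) * ‖s.Xbar (k + 1) - s.Xbar k‖

/-- The gradient-gap condition for `U` at iteration `k`, with `B₁ᵏ = D̄₁⁻¹ R₂ᵏ D̄₁`. -/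
def GapU {n m r : ℕ} (θ : ℝ → EReal) (s : Iterates n m r) (rbar k : ℕ)
    (R : Matrix (Lead r rbar) (Lead r rbar) ℝ) : Prop :=
  ‖gradVartheta θ (leadCols rbar (s.Ubar (k + 1)))
      - gradVartheta θ (leadCols rbar (s.U (k + 1))) * conjD (s.Dbar k) R‖
    ≤ ‖leadCols rbar (s.Ubar (k + 1)) - leadCols rbar (s.U (k + 1)) * conjD (s.Dbar k) R‖

/-- The gradient-gap condition for `V` at iteration `k`, with `A₁ᵏ⁺¹ = D̂₁⁻¹ R₁ᵏ⁺¹ D̂₁`. -/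
def GapV {n m r : ℕ} (θ : ℝ → EReal) (s : Iterates n m r) (rbar k : ℕ)
    (R : Matrix (Lead r rbar) (Lead r rbar) ℝ) : Prop :=
  ‖gradVartheta θ (leadCols rbar (s.Vbar (k + 1)))
      - gradVartheta θ (leadCols rbar (s.V (k + 1))) * conjD (s.Dhat (k + 1)) R‖
    ≤ ‖leadCols rbar (s.Vbar (k + 1))
        - leadCols rbar (s.V (k + 1)) * conjD (s.Dhat (k + 1)) R‖

end LowRankFactor

end

open Set Filter Topology
open scoped Matrix NNReal ENNReal Matrix.Norms.Frobenius

noncomputable section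

namespace LowRankFactor

/-! ### Trace inner product, isometries and singular value decomposition of square matrices. -/

section MatrixBasics

variable {ι κ o : Type*} [Fintype ι] [Fintype κ] [Fintype o]

/-! Both subproblems split over columns: the fixed factor has the form `P * diagonal d` with `Pᵀ * P
= 1`, so the quadratic term of the majorization is a weighted sum of squared column norms. Along the
ray through a nonzero optimal column the problem is a scalar proximal problem for `θ`. Increasing
the quadratic coefficient to the common bound `β` while moving the center keeps the same minimizer,
so a single parameter `λ / β`, and hence a single gap `cp`, serves all columns and all iterations
(`exists_prox_of_colObj_min`, `exists_column_gap`).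

The subspace correction changes a factorization but not its product. The balanced pair minimizes the
squared norms (a nuclear norm argument) and, by Assumption 1, also `ϑ(U) + ϑ(V)`, so the correction
does not increase the objective (`IsBalanced.phi_le`). Together with the majorization this gives
sufficient decrease; the term with `μ` bounds the iterates, and the steps `U - Ubar` and `V - Vhat`
tend to zero.

For (a), every matrix in the chain `Xbar 0, Xhat 1, Xbar 1, …` is a product containing the diagonal
factor of its predecessor. The ranks therefore decrease, and become constant. Once they are
constant, no column of `U` or `V` that meets a nonzero diagonal entry can vanish, so its norm is at
least `cp`. As the steps vanish, the corresponding entries of `Dbar` and `Dhat` eventually exceed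
`cp / 2`, and the singular values are their squares.

For the alignment in (b), the orthogonal matrix is the polar factor of the mean of the two products
of singular bases. It aligns left and right singular subspaces simultaneously with error `2 / α`
times the distance of the matrices (`exists_orthogonal_alignment`), and Mirsky's inequality controls
the singular values (`sum_sq_sub_le_norm_sub_sq`).

For the error bound, dropping the zero columns from the regularizer gives a smooth minorant that
touches the objective, since `θ` is nonnegative and `θ(0) = 0`. Its gradient is thus a limiting
subgradient (`Model.Valid.mem_limitingSubdiff_Phi`). Subtracting the optimality conditions of the
subproblems, multiplied on the right by the aligning matrices, leaves only differences, which the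
Lipschitz gradient, the alignment and the gap conditions control (`norm_partial_gradient_le`). -/

theorem inner_eq_trace (A B : Matrix ι κ ℝ) : inner ℝ A B = (Aᵀ * B).trace := rfl

theorem inner_eq_sum (A B : Matrix ι κ ℝ) : inner ℝ A B = ∑ j, ∑ i, A i j * B i j := by
  simp [inner_eq_trace, Matrix.trace, Matrix.mul_apply]

theorem inner_mul_left_eq (A : Matrix ι κ ℝ) (B : Matrix κ o ℝ) (C : Matrix ι o ℝ) :
    inner ℝ (A * B) C = inner ℝ B (Aᵀ * C) := by
  simp [inner_eq_trace, Matrix.mul_assoc]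

theorem inner_mul_right_eq (A : Matrix ι κ ℝ) (B : Matrix κ o ℝ) (C : Matrix ι o ℝ) :
    inner ℝ (A * B) C = inner ℝ A (C * Bᵀ) := by
  rw [inner_eq_trace, inner_eq_trace, Matrix.transpose_mul, Matrix.mul_assoc,
    Matrix.trace_mul_comm, Matrix.mul_assoc]

theorem inner_transpose (A B : Matrix ι κ ℝ) : inner ℝ Aᵀ Bᵀ = inner ℝ A B := by
  rw [inner_eq_sum, inner_eq_sum, Finset.sum_comm]
  rfl

theorem norm_sq_eq_sum (A : Matrix ι κ ℝ) : ‖A‖ ^ 2 = ∑ j, ∑ i, A i j ^ 2 := by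
  rw [← real_inner_self_eq_norm_sq, inner_eq_sum]
  simp [sq]

theorem colNorm_sq {l : ℕ} {κ : Type*} (W : Matrix (Fin l) κ ℝ) (j : κ) :
    colNorm W j ^ 2 = ∑ i, W i j ^ 2 := by
  rw [colNorm, EuclideanSpace.norm_sq_eq]
  simp

theorem colNorm_nonneg {l : ℕ} {κ : Type*} (W : Matrix (Fin l) κ ℝ) (j : κ) : 0 ≤ colNorm W j :=
  norm_nonneg _

theorem norm_sq_eq_sum_colNorm {l : ℕ} (W : Matrix (Fin l) κ ℝ) :
    ‖W‖ ^ 2 = ∑ j, colNorm W j ^ 2 := by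
  simp [norm_sq_eq_sum, colNorm_sq]

theorem colNorm_le_norm {l : ℕ} (W : Matrix (Fin l) κ ℝ) (j : κ) : colNorm W j ≤ ‖W‖ := by
  refine le_of_sq_le_sq ?_ (norm_nonneg _)
  rw [norm_sq_eq_sum_colNorm]
  exact Finset.single_le_sum (f := fun j => colNorm W j ^ 2) (fun i _ => sq_nonneg _)
    (Finset.mem_univ j)

theorem norm_isometry_mul [DecidableEq κ] {P : Matrix ι κ ℝ} (hP : Pᵀ * P = 1)
    (A : Matrix κ o ℝ) : ‖P * A‖ = ‖A‖ := by
  have : ‖P * A‖ ^ 2 = ‖A‖ ^ 2 := by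
    rw [← real_inner_self_eq_norm_sq, ← real_inner_self_eq_norm_sq, inner_mul_left_eq,
      ← Matrix.mul_assoc, hP, Matrix.one_mul]
  exact (sq_eq_sq₀ (norm_nonneg _) (norm_nonneg _)).1 this

theorem norm_mul_isometry_transpose [DecidableEq κ] {Q : Matrix ι κ ℝ} (hQ : Qᵀ * Q = 1)
    (A : Matrix o κ ℝ) : ‖A * Qᵀ‖ = ‖A‖ := by
  rw [← Matrix.frobenius_norm_transpose, Matrix.transpose_mul, Matrix.transpose_transpose,
    norm_isometry_mul hQ, Matrix.frobenius_norm_transpose]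

/-- Cauchy–Schwarz for `A * Q * Qᵀ` and `A`, because the former has the same norm as `A * Q`. -/
theorem norm_mul_isometry_le [DecidableEq κ] {Q : Matrix ι κ ℝ} (hQ : Qᵀ * Q = 1)
    (A : Matrix o ι ℝ) : ‖A * Q‖ ≤ ‖A‖ := by
  have h : ‖A * Q‖ * ‖A * Q‖ ≤ ‖A * Q‖ * ‖A‖ := by
    calc ‖A * Q‖ * ‖A * Q‖ = inner ℝ (A * Q) (A * Q) := (real_inner_self_eq_norm_mul_norm _).symm
      _ = inner ℝ (A * Q * Qᵀ) A := by rw [inner_mul_right_eq, real_inner_comm]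
      _ ≤ ‖A * Q * Qᵀ‖ * ‖A‖ := real_inner_le_norm _ _
      _ = ‖A * Q‖ * ‖A‖ := by rw [norm_mul_isometry_transpose hQ]
  rcases (norm_nonneg (A * Q)).eq_or_lt with h0 | h0
  · rw [← h0]; exact norm_nonneg _
  · exact le_of_mul_le_mul_left h h0

theorem norm_mul_diagonal_sq [DecidableEq κ] (A : Matrix ι κ ℝ) (d : κ → ℝ) :
    ‖A * Matrix.diagonal d‖ ^ 2 = ∑ j, d j ^ 2 * ∑ i, A i j ^ 2 := by
  simp only [norm_sq_eq_sum, Matrix.mul_diagonal, Finset.mul_sum]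
  refine Finset.sum_congr rfl fun j _ => Finset.sum_congr rfl fun i _ => by ring

theorem norm_mul_diagonal_le [DecidableEq κ] (A : Matrix ι κ ℝ) {d : κ → ℝ} {c : ℝ} (hc : 0 ≤ c)
    (hd : ∀ j, |d j| ≤ c) : ‖A * Matrix.diagonal d‖ ≤ c * ‖A‖ := by
  refine le_of_sq_le_sq ?_ (by positivity)
  rw [norm_mul_diagonal_sq, mul_pow, norm_sq_eq_sum, Finset.mul_sum]
  refine Finset.sum_le_sum fun j _ => mul_le_mul_of_nonneg_right ?_ (by positivity)
  exact sq_le_sq' (by linarith [neg_abs_le (d j), hd j]) ((le_abs_self _).trans (hd j))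

theorem norm_diagonal_sq [DecidableEq κ] (d : κ → ℝ) :
    ‖(Matrix.diagonal d : Matrix κ κ ℝ)‖ ^ 2 = ∑ j, d j ^ 2 := by
  rw [norm_sq_eq_sum]
  refine Finset.sum_congr rfl fun j _ => ?_
  rw [Finset.sum_eq_single j] <;> simp +contextual

theorem sum_sq_col_of_isometry {κ : Type*} [DecidableEq κ] {P : Matrix ι κ ℝ} (hP : Pᵀ * P = 1) (j : κ) :
    ∑ i, P i j ^ 2 = 1 := by
  have := congrFun (congrFun hP j) j
  simpa [Matrix.mul_apply, sq] using this

theorem colNorm_isometry_mul_diagonal {l : ℕ} [DecidableEq κ] {P : Matrix (Fin l) κ ℝ}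
    (hP : Pᵀ * P = 1) (d : κ → ℝ) (j : κ) : colNorm (P * Matrix.diagonal d) j = |d j| := by
  have h : colNorm (P * Matrix.diagonal d) j ^ 2 = |d j| ^ 2 := by
    simp [colNorm_sq, Matrix.mul_diagonal, mul_pow, ← Finset.sum_mul, sum_sq_col_of_isometry hP]
  exact (sq_eq_sq₀ (colNorm_nonneg _ _) (abs_nonneg _)).1 h

theorem colNorm_eq_zero_iff {l : ℕ} {κ : Type*} (W : Matrix (Fin l) κ ℝ) (j : κ) :
    colNorm W j = 0 ↔ ∀ i, W i j = 0 := by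
  rw [colNorm, norm_eq_zero]
  constructor
  · intro h i
    simpa using congrArg (fun v : EuclideanSpace ℝ (Fin l) => v i) h
  · intro h
    ext i
    simpa using h i

theorem colNorm_sub_le {l : ℕ} {κ : Type*} (W Z : Matrix (Fin l) κ ℝ) (j : κ) :
    colNorm W j - colNorm Z j ≤ colNorm (W - Z) j :=
  norm_sub_norm_le _ _

theorem isometry_mul_isometry {υ : Type*} [Fintype υ] [DecidableEq κ] [DecidableEq υ]
    {P : Matrix ι κ ℝ} {R : Matrix κ υ ℝ} (hP : Pᵀ * P = 1) (hR : Rᵀ * R = 1) :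
    (P * R)ᵀ * (P * R) = 1 := by
  rw [Matrix.transpose_mul, Matrix.mul_assoc, ← Matrix.mul_assoc Pᵀ, hP, Matrix.one_mul, hR]

theorem orthogonal_transpose_mul [DecidableEq κ] {R : Matrix κ κ ℝ}
    (hR : R ∈ Matrix.orthogonalGroup κ ℝ) : Rᵀ * R = 1 :=
  (Matrix.mem_orthogonalGroup_iff' _ _).1 hR

/-- A family of orthonormal vectors as the columns of a matrix. -/
theorem isometry_iff_orthonormal {κ : Type*} [DecidableEq κ] (P : Matrix ι κ ℝ) :
    Pᵀ * P = 1 ↔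
      Orthonormal ℝ (fun j => (WithLp.toLp 2 (fun i => P i j) : EuclideanSpace ℝ ι)) := by
  rw [orthonormal_iff_ite]
  simp only [EuclideanSpace.inner_toLp_toLp, ← Matrix.ext_iff]
  refine forall_congr' fun i => forall_congr' fun j => ?_
  simp [Matrix.mul_apply, Matrix.one_apply, dotProduct, mul_comm]

/-- Only the columns indexed by `t` matter; the others are placeholders to be replaced. This form
serves both to complete a thin factor and to supply left singular vectors for vanishing singular
values. -/
theorem exists_orthogonal_of_isometry_on [DecidableEq ι] (P : Matrix ι ι ℝ) (t : Set ι)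
    (hP : Orthonormal ℝ (t.domRestrict fun j =>
      (WithLp.toLp 2 (fun i => P i j) : EuclideanSpace ℝ ι))) :
    ∃ R ∈ Matrix.orthogonalGroup ι ℝ, ∀ j ∈ t, ∀ i, R i j = P i j := by
  obtain ⟨b, hb⟩ := hP.exists_orthonormalBasis_extension_of_card_eq
    (by simp) 
  refine ⟨Matrix.of fun i j => b j i, ?_, fun j hj i => by simp [hb j hj]⟩
  rw [Matrix.mem_orthogonalGroup_iff', isometry_iff_orthonormal]
  exact b.orthonormal

/-- Orthonormal columns extend to an orthogonal matrix. -/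
theorem exists_orthogonal_extension {l r : ℕ} (h : r ≤ l) {P : Mat l r} (hP : Pᵀ * P = 1) :
    ∃ R ∈ Matrix.orthogonalGroup (Fin l) ℝ, R.submatrix id (Fin.castLE h) = P := by
  have ho := (isometry_iff_orthonormal P).1 hP
  obtain ⟨R, hR, hRP⟩ := exists_orthogonal_of_isometry_on
    (P := Matrix.of fun (i j : Fin l) => if hj : (j : ℕ) < r then P i ⟨j, hj⟩ else 0)
    {j : Fin l | (j : ℕ) < r} (by
      have := ho.comp (fun j : {j : Fin l | (j : ℕ) < r} => (⟨j.1, j.2⟩ : Fin r))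
        (fun a b hab => by ext; simpa using hab)
      convert this using 1
      ext j i
      simp [show (j.1 : ℕ) < r from j.2])
  refine ⟨R, hR, ?_⟩
  ext i j
  simp [hRP (Fin.castLE h j) (by simp) i]

/-- Singular value decomposition of a square matrix, without ordering. -/
theorem exists_svd_square [DecidableEq ι] (T : Matrix ι ι ℝ) :
    ∃ (A B : Matrix ι ι ℝ) (s : ι → ℝ), A ∈ Matrix.orthogonalGroup ι ℝ ∧
      B ∈ Matrix.orthogonalGroup ι ℝ ∧ (∀ i, 0 ≤ s i) ∧ T = A * Matrix.diagonal s * Bᵀ := by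
  have hH : (Tᵀ * T).IsHermitian := by
    simpa using Matrix.isHermitian_conjTranspose_mul_self T
  set B : Matrix ι ι ℝ := (hH.eigenvectorUnitary : Matrix ι ι ℝ) with hB
  have hBo : B ∈ Matrix.orthogonalGroup ι ℝ := hH.eigenvectorUnitary.2
  have hB1 := orthogonal_transpose_mul hBo
  have hB2 : B * Bᵀ = 1 := mul_eq_one_comm.1 hB1
  set e := hH.eigenvalues with he
  -- In an eigenbasis of `Tᵀ * T` the columns of `T * B` are orthogonal with squared lengths `e`.
  -- Normalizing the nonzero ones gives left singular vectors.
  have hdiag : (T * B)ᵀ * (T * B) = Matrix.diagonal e := by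
    have h := hH.spectral_theorem
    rw [Unitary.conjStarAlgAut_apply] at h
    have h2 : Tᵀ * T = B * Matrix.diagonal e * Bᵀ := by
      simpa [Matrix.star_eq_conjTranspose] using h
    rw [Matrix.transpose_mul, Matrix.mul_assoc, ← Matrix.mul_assoc Tᵀ, h2]
    simp only [← Matrix.mul_assoc, hB1, Matrix.one_mul]
    rw [Matrix.mul_assoc, hB1, Matrix.mul_one]
  have hcol : ∀ i j, ∑ k, (T * B) k i * (T * B) k j = if i = j then e i else 0 := by
    intro i j
    have := congrFun (congrFun hdiag i) j
    rw [Matrix.diagonal_apply, Matrix.mul_apply] at this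
    simpa only [Matrix.transpose_apply] using this
  have he0 : ∀ i, 0 ≤ e i := fun i => by
    have := hcol i i
    rw [if_pos rfl] at this
    rw [← this]
    exact Finset.sum_nonneg fun k _ => mul_self_nonneg _
  obtain ⟨A, hA, hAe⟩ := exists_orthogonal_of_isometry_on
    (P := Matrix.of fun k i => (T * B) k i / Real.sqrt (e i)) {i | e i ≠ 0} (by
      rw [orthonormal_iff_ite]
      rintro ⟨i, hi⟩ ⟨j, hj⟩
      have h := hcol j i
      simp only [Set.domRestrict_apply, EuclideanSpace.inner_toLp_toLp, dotProduct, Matrix.of_apply,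
        star_trivial, Subtype.mk.injEq]
      simp_rw [div_mul_div_comm]
      rw [← Finset.sum_div, h]
      by_cases hij : i = j
      · subst hij
        simp [Real.mul_self_sqrt (he0 i), div_self hi]
      · simp [hij, Ne.symm hij])
  refine ⟨A, B, fun i => Real.sqrt (e i), hA, hBo, fun i => Real.sqrt_nonneg _, ?_⟩
  have : T * B = A * Matrix.diagonal fun i => Real.sqrt (e i) := by
    ext k i
    rw [Matrix.mul_diagonal]
    -- If `e i = 0` the column of `T * B` itself vanishes, so the choice of the column of `A` is
    -- immaterial.
    by_cases hi : e i = 0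
    · have h := hcol i i
      rw [if_pos rfl, hi, Finset.sum_eq_zero_iff_of_nonneg (fun k _ => mul_self_nonneg _)] at h
      simpa [hi] using h k (Finset.mem_univ k)
    · rw [hAe i hi k]
      simp only [Matrix.of_apply]
      rw [div_mul_cancel₀]
      exact Real.sqrt_ne_zero'.2 (lt_of_le_of_ne (he0 i) (Ne.symm hi))
  rw [← this, Matrix.mul_assoc, hB2, Matrix.mul_one]

end MatrixBasics

/-! ### Mirsky's inequality through doubly substochastic weights. -/

section Mirsky

/-- Abel summation: weighting by an antitone nonnegative sequence preserves nonpositivity of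
partial sums. -/
theorem sum_mul_nonpos_of_partial_sums {a : ℕ → ℝ} (ha : Antitone a) (ha0 : ∀ i, 0 ≤ a i) :
    ∀ (r : ℕ) (x : Fin r → ℝ), (∀ k : ℕ, ∑ i : Fin r, (if (i : ℕ) < k then x i else 0) ≤ 0) →
      ∑ i : Fin r, a i * x i ≤ 0 := by
  -- The induction carries the sharper bound `a r * ∑ x`: since the total is nonpositive, passing to
  -- the smaller weight `a (n + 1)` only weakens it.
  have key : ∀ (r : ℕ) (x : Fin r → ℝ),
      (∀ k ≤ r, ∑ i : Fin r, (if (i : ℕ) < k then x i else 0) ≤ 0) →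
      ∑ i : Fin r, a i * x i ≤ a r * ∑ i, x i := by
    intro r
    induction r with
    | zero => intro x _; simp
    | succ n ih =>
      intro x hx
      have h1 := ih (fun i => x i.castSucc) (fun k hk => by
        have := hx k (by omega)
        rw [Fin.sum_univ_castSucc] at this
        simpa [show ¬ n < k by omega] using this)
      have h2 := hx (n + 1) le_rfl
      have h3 : ∑ i : Fin (n + 1), (if (i : ℕ) < n + 1 then x i else 0) = ∑ i, x i :=
        Finset.sum_congr rfl fun i _ => if_pos i.2
      rw [h3] at h2
      have h4 := ha (Nat.le_succ n)
      rw [Fin.sum_univ_castSucc] at h2 ⊢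
      rw [Fin.sum_univ_castSucc]
      simp only [Fin.val_castSucc, Fin.val_last] at *
      nlinarith
  intro r x hx
  refine (key r x fun k _ => hx k).trans (mul_nonpos_of_nonneg_of_nonpos (ha0 r) ?_)
  have h3 : ∑ i : Fin r, (if (i : ℕ) < r then x i else 0) = ∑ i, x i :=
    Finset.sum_congr rfl fun i _ => if_pos i.2
  exact h3 ▸ hx r

/-- A bilinear form with doubly substochastic coefficients is maximal, on antitone nonnegative
sequences, for the identity matrix. -/
theorem sum_mul_substochastic_le {a b : ℕ → ℝ} (ha : Antitone a) (ha0 : ∀ i, 0 ≤ a i)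
    (hb : Antitone b) (hb0 : ∀ i, 0 ≤ b i) {r : ℕ} {w : Fin r → Fin r → ℝ}
    (hw : ∀ i j, 0 ≤ w i j) (hrow : ∀ i, ∑ j, w i j ≤ 1) (hcol : ∀ j, ∑ i, w i j ≤ 1) :
    ∑ i : Fin r, ∑ j : Fin r, a i * b j * w i j ≤ ∑ i : Fin r, a i * b i := by
  have h := sum_mul_nonpos_of_partial_sums ha ha0 r
    (fun i => ∑ j : Fin r, b j * w i j - b i) (fun k => by
      have hite : ∀ i : Fin r, (if (i : ℕ) < k then (∑ j : Fin r, b j * w i j - b i) else 0)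
          = ∑ j : Fin r, b j * (if (i : ℕ) < k then w i j else 0)
            - (if (i : ℕ) < k then b i else 0) := by
        intro i; split_ifs <;> simp
      simp_rw [hite]
      rw [Finset.sum_sub_distrib, Finset.sum_comm, ← Finset.sum_sub_distrib]
      -- All weights are replaced by the threshold value `b k`: for `j < k` one has `b k ≤ b j`
      -- against a nonpositive factor, for `j ≥ k` one has `b j ≤ b k` against a nonnegative one.
      have hle : ∀ j : Fin r, ∑ i : Fin r, b j * (if (i : ℕ) < k then w i j else 0)
          - (if (j : ℕ) < k then b j else 0)
          ≤ b k * (∑ i : Fin r, (if (i : ℕ) < k then w i j else 0)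
            - (if (j : ℕ) < k then 1 else 0)) := by
        intro j
        rw [← Finset.mul_sum]
        have h0 : 0 ≤ ∑ i : Fin r, (if (i : ℕ) < k then w i j else 0) :=
          Finset.sum_nonneg fun i _ => by split_ifs <;> simp [hw]
        have h1 : ∑ i : Fin r, (if (i : ℕ) < k then w i j else 0) ≤ 1 :=
          (Finset.sum_le_sum fun i _ => by split_ifs <;> simp [hw]).trans (hcol j)
        split_ifs with hj
        · have := hb hj.le
          nlinarith
        · have := hb (not_lt.1 hj)
          nlinarith
      refine (Finset.sum_le_sum fun j _ => hle j).trans ?_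
      rw [← Finset.mul_sum]
      refine mul_nonpos_of_nonneg_of_nonpos (hb0 k) ?_
      -- The indicators of `j < k` are now paired with the rows `i < k`, so what remains is a sum of
      -- row sums minus one.
      rw [Finset.sum_sub_distrib, Finset.sum_comm, ← Finset.sum_sub_distrib]
      refine Finset.sum_nonpos fun i _ => ?_
      split_ifs
      · linarith [hrow i]
      · simp)
  have he : ∑ i : Fin r, a i * (∑ j : Fin r, b j * w i j - b i)
      = ∑ i : Fin r, ∑ j : Fin r, a i * b j * w i j - ∑ i : Fin r, a i * b i := by
    simp only [mul_sub, Finset.sum_sub_distrib, Finset.mul_sum, mul_assoc]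
  linarith

/-- Bessel's inequality for the unit vector `P i` and the orthonormal columns of `P'`. -/
theorem sum_sq_isometry_products_le {ι κ κ' : Type*} [Fintype ι] [Fintype κ] [Fintype κ']
    [DecidableEq κ] [DecidableEq κ'] {P : Matrix ι κ ℝ} {P' : Matrix ι κ' ℝ}
    (hP : Pᵀ * P = 1) (hP' : P'ᵀ * P' = 1) (i : κ) :
    ∑ j, (Pᵀ * P') i j ^ 2 ≤ 1 := by
  have h := norm_mul_isometry_le hP' (Matrix.replicateRow Unit fun a => P a i)
  have h2 := pow_le_pow_left₀ (norm_nonneg _) h 2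
  rw [norm_sq_eq_sum, norm_sq_eq_sum] at h2
  simpa [Matrix.mul_apply, sum_sq_col_of_isometry hP] using h2

theorem transpose_mul_apply_comm {ι κ κ' : Type*} [Fintype ι] (A : Matrix ι κ ℝ)
    (B : Matrix ι κ' ℝ) (i : κ) (j : κ') : (Aᵀ * B) i j = (Bᵀ * A) j i := by
  simp only [Matrix.mul_apply, Matrix.transpose_apply, mul_comm]

theorem inner_diagonal_products {ι ι' κ : Type*} [Fintype ι] [Fintype ι'] [Fintype κ]
    [DecidableEq κ] (P P' : Matrix ι κ ℝ) (Q Q' : Matrix ι' κ ℝ) (e e' : κ → ℝ) :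
    inner ℝ (P * Matrix.diagonal e * Qᵀ) (P' * Matrix.diagonal e' * Q'ᵀ)
      = ∑ i, ∑ j, e i * e' j * ((Pᵀ * P') i j * (Qᵀ * Q') i j) := by
  rw [inner_mul_right_eq, inner_mul_left_eq]
  have : Pᵀ * (P' * Matrix.diagonal e' * Q'ᵀ * Qᵀᵀ)
      = (Pᵀ * P') * Matrix.diagonal e' * (Qᵀ * Q')ᵀ := by
    simp [Matrix.mul_assoc]
  rw [this, inner_eq_sum]
  refine Finset.sum_congr rfl fun i _ => ?_
  rw [Finset.sum_eq_single i (by simp +contextual) (by simp),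
    Matrix.diagonal_apply_eq, Matrix.mul_apply, Finset.mul_sum]
  refine Finset.sum_congr rfl fun j _ => ?_
  rw [Matrix.mul_diagonal, Matrix.transpose_apply]
  ring

theorem norm_isometry_diagonal_sq {ι ι' κ : Type*} [Fintype ι] [Fintype ι'] [Fintype κ]
    [DecidableEq κ] {P : Matrix ι κ ℝ} {Q : Matrix ι' κ ℝ} (hP : Pᵀ * P = 1) (hQ : Qᵀ * Q = 1)
    (e : κ → ℝ) : ‖P * Matrix.diagonal e * Qᵀ‖ ^ 2 = ∑ i, e i ^ 2 := by
  rw [norm_mul_isometry_transpose hQ, norm_isometry_mul hP, norm_diagonal_sq]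

/-- Mirsky's inequality for the Frobenius norm. -/
theorem sum_sq_sub_le_norm_sub_sq {ι ι' : Type*} [Fintype ι] [Fintype ι'] {r : ℕ}
    {P P' : Matrix ι (Fin r) ℝ} {Q Q' : Matrix ι' (Fin r) ℝ}
    (hP : Pᵀ * P = 1) (hQ : Qᵀ * Q = 1) (hP' : P'ᵀ * P' = 1) (hQ' : Q'ᵀ * Q' = 1)
    {a b : ℕ → ℝ} (ha : Antitone a) (ha0 : ∀ i, 0 ≤ a i) (hb : Antitone b) (hb0 : ∀ i, 0 ≤ b i) :
    ∑ i : Fin r, (a i - b i) ^ 2 ≤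
      ‖P * Matrix.diagonal (fun i : Fin r => a i) * Qᵀ
        - P' * Matrix.diagonal (fun i : Fin r => b i) * Q'ᵀ‖ ^ 2 := by
  rw [norm_sub_sq_real, norm_isometry_diagonal_sq hP hQ, norm_isometry_diagonal_sq hP' hQ',
    inner_diagonal_products]
  -- Products of entries of two contractions are bounded by means of their squares, which form a
  -- doubly substochastic array.
  have h1 : ∑ i : Fin r, ∑ j : Fin r, a i * b j * ((Pᵀ * P') i j * (Qᵀ * Q') i j)
      ≤ ∑ i : Fin r, ∑ j : Fin r,
        a i * b j * (((Pᵀ * P') i j ^ 2 + (Qᵀ * Q') i j ^ 2) / 2) := by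
    refine Finset.sum_le_sum fun i _ => Finset.sum_le_sum fun j _ => ?_
    refine mul_le_mul_of_nonneg_left ?_ (mul_nonneg (ha0 i) (hb0 j))
    nlinarith [sq_nonneg ((Pᵀ * P') i j - (Qᵀ * Q') i j)]
  have h2 := sum_mul_substochastic_le ha ha0 hb hb0
    (w := fun i j : Fin r => ((Pᵀ * P') i j ^ 2 + (Qᵀ * Q') i j ^ 2) / 2)
    (fun i j => by positivity)
    (fun i => by
      rw [← Finset.sum_div, Finset.sum_add_distrib]
      linarith [sum_sq_isometry_products_le hP hP' i, sum_sq_isometry_products_le hQ hQ' i])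
    (fun j => by
      rw [← Finset.sum_div, Finset.sum_add_distrib]
      simp_rw [transpose_mul_apply_comm P P', transpose_mul_apply_comm Q Q']
      linarith [sum_sq_isometry_products_le hP' hP j, sum_sq_isometry_products_le hQ' hQ j])
  have h3 : ∑ i : Fin r, (a i - b i) ^ 2
      = ∑ i : Fin r, a i ^ 2 - 2 * ∑ i : Fin r, a i * b i + ∑ i : Fin r, b i ^ 2 := by
    rw [Finset.mul_sum, ← Finset.sum_sub_distrib, ← Finset.sum_add_distrib]
    exact Finset.sum_congr rfl fun i _ => by ring
  linarith

end Mirsky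

/-! ### Simultaneous alignment of singular subspaces. -/

section Alignment

variable {ι ι' κ : Type*} [Fintype ι] [Fintype ι'] [Fintype κ] [DecidableEq κ]

theorem norm_sq_isometry {P : Matrix ι κ ℝ} (hP : Pᵀ * P = 1) :
    ‖P‖ ^ 2 = Fintype.card κ := by
  simp [norm_sq_eq_sum, sum_sq_col_of_isometry hP]

theorem inner_mul_right_move {κ : Type*} [Fintype κ] (A W : Matrix ι κ ℝ) (Z : Matrix κ κ ℝ) :
    inner ℝ W (A * Z) = inner ℝ (Aᵀ * W) Z := by
  rw [real_inner_comm, inner_mul_left_eq, real_inner_comm]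

theorem isometry_products_diag_le_one {κ : Type*} [DecidableEq κ] {X Y : Matrix ι κ ℝ} (hX : Xᵀ * X = 1) (hY : Yᵀ * Y = 1)
    (i : κ) : (Xᵀ * Y) i i ≤ 1 := by
  rw [Matrix.mul_apply]
  have hx := sum_sq_col_of_isometry hX i
  have hy := sum_sq_col_of_isometry hY i
  have : ∑ j, Xᵀ i j * Y j i ≤ ∑ j, (X j i ^ 2 + Y j i ^ 2) / 2 :=
    Finset.sum_le_sum fun j _ => by
      rw [Matrix.transpose_apply]; nlinarith [sq_nonneg (X j i - Y j i)]
  rw [← Finset.sum_div, Finset.sum_add_distrib, hx, hy] at this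
  linarith

theorem inner_mul_diagonal_self_ge (W : Matrix ι κ ℝ) {e : κ → ℝ} {α : ℝ} (he : ∀ i, α ≤ e i) :
    α * ‖W‖ ^ 2 ≤ inner ℝ W (W * Matrix.diagonal e) := by
  rw [norm_sq_eq_sum, inner_eq_sum, Finset.mul_sum]
  refine Finset.sum_le_sum fun j _ => ?_
  rw [Finset.mul_sum]
  refine Finset.sum_le_sum fun i _ => ?_
  rw [Matrix.mul_diagonal]
  nlinarith [mul_le_mul_of_nonneg_right (he j) (sq_nonneg (W i j))]

theorem inner_diagonal_mul_self_nonneg (K : Matrix κ ι ℝ) {e : κ → ℝ} (he : ∀ i, 0 ≤ e i) :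
    0 ≤ inner ℝ K (Matrix.diagonal e * K) := by
  rw [inner_eq_sum]
  refine Finset.sum_nonneg fun j _ => Finset.sum_nonneg fun i _ => ?_
  rw [Matrix.diagonal_mul]
  nlinarith [mul_nonneg (he i) (sq_nonneg (K i j))]

/-- The orthogonal polar factor of a mean of two products of isometries. -/
theorem exists_orthogonal_inner_ge {P P' : Matrix ι κ ℝ} {Q Q' : Matrix ι' κ ℝ}
    (hP : Pᵀ * P = 1) (hQ : Qᵀ * Q = 1) (hP' : P'ᵀ * P' = 1) (hQ' : Q'ᵀ * Q' = 1)
    {T : Matrix κ κ ℝ} (hT : T = (2⁻¹ : ℝ) • (Pᵀ * P' + Qᵀ * Q')) :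
    ∃ R ∈ Matrix.orthogonalGroup κ ℝ, ‖T‖ ^ 2 ≤ inner ℝ R T := by
  obtain ⟨A, B, s, hA, hB, hs, hTs⟩ := exists_svd_square T
  have hA1 := orthogonal_transpose_mul hA
  have hB1 := orthogonal_transpose_mul hB
  -- Each `s i` is a mean of two inner products of unit vectors. Hence `s i ^ 2 ≤ s i`, which
  -- compares `‖T‖ ^ 2 = ∑ s i ^ 2` with `inner R T = ∑ s i` for the polar factor `R`.
  have hs1 : ∀ i, s i ≤ 1 := by
    intro i
    have h1 : Aᵀ * T * B = Matrix.diagonal s := by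
      rw [hTs, Matrix.mul_assoc, Matrix.mul_assoc, hB1, Matrix.mul_one, ← Matrix.mul_assoc, hA1,
        Matrix.one_mul]
    have h2 : Aᵀ * T * B
        = (2⁻¹ : ℝ) • ((P * A)ᵀ * (P' * B) + (Q * A)ᵀ * (Q' * B)) := by
      rw [hT]
      simp [Matrix.mul_add, Matrix.add_mul, Matrix.mul_assoc]
    have h3 : s i = 2⁻¹ * (((P * A)ᵀ * (P' * B)) i i + ((Q * A)ᵀ * (Q' * B)) i i) := by
      have := congrFun (congrFun (h1.symm.trans h2) i) i
      simpa using this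
    have h5 := isometry_products_diag_le_one (isometry_mul_isometry hP hA1)
      (isometry_mul_isometry hP' hB1) i
    have h6 := isometry_products_diag_le_one (isometry_mul_isometry hQ hA1)
      (isometry_mul_isometry hQ' hB1) i
    linarith
  refine ⟨A * Bᵀ, mul_mem hA ?_, ?_⟩
  · rw [Matrix.mem_orthogonalGroup_iff', Matrix.transpose_transpose]
    exact mul_eq_one_comm.1 hB1
  · have h1 : inner ℝ (A * Bᵀ) T = ∑ i, s i := by
      rw [inner_mul_right_eq, hTs, Matrix.transpose_transpose, Matrix.mul_assoc, hB1,
        Matrix.mul_one]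
      rw [← real_inner_comm, inner_mul_left_eq, hA1, real_inner_comm, inner_eq_trace]
      simp [Matrix.trace]
    rw [h1, hTs, norm_isometry_diagonal_sq hA1 hB1]
    exact Finset.sum_le_sum fun i _ => by nlinarith [hs i, hs1 i]

/-- Simultaneous alignment of the left and right singular subspaces of two matrices of equal rank
whose nonzero singular values are bounded below. -/
theorem exists_orthogonal_alignment {P P' : Matrix ι κ ℝ} {Q Q' : Matrix ι' κ ℝ}
    (hP : Pᵀ * P = 1) (hQ : Qᵀ * Q = 1) (hP' : P'ᵀ * P' = 1) (hQ' : Q'ᵀ * Q' = 1)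
    {e e' : κ → ℝ} (he : ∀ i, 0 ≤ e i) {α : ℝ} (hα : 0 < α) (he' : ∀ i, α ≤ e' i) :
    ∃ R ∈ Matrix.orthogonalGroup κ ℝ,
      ‖P' - P * R‖ ^ 2 + ‖Q' - Q * R‖ ^ 2
        ≤ (2 / α * ‖P' * Matrix.diagonal e' * Q'ᵀ - P * Matrix.diagonal e * Qᵀ‖) ^ 2 := by
  set E := P' * Matrix.diagonal e' * Q'ᵀ - P * Matrix.diagonal e * Qᵀ with hE
  set C := Pᵀ * P' with hC
  set S := Qᵀ * Q' with hS
  set T := (2⁻¹ : ℝ) • (C + S) with hT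
  set K := (2⁻¹ : ℝ) • (C - S) with hK
  set W₁ := P' - P * T with hW₁
  set W₂ := Q' - Q * T with hW₂
  -- The mean `T` is used in both residuals so that their projections onto the old subspaces are
  -- opposite, `K` and `-K`.
  have hK1 : Pᵀ * W₁ = K := by
    rw [hW₁, Matrix.mul_sub, ← Matrix.mul_assoc, hP, Matrix.one_mul, ← hC, hT, hK]
    module
  have hK2 : Qᵀ * W₂ = -K := by
    rw [hW₂, Matrix.mul_sub, ← Matrix.mul_assoc, hQ, Matrix.one_mul, ← hS, hT, hK]
    module
  have hEQ : E * Q' = W₁ * Matrix.diagonal e' + P * (T * Matrix.diagonal e')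
      - P * (Matrix.diagonal e * S) := by
    have h1 : E * Q' = P' * Matrix.diagonal e' - P * (Matrix.diagonal e * S) := by
      rw [hE, Matrix.sub_mul, Matrix.mul_assoc, hQ', Matrix.mul_one]
      simp only [hS, Matrix.mul_assoc]
    rw [h1, hW₁, Matrix.sub_mul, Matrix.mul_assoc P T]
    abel
  have hEP : Eᵀ * P' = W₂ * Matrix.diagonal e' + Q * (T * Matrix.diagonal e')
      - Q * (Matrix.diagonal e * C) := by
    have h1 : Eᵀ * P' = Q' * Matrix.diagonal e' - Q * (Matrix.diagonal e * C) := by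
      rw [hE, Matrix.transpose_sub, Matrix.sub_mul]
      simp only [Matrix.transpose_mul, Matrix.transpose_transpose, Matrix.diagonal_transpose,
        Matrix.mul_assoc, hP', Matrix.mul_one, hC]
    rw [h1, hW₂, Matrix.sub_mul, Matrix.mul_assoc Q T]
    abel
  have hEQn : ‖E * Q'‖ ≤ ‖E‖ := norm_mul_isometry_le hQ' E
  have hEPn : ‖Eᵀ * P'‖ ≤ ‖E‖ := by
    rw [← Matrix.frobenius_norm_transpose E]
    exact norm_mul_isometry_le hP' Eᵀ
  -- In the sum of the two inner products the terms with `T * diagonal e'` cancel, and those with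
  -- `diagonal e` add up to `2 * inner K (diagonal e * K)`, which is nonnegative. No lower bound on
  -- `e` and no gap between singular values is needed.
  have hsum : α * (‖W₁‖ ^ 2 + ‖W₂‖ ^ 2) ≤ inner ℝ W₁ (E * Q') + inner ℝ W₂ (Eᵀ * P') := by
    rw [hEQ, hEP, inner_sub_right, inner_sub_right, inner_add_right, inner_add_right,
      inner_mul_right_move P, inner_mul_right_move P,
      inner_mul_right_move Q, inner_mul_right_move Q, hK1, hK2, inner_neg_left, inner_neg_left]
    have h1 := inner_mul_diagonal_self_ge W₁ he'
    have h2 := inner_mul_diagonal_self_ge W₂ he'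
    have h3 := inner_diagonal_mul_self_nonneg K he
    have h4 : inner ℝ K (Matrix.diagonal e * K)
        = 2⁻¹ * (inner ℝ K (Matrix.diagonal e * C) - inner ℝ K (Matrix.diagonal e * S)) := by
      rw [← inner_sub_right, ← Matrix.mul_sub, ← inner_smul_right, ← Matrix.mul_smul]
    linarith
  have hw : ‖W₁‖ ^ 2 + ‖W₂‖ ^ 2 ≤ 2 * (‖E‖ / α) ^ 2 := by
    have h1 : inner ℝ W₁ (E * Q') ≤ ‖W₁‖ * ‖E‖ :=
      (real_inner_le_norm _ _).trans (mul_le_mul_of_nonneg_left hEQn (norm_nonneg _))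
    have h2 : inner ℝ W₂ (Eᵀ * P') ≤ ‖W₂‖ * ‖E‖ :=
      (real_inner_le_norm _ _).trans (mul_le_mul_of_nonneg_left hEPn (norm_nonneg _))
    have h3 : ‖W₁‖ ^ 2 + ‖W₂‖ ^ 2 ≤ (‖W₁‖ + ‖W₂‖) * (‖E‖ / α) := by
      rw [mul_div_assoc', le_div_iff₀ hα]
      linarith
    nlinarith [sq_nonneg (‖W₁‖ - ‖E‖ / α), sq_nonneg (‖W₂‖ - ‖E‖ / α)]
  obtain ⟨R, hR, hRT⟩ := exists_orthogonal_inner_ge hP hQ hP' hQ' hT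
  refine ⟨R, hR, ?_⟩
  have hR1 := orthogonal_transpose_mul hR
  -- With `N` the cardinality of `κ`, the left side of the claim is `4 * N - 4 * inner R T`, at most
  -- `4 * N - 4 * ‖T‖ ^ 2`, which is twice `‖W₁‖ ^ 2 + ‖W₂‖ ^ 2`. With `hw` this gives the constant
  -- `2 / α`.
  have hn1 : ‖P' - P * R‖ ^ 2 = 2 * Fintype.card κ - 2 * inner ℝ R C := by
    rw [norm_sub_sq_real, norm_sq_isometry hP', norm_sq_isometry (isometry_mul_isometry hP hR1),
      inner_mul_right_move, ← hC, real_inner_comm]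
    ring
  have hn2 : ‖Q' - Q * R‖ ^ 2 = 2 * Fintype.card κ - 2 * inner ℝ R S := by
    rw [norm_sub_sq_real, norm_sq_isometry hQ', norm_sq_isometry (isometry_mul_isometry hQ hR1),
      inner_mul_right_move, ← hS, real_inner_comm]
    ring
  have hn3 : ‖W₁‖ ^ 2 = Fintype.card κ - 2 * inner ℝ T C + ‖T‖ ^ 2 := by
    rw [hW₁, norm_sub_sq_real, norm_sq_isometry hP', norm_isometry_mul hP,
      inner_mul_right_move, ← hC, real_inner_comm]
  have hn4 : ‖W₂‖ ^ 2 = Fintype.card κ - 2 * inner ℝ T S + ‖T‖ ^ 2 := by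
    rw [hW₂, norm_sub_sq_real, norm_sq_isometry hQ', norm_isometry_mul hQ,
      inner_mul_right_move, ← hS, real_inner_comm]
  have hsp : ∀ Z : Matrix κ κ ℝ, inner ℝ Z T = 2⁻¹ * (inner ℝ Z C + inner ℝ Z S) := by
    intro Z
    rw [hT, inner_smul_right, inner_add_right]
  have hTT := hsp T
  rw [real_inner_self_eq_norm_sq] at hTT
  have hRs := hsp R
  have : (2 / α * ‖E‖) ^ 2 = 4 * (‖E‖ / α) ^ 2 := by ring
  rw [this]
  linarith

end Alignment

/-! ### Singular values and rank read off from balanced decompositions. -/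

section SingularValues

theorem sum_castLE_eq {r l : ℕ} (h : r ≤ l) (g : Fin l → ℝ) (hg : ∀ i : Fin l, r ≤ i → g i = 0) :
    ∑ i : Fin r, g (Fin.castLE h i) = ∑ i, g i :=
  Fintype.sum_of_injective (Fin.castLE h) (Fin.castLE_injective h) _ _
    (fun i hi => hg i (by
      by_contra hlt
      exact hi ⟨⟨i, not_le.1 hlt⟩, rfl⟩)) fun _ => rfl

theorem toEuclideanLin_adjoint_comp_self {a b : ℕ} (X : Mat a b) :
    (Matrix.toEuclideanLin X).adjoint ∘ₗ Matrix.toEuclideanLin X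
      = Matrix.toEuclideanLin (Xᵀ * X) := by
  rw [← Matrix.toEuclideanLin_conjTranspose_eq_adjoint,
    Matrix.conjTranspose_eq_transpose_of_trivial, Matrix.toLpLin_mul_same]

theorem sv_nonneg {a b : ℕ} (X : Mat a b) (i : ℕ) : 0 ≤ sv X i :=
  LinearMap.singularValues_nonneg _ i

theorem sv_antitone {a b : ℕ} (X : Mat a b) : Antitone (sv X) :=
  LinearMap.singularValues_antitone _

/-- Singular values read off from an ordered spectral decomposition of `Xᵀ X`. -/
theorem sv_eq_sqrt {a b : ℕ} (X : Mat a b) {Q : Mat b b}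
    (hQ : Q ∈ Matrix.orthogonalGroup (Fin b) ℝ) {e : Fin b → ℝ} (he : Antitone e)
    (h : Xᵀ * X = Q * Matrix.diagonal e * Qᵀ) (i : Fin b) : sv X i = Real.sqrt (e i) := by
  have hQ1 := orthogonal_transpose_mul hQ
  have hn : Module.finrank ℝ (EuclideanSpace ℝ (Fin b)) = b := finrank_euclideanSpace_fin
  refine (LinearMap.singularValues_fin (Matrix.toEuclideanLin X) hn i).trans ?_
  congr 1
  have hs := (Matrix.toEuclideanLin X).isSymmetric_adjoint_comp_self
  have h1 := hs.sort_roots_charpoly_eq_eigenvalues hn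
  -- The eigenvalues in descending order are the sorted roots of the characteristic polynomial, and
  -- `e` is already sorted.
  have h2 : ((Matrix.toEuclideanLin X).adjoint ∘ₗ Matrix.toEuclideanLin X).charpoly
      = (Matrix.diagonal e).charpoly := by
    rw [toEuclideanLin_adjoint_comp_self, h, Matrix.toEuclideanLin_eq_toLin_orthonormal,
      Matrix.charpoly_toLin, Matrix.charpoly_mul_comm, ← Matrix.mul_assoc, hQ1, Matrix.one_mul]
  have h3 : (Matrix.diagonal e).charpoly.roots = Multiset.map e Finset.univ.val := by
    rw [Matrix.charpoly_diagonal, Polynomial.roots_prod _ _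
      (Finset.prod_ne_zero_iff.2 fun i _ => Polynomial.X_sub_C_ne_zero _)]
    simp
  rw [h2, h3, Fin.univ_val_map, Multiset.map_coe, List.map_ofFn, Multiset.coe_sort] at h1
  have h4 : (List.ofFn e).mergeSort (fun x y => decide (x ≥ y)) = List.ofFn e := by
    apply List.mergeSort_of_pairwise
    simp_rw [decide_eq_true_eq]
    rw [← List.sortedGE_iff_pairwise]
    exact he.sortedGE_ofFn
  have h5 : (RCLike.re : ℝ → ℝ) ∘ e = e := rfl
  rw [h5, h4] at h1
  exact (congrFun (List.ofFn_injective h1) i).symm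

/-- `X = P Diag(d)² Qᵀ` with orthonormal columns in `P`, `Q` and `d` nonnegative, descending. -/
structure IsBalanced {n m r : ℕ} (X : Mat n m) (P : Mat n r) (d : Fin r → ℝ) (Q : Mat m r) :
    Prop where
  orthP : Pᵀ * P = 1
  orthQ : Qᵀ * Q = 1
  nonneg : ∀ i, 0 ≤ d i
  anti : Antitone d
  eq : X = P * Matrix.diagonal (fun i => d i ^ 2) * Qᵀ

namespace IsBalanced

variable {n m r : ℕ} {X : Mat n m} {P : Mat n r} {d : Fin r → ℝ} {Q : Mat m r}

theorem transpose (h : IsBalanced X P d Q) : IsBalanced Xᵀ Q d P where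
  orthP := h.orthQ
  orthQ := h.orthP
  nonneg := h.nonneg
  anti := h.anti
  eq := by rw [h.eq]; simp [Matrix.mul_assoc]

/-- Completing `Q` to an orthogonal matrix diagonalizes `Xᵀ * X`; padding `d` with zeros keeps it
descending because `d` is nonnegative. -/
theorem sv_eq (h : IsBalanced X P d Q) (hrm : r ≤ m) (j : Fin m) :
    sv X j = if hj : (j : ℕ) < r then d ⟨j, hj⟩ ^ 2 else 0 := by
  obtain ⟨Qf, hQf, hQfs⟩ := exists_orthogonal_extension hrm h.orthQ
  have hX : Xᵀ * X = Qf * Matrix.diagonal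
      (fun j : Fin m => (if hj : (j : ℕ) < r then d ⟨j, hj⟩ ^ 2 else 0) ^ 2) * Qfᵀ := by
    have h1 : Xᵀ * X = Q * Matrix.diagonal (fun i => (d i ^ 2) ^ 2) * Qᵀ := by
      rw [h.eq]
      simp only [Matrix.transpose_mul, Matrix.transpose_transpose, Matrix.diagonal_transpose,
        Matrix.mul_assoc]
      rw [← Matrix.mul_assoc Pᵀ, h.orthP, Matrix.one_mul, ← Matrix.mul_assoc (Matrix.diagonal _),
        Matrix.diagonal_mul_diagonal]
      simp only [sq]
    rw [h1]
    ext a b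
    rw [Matrix.mul_apply, Matrix.mul_apply, ← sum_castLE_eq hrm]
    · refine Finset.sum_congr rfl fun k _ => ?_
      simp [Matrix.mul_diagonal, ← hQfs]
    · intro i hi
      simp [Matrix.mul_diagonal, not_lt.2 hi]
  rw [sv_eq_sqrt X hQf ?_ hX j, Real.sqrt_sq]
  · split_ifs <;> positivity
  · intro i j hij
    have hij' : (i : ℕ) ≤ j := hij
    dsimp only
    by_cases hj : (j : ℕ) < r
    · rw [dif_pos hj, dif_pos (hij'.trans_lt hj)]
      have := h.anti (show (⟨i, hij'.trans_lt hj⟩ : Fin r) ≤ ⟨j, hj⟩ from hij')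
      have h0 := h.nonneg ⟨j, hj⟩
      gcongr
    · rw [dif_neg hj]
      simp only [ne_eq, OfNat.ofNat_ne_zero, not_false_eq_true, zero_pow]
      positivity

theorem sv_fin (h : IsBalanced X P d Q) (hrm : r ≤ m) (i : Fin r) : sv X i = d i ^ 2 := by
  have := h.sv_eq hrm (Fin.castLE hrm i)
  simpa using this

theorem sv_of_le (h : IsBalanced X P d Q) (hrm : r ≤ m) {i : ℕ} (hi : r ≤ i) : sv X i = 0 := by
  by_cases him : i < m
  · have := h.sv_eq hrm ⟨i, him⟩
    simpa [not_lt.2 hi] using this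
  · exact LinearMap.singularValues_of_finrank_le _ (by simpa using not_lt.1 him)

theorem diagonal_eq (h : IsBalanced X P d Q) :
    Pᵀ * X * Q = Matrix.diagonal (fun i => d i ^ 2) := by
  rw [h.eq]
  simp only [Matrix.mul_assoc]
  rw [h.orthQ, Matrix.mul_one, ← Matrix.mul_assoc, h.orthP, Matrix.one_mul]

open Classical in
theorem rank_eq (h : IsBalanced X P d Q) : X.rank = Fintype.card {i // d i ≠ 0} := by
  have h1 : (Matrix.diagonal (fun i => d i ^ 2)).rank = Fintype.card {i // d i ≠ 0} := by
    rw [Matrix.rank_diagonal]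
    simp
  rw [← h1]
  apply le_antisymm
  · conv_lhs => rw [h.eq]
    exact (Matrix.rank_mul_le_left _ _).trans (Matrix.rank_mul_le_right _ _)
  · rw [← h.diagonal_eq]
    exact (Matrix.rank_mul_le_left _ _).trans (Matrix.rank_mul_le_right _ _)

theorem rank_le (h : IsBalanced X P d Q) : X.rank ≤ r := by
  classical
  rw [h.rank_eq]
  exact (Fintype.card_subtype_le _).trans (by simp)

/-- Assumption 1 speaks of full decompositions; extending the given thin bases, instead of choosing
new ones, makes it apply to the very pair that the algorithm produces. -/
theorem exists_fullSVD (h : IsBalanced X P d Q) (hrn : r ≤ n) (hnm : n ≤ m) :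
    ∃ Pf Qf, IsFullSVD X Pf Qf ∧ Pf.submatrix id (Fin.castLE hrn) = P ∧
      Qf.submatrix id (Fin.castLE (hrn.trans hnm)) = Q := by
  obtain ⟨Pf, hPf, hPfs⟩ := exists_orthogonal_extension hrn h.orthP
  obtain ⟨Qf, hQf, hQfs⟩ := exists_orthogonal_extension (hrn.trans hnm) h.orthQ
  refine ⟨Pf, Qf, ⟨hPf, hQf, ?_⟩, hPfs, hQfs⟩
  ext a b
  conv_lhs => rw [h.eq]
  rw [Matrix.mul_assoc Pf, Matrix.mul_apply, Matrix.mul_apply, ← sum_castLE_eq hrn]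
  · refine Finset.sum_congr rfl fun k _ => ?_
    have hmid : ∀ A : Mat n m, (A * Qfᵀ) (Fin.castLE hrn k) b
        = ∑ j, A (Fin.castLE hrn k) j * Qf b j := fun A => Matrix.mul_apply
    rw [hmid, Finset.sum_eq_single (Fin.castLE (hrn.trans hnm) k)]
    · simp [Matrix.mul_diagonal, ← hPfs, ← hQfs, h.sv_fin (hrn.trans hnm), mul_assoc]
    · intro j _ hj
      have : (k : ℕ) ≠ j := fun hkj => hj (Fin.ext hkj.symm)
      simp [this]
    · simp
  · intro i hi
    rw [Matrix.mul_apply, Finset.sum_eq_zero, mul_zero]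
    intro j _
    by_cases hij : (i : ℕ) = j
    · simp [hij, h.sv_of_le (hrn.trans hnm) (hij ▸ hi)]
    · simp [hij]

end IsBalanced

end SingularValues

/-! ### Leading columns and alignment of balanced factor pairs. -/

section BalancedAlignment

variable {r ρ : ℕ}

theorem leadCols_apply {l : ℕ} (Z : Mat l r) (i : Fin l) (j : Lead r ρ) :
    leadCols ρ Z i j = Z i j.1 := rfl

theorem leadCols_sub {l : ℕ} (A B : Mat l r) :
    leadCols ρ (A - B) = leadCols ρ A - leadCols ρ B := rfl

theorem sum_lead_eq (g : Fin r → ℝ) (hg : ∀ i : Fin r, ρ ≤ i → g i = 0) :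
    ∑ i : Lead r ρ, g i.1 = ∑ i, g i :=
  Fintype.sum_of_injective Subtype.val Subtype.val_injective _ _
    (fun i hi => hg i (by
      by_contra hlt
      exact hi ⟨⟨i, not_le.1 hlt⟩, rfl⟩)) fun _ => rfl

theorem norm_leadCols_eq {l : ℕ} {Z : Mat l r} (hZ : ∀ i (j : Fin r), ρ ≤ j → Z i j = 0) :
    ‖leadCols ρ Z‖ = ‖Z‖ := by
  refine (sq_eq_sq₀ (norm_nonneg _) (norm_nonneg _)).1 ?_
  rw [norm_sq_eq_sum, norm_sq_eq_sum]
  exact sum_lead_eq (fun j => ∑ i, Z i j ^ 2) fun j hj => by simp [hZ _ j hj]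

theorem norm_leadCols_le {l : ℕ} (Z : Mat l r) : ‖leadCols ρ Z‖ ≤ ‖Z‖ := by
  refine le_of_sq_le_sq ?_ (norm_nonneg _)
  rw [norm_sq_eq_sum, norm_sq_eq_sum]
  have := Finset.sum_le_sum_of_subset_of_nonneg
    (Finset.subset_univ (Finset.univ.filter fun j : Fin r => (j : ℕ) < ρ))
    (f := fun j => ∑ i, Z i j ^ 2) (fun j _ _ => by positivity)
  rw [Finset.sum_subtype (p := fun j : Fin r => (j : ℕ) < ρ) _ (by simp)] at this
  exact this

theorem leadCols_isometry {l : ℕ} {P : Mat l r} (hP : Pᵀ * P = 1) :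
    (leadCols ρ P)ᵀ * leadCols ρ P = 1 := by
  ext i j
  have := congrFun (congrFun hP i.1) j.1
  simp only [Matrix.one_apply, Subtype.ext_iff] at this ⊢
  exact this

theorem mul_blk_apply_of_le {l : ℕ} (Z : Mat l r) (A : Matrix (Lead r ρ) (Lead r ρ) ℝ)
    (i : Fin l) {j : Fin r} (hj : ρ ≤ j) : (Z * blk A) i j = 0 := by
  rw [Matrix.mul_apply]
  exact Finset.sum_eq_zero fun k _ => by simp [blk, not_lt.2 hj]

theorem leadCols_mul_blk {l : ℕ} (Z : Mat l r) (A : Matrix (Lead r ρ) (Lead r ρ) ℝ) :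
    leadCols ρ (Z * blk A) = leadCols ρ Z * A := by
  ext i j
  rw [leadCols_apply, Matrix.mul_apply, Matrix.mul_apply,
    ← sum_lead_eq (ρ := ρ) (fun k => Z i k * blk A k j.1)]
  · refine Finset.sum_congr rfl fun k _ => ?_
    simp [blk, k.2, j.2, leadCols_apply]
  · intro k hk
    simp [blk, not_lt.2 hk]

theorem leadCols_mul_diagonal {l : ℕ} (Z : Mat l r) (d : Fin r → ℝ) :
    leadCols ρ (Z * Matrix.diagonal d)
      = leadCols ρ Z * Matrix.diagonal (fun i : Lead r ρ => d i) := by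
  ext i j
  simp [leadCols_apply, Matrix.mul_diagonal]

/-- The reason for conjugating by the diagonal: it moves `R` to the other side, so that on the
leading block `(P * D) * (D⁻¹ * R * D) = (P * R) * D` and `R` rotates the orthonormal basis. -/
theorem diagonal_mul_conjD {d : Fin r → ℝ} (hd : ∀ i : Fin r, (i : ℕ) < ρ → d i ≠ 0)
    (R : Matrix (Lead r ρ) (Lead r ρ) ℝ) :
    Matrix.diagonal (fun i : Lead r ρ => d i) * conjD d R
      = R * Matrix.diagonal (fun i : Lead r ρ => d i) := by
  rw [conjD, ← Matrix.mul_assoc, ← Matrix.mul_assoc, Matrix.mul_nonsing_inv, Matrix.one_mul]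
  rw [Matrix.det_diagonal, isUnit_iff_ne_zero, Finset.prod_ne_zero_iff]
  exact fun i _ => hd i i.2

/-- This reduces a rank-deficient matrix to its leading block, where the singular values are bounded
below as the alignment theorem requires. -/
theorem mul_diagonal_leadCols {n m : ℕ} (P : Mat n r) (Q : Mat m r) {e : Fin r → ℝ}
    (he : ∀ i : Fin r, ρ ≤ i → e i = 0) :
    leadCols ρ P * Matrix.diagonal (fun i : Lead r ρ => e i) * (leadCols ρ Q)ᵀ
      = P * Matrix.diagonal e * Qᵀ := by
  ext a b
  rw [Matrix.mul_apply, Matrix.mul_apply,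
    ← sum_lead_eq (ρ := ρ) (fun k => (P * Matrix.diagonal e) a k * Qᵀ k b)]
  · refine Finset.sum_congr rfl fun k _ => ?_
    simp [Matrix.mul_diagonal, leadCols_apply]
  · intro k hk
    simp [Matrix.mul_diagonal, he k hk]

/-- The factor pairs built from two balanced decompositions of the same rank can be aligned by a
common orthogonal matrix. -/
theorem IsBalanced.exists_alignment {n m : ℕ} {X X' : Mat n m} {P P' : Mat n r} {d d' : Fin r → ℝ}
    {Q Q' : Mat m r} (h : IsBalanced X P d Q) (h' : IsBalanced X' P' d' Q') (hrm : r ≤ m)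
    {α β : ℝ} (hα : 0 < α) (hβ : 0 ≤ β) (hdβ : ∀ i, d i ≤ β)
    (hd : ∀ i : Fin r, (i : ℕ) < ρ → α ≤ d i ^ 2) (hd0 : ∀ i : Fin r, ρ ≤ i → d i = 0)
    (hd' : ∀ i : Fin r, (i : ℕ) < ρ → α ≤ d' i ^ 2) (hd0' : ∀ i : Fin r, ρ ≤ i → d' i = 0) :
    ∃ R ∈ Matrix.orthogonalGroup (Lead r ρ) ℝ,
      max ‖P' * Matrix.diagonal d' - P * Matrix.diagonal d * blk (conjD d R)‖
        ‖Q' * Matrix.diagonal d' - Q * Matrix.diagonal d * blk (conjD d R)‖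
      ≤ (Real.sqrt α + 4 * β) / (2 * α) * ‖X' - X‖ := by
  have hne : ∀ i : Fin r, (i : ℕ) < ρ → d i ≠ 0 := fun i hi h0 => by
    have := hd i hi
    rw [h0] at this
    simp at this
    linarith
  obtain ⟨R, hR, hRle⟩ := exists_orthogonal_alignment
    (leadCols_isometry (ρ := ρ) h.orthP) (leadCols_isometry (ρ := ρ) h.orthQ)
    (leadCols_isometry (ρ := ρ) h'.orthP) (leadCols_isometry (ρ := ρ) h'.orthQ)
    (e := fun i => d i ^ 2) (e' := fun i => d' i ^ 2) (fun i => sq_nonneg _) hα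
    (fun i => hd' i i.2)
  rw [mul_diagonal_leadCols P Q (e := fun i => d i ^ 2) (fun i hi => by simp [hd0 i hi]),
    mul_diagonal_leadCols P' Q' (e := fun i => d' i ^ 2) (fun i hi => by simp [hd0' i hi]),
    ← h.eq, ← h'.eq] at hRle
  have hP := abs_le_of_sq_le_sq' ((le_add_of_nonneg_right (sq_nonneg _)).trans hRle) (by positivity)
  have hQ := abs_le_of_sq_le_sq' ((le_add_of_nonneg_left (sq_nonneg _)).trans hRle) (by positivity)
  have hsα : 0 < Real.sqrt α := Real.sqrt_pos.2 hα
  -- Mirsky's inequality compares the squares of `d'` and `d`; factoring `d' ^ 2 - d ^ 2` and using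
  -- `d' + d ≥ 2 * √α` on the leading indices passes to the square roots.
  have hmirsky : ‖(Matrix.diagonal (fun i => d' i - d i) : Mat r r)‖
      ≤ ‖X' - X‖ / (2 * Real.sqrt α) := by
    rw [le_div_iff₀ (by positivity)]
    refine le_of_sq_le_sq ?_ (norm_nonneg _)
    have hm := sum_sq_sub_le_norm_sub_sq h'.orthP h'.orthQ h.orthP h.orthQ
      (sv_antitone X') (sv_nonneg X') (sv_antitone X) (sv_nonneg X)
    simp only [h.sv_fin hrm, h'.sv_fin hrm, ← h.eq, ← h'.eq] at hm
    refine le_trans ?_ hm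
    rw [mul_pow, norm_diagonal_sq, Finset.sum_mul]
    refine Finset.sum_le_sum fun i _ => ?_
    by_cases hi : (i : ℕ) < ρ
    · have h1 : Real.sqrt α ≤ d i := Real.sqrt_le_iff.2 ⟨h.nonneg i, hd i hi⟩
      have h2 : Real.sqrt α ≤ d' i := Real.sqrt_le_iff.2 ⟨h'.nonneg i, hd' i hi⟩
      have h3 : (d' i ^ 2 - d i ^ 2) ^ 2 = (d' i - d i) ^ 2 * (d' i + d i) ^ 2 := by ring
      rw [h3]
      refine mul_le_mul_of_nonneg_left ?_ (sq_nonneg _)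
      exact pow_le_pow_left₀ (by positivity) (by linarith) 2
    · simp [hd0 i (not_lt.1 hi), hd0' i (not_lt.1 hi)]
  have key : ∀ {l : ℕ} (A A' : Mat l r), A'ᵀ * A' = 1 →
      ‖leadCols ρ A' - leadCols ρ A * R‖ ≤ 2 / α * ‖X' - X‖ →
      ‖A' * Matrix.diagonal d' - A * Matrix.diagonal d * blk (conjD d R)‖
        ≤ (Real.sqrt α + 4 * β) / (2 * α) * ‖X' - X‖ := by
    intro l A A' hA' hle
    have h0 : ∀ i (j : Fin r), ρ ≤ j →
        (A' * Matrix.diagonal d' - A * Matrix.diagonal d * blk (conjD d R)) i j = 0 := by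
      intro i j hj
      rw [Matrix.sub_apply, mul_blk_apply_of_le _ _ _ hj, Matrix.mul_diagonal, hd0' j hj]
      simp
    -- The error splits into the change of the diagonal in the new basis and the misalignment of the
    -- bases, scaled by the old diagonal.
    have h1 : leadCols ρ (A' * Matrix.diagonal d' - A * Matrix.diagonal d * blk (conjD d R))
        = leadCols ρ (A' * Matrix.diagonal (fun i => d' i - d i))
          + (leadCols ρ A' - leadCols ρ A * R) * Matrix.diagonal (fun i : Lead r ρ => d i) := by
      rw [leadCols_sub, leadCols_mul_blk, leadCols_mul_diagonal, leadCols_mul_diagonal,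
        leadCols_mul_diagonal, Matrix.mul_assoc, diagonal_mul_conjD hne, Matrix.sub_mul,
        Matrix.mul_assoc, ← Matrix.diagonal_sub, Matrix.mul_sub]
      abel
    rw [← norm_leadCols_eq h0, h1]
    refine (norm_add_le _ _).trans ?_
    have h2 : ‖leadCols ρ (A' * Matrix.diagonal (fun i => d' i - d i))‖
        ≤ ‖X' - X‖ / (2 * Real.sqrt α) :=
      (norm_leadCols_le _).trans (by rw [norm_isometry_mul hA']; exact hmirsky)
    have h3 : ‖(leadCols ρ A' - leadCols ρ A * R) * Matrix.diagonal (fun i : Lead r ρ => d i)‖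
        ≤ β * (2 / α * ‖X' - X‖) :=
      (norm_mul_diagonal_le _ hβ fun i => by
        rw [abs_of_nonneg (h.nonneg _)]; exact hdβ _).trans (mul_le_mul_of_nonneg_left hle hβ)
    -- The constant arises as `1 / (2 * √α) + 2 * β / α = (√α + 4 * β) / (2 * α)`.
    refine (add_le_add h2 h3).trans (le_of_eq ?_)
    have h4 : α = Real.sqrt α * Real.sqrt α := (Real.mul_self_sqrt hα.le).symm
    rw [show ‖X' - X‖ / (2 * Real.sqrt α) = Real.sqrt α * ‖X' - X‖ / (2 * α) by
      rw [div_eq_div_iff (by positivity) (by positivity)]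
      nth_rewrite 1 [h4]
      ring]
    field_simp
    ring
  exact ⟨R, hR, max_le (key P P' h'.orthP hP.2) (key Q Q' h'.orthQ hQ.2)⟩

end BalancedAlignment

/-! ### Descent inequality and the derivative of a function of the norm. -/

section SmoothDescent

variable {E : Type*} [NormedAddCommGroup E] [InnerProductSpace ℝ E]

/-- Quadratic upper bound for a function with Lipschitz gradient. -/
theorem le_add_inner_add_sq_of_lipschitz_gradient [CompleteSpace E] {f : E → ℝ}
    (hf : Differentiable ℝ f) {L : ℝ≥0} (hL : LipschitzWith L (gradient f)) (x y : E) :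
    f y ≤ f x + inner ℝ (gradient f x) (y - x) + L / 2 * ‖y - x‖ ^ 2 := by
  set v := y - x with hv
  set φ : ℝ → ℝ := fun t => f (x + t • v) - t * inner ℝ (gradient f x) v
    - L / 2 * t ^ 2 * ‖v‖ ^ 2 with hφ
  have hd : ∀ t, HasDerivAt φ (inner ℝ (gradient f (x + t • v)) v - inner ℝ (gradient f x) v
      - L * t * ‖v‖ ^ 2) t := by
    intro t
    have h1 : HasDerivAt (fun t : ℝ => x + t • v) v t := by
      simpa using ((hasDerivAt_id t).smul_const v).const_add x
    have h2 := (hf (x + t • v)).hasGradientAt.hasFDerivAt.comp_hasDerivAt t h1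
    have h3 := (h2.sub ((hasDerivAt_id t).mul_const (inner ℝ (gradient f x) v))).sub
      ((((hasDerivAt_pow 2 t).const_mul (L / 2 : ℝ))).mul_const (‖v‖ ^ 2))
    refine HasDerivAt.congr_deriv h3 ?_
    rw [InnerProductSpace.toDual_apply_apply]
    push_cast
    simp only [pow_one]
    ring
  -- The claim is `φ 1 ≤ φ 0`; the derivative is nonpositive since the gradient moves by at most `L
  -- * t * ‖v‖` at distance `t * ‖v‖`.
  have hanti : AntitoneOn φ (Icc 0 1) := by
    refine antitoneOn_of_deriv_nonpos (convex_Icc 0 1)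
      (fun t _ => (hd t).continuousAt.continuousWithinAt)
      (fun t _ => (hd t).differentiableAt.differentiableWithinAt) ?_
    intro t ht
    rw [interior_Icc] at ht
    rw [(hd t).deriv, ← inner_sub_left]
    have h1 := real_inner_le_norm (gradient f (x + t • v) - gradient f x) v
    have h2 := hL.norm_sub_le (x + t • v) x
    rw [add_sub_cancel_left, norm_smul, Real.norm_of_nonneg ht.1.le] at h2
    nlinarith [mul_le_mul_of_nonneg_right h2 (norm_nonneg v)]
  have h := hanti (left_mem_Icc.2 zero_le_one) (right_mem_Icc.2 zero_le_one) zero_le_one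
  simp only [hφ, one_smul, zero_smul, hv, add_sub_cancel, add_zero] at h
  linarith

theorem hasFDerivAt_comp_norm {τ : ℝ → ℝ} {τ' : ℝ} {w : E} (hw : w ≠ 0)
    (hτ : HasDerivAt τ τ' ‖w‖) :
    HasFDerivAt (fun u => τ ‖u‖) ((τ' / ‖w‖) • innerSL ℝ w) w := by
  have hw0 : ‖w‖ ≠ 0 := norm_ne_zero_iff.2 hw
  have h1 : HasFDerivAt (fun u : E => ‖u‖) (‖w‖⁻¹ • innerSL ℝ w) w := by
    have h2 := (hasStrictFDerivAt_norm_sq w).hasFDerivAt.sqrt (by positivity)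
    simp only [Real.sqrt_sq (norm_nonneg _)] at h2
    convert h2 using 1
    rw [← Nat.cast_smul_eq_nsmul ℝ, smul_smul]
    congr 1
    push_cast
    field_simp
  have h3 := hτ.comp_hasFDerivAt w h1
  rwa [smul_smul, ← div_eq_mul_inv] at h3

end SmoothDescent

/-! ### The problem for a single column. -/

section ColumnProblem

variable {E : Type*} [NormedAddCommGroup E] [InnerProductSpace ℝ E]

/-- The objective of the subproblem for a single column. -/
def colObj (τ : ℝ → ℝ) (lam mu c : ℝ) (g w₀ u : E) : ℝ :=
  inner ℝ g (u - w₀) + c / 2 * ‖u - w₀‖ ^ 2 + lam * τ ‖u‖ + mu / 2 * ‖u‖ ^ 2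

variable {τ : ℝ → ℝ} {lam mu c : ℝ} {g w₀ w : E}

/-- A nonzero minimizer has for its norm a nonzero proximal point of `τ` with parameter
`λ / β`. -/
theorem exists_prox_of_colObj_min (hτ0 : τ 0 = 0) (hτ : ∀ t, 0 ≤ t → 0 ≤ τ t) (hlam : 0 < lam)
    (hmu : 0 < mu) (hc : 0 ≤ c) {β : ℝ} (hβ : c + mu ≤ β) (hw : w ≠ 0)
    (hmin : ∀ u, colObj τ lam mu c g w₀ w ≤ colObj τ lam mu c g w₀ u) :
    ∃ t, 0 ≤ t ∧ ∀ y, 0 ≤ y →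
      1 / (2 * (lam * β⁻¹)) * (t - ‖w‖) ^ 2 + τ ‖w‖
        ≤ 1 / (2 * (lam * β⁻¹)) * (t - y) ^ 2 + τ y := by
  set x := ‖w‖ with hx
  have hx0 : 0 < x := norm_pos_iff.2 hw
  have hβ0 : 0 < β := by linarith
  set s := inner ℝ (c • w₀ - g) w / x with hs
  -- Restriction to the ray through `w` leaves a scalar quadratic plus `lam * τ y`.
  have hexp : ∀ y, 0 ≤ y → colObj τ lam mu c g w₀ ((y / x) • w)
      = (c + mu) / 2 * y ^ 2 - s * y + lam * τ y
        + (c / 2 * ‖w₀‖ ^ 2 - inner ℝ g w₀) := by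
    intro y hy
    have hn : ‖(y / x) • w‖ = y := by
      rw [norm_smul, Real.norm_of_nonneg (by positivity), ← hx, div_mul_cancel₀ _ hx0.ne']
    rw [colObj, norm_sub_sq_real, hn, inner_sub_right, inner_smul_right, real_inner_smul_left,
      hs, inner_sub_left, real_inner_smul_left, real_inner_comm w₀ w]
    field_simp
    ring
  have hq : ∀ y, 0 ≤ y → (c + mu) / 2 * x ^ 2 - s * x + lam * τ x
      ≤ (c + mu) / 2 * y ^ 2 - s * y + lam * τ y := by
    intro y hy
    have h1 := hexp x hx0.le
    rw [div_self hx0.ne', one_smul] at h1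
    have h2 := hexp y hy
    have h3 := hmin ((y / x) • w)
    linarith
  -- With `s < 0` the point `y = 0` would be strictly better than `x`. The sign makes the prox
  -- center nonnegative, the only case that Assumption 2 covers.
  have hs0 : 0 ≤ s := by
    have h := hq 0 le_rfl
    rw [hτ0] at h
    have h1 := mul_nonneg hlam.le (hτ x hx0.le)
    by_contra hneg
    have : 0 < (c + mu) / 2 * x ^ 2 := by positivity
    nlinarith
  -- Adding `(β - (c + mu)) / 2 * (y - x) ^ 2`, which vanishes at `x`, keeps `x` a minimizer and
  -- raises the leading coefficient to `β`. Completing the square gives this center.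
  refine ⟨(s + (β - (c + mu)) * x) / β, by
    have := sub_nonneg.2 hβ
    positivity, fun y hy => ?_⟩
  have h := hq y hy
  have hsq : 0 ≤ (β - (c + mu)) * (y - x) ^ 2 := mul_nonneg (by linarith) (sq_nonneg _)
  set t := (s + (β - (c + mu)) * x) / β with ht
  have htβ : β * t = s + (β - (c + mu)) * x := by rw [ht]; field_simp
  have hcoef : 1 / (2 * (lam * β⁻¹)) = β / (2 * lam) := by field_simp
  rw [hcoef]
  have key : β / 2 * (t - x) ^ 2 + lam * τ x ≤ β / 2 * (t - y) ^ 2 + lam * τ y := by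
    have e1 : β / 2 * (t - x) ^ 2 = β / 2 * t ^ 2 - (s + (β - (c + mu)) * x) * x
        + β / 2 * x ^ 2 := by rw [← htβ]; ring
    have e2 : β / 2 * (t - y) ^ 2 = β / 2 * t ^ 2 - (s + (β - (c + mu)) * x) * y
        + β / 2 * y ^ 2 := by rw [← htβ]; ring
    rw [e1, e2]
    nlinarith
  have e3 : ∀ z, β / (2 * lam) * (t - z) ^ 2 + τ z
      = (β / 2 * (t - z) ^ 2 + lam * τ z) / lam := by
    intro z; field_simp
  rw [e3, e3]
  exact div_le_div_of_nonneg_right key hlam.le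

/-- Fermat's rule for the column problem. -/
theorem colObj_min_fermat {τ' : ℝ} (hw : w ≠ 0) (hτ' : HasDerivAt τ τ' ‖w‖)
    (hmin : ∀ u, colObj τ lam mu c g w₀ w ≤ colObj τ lam mu c g w₀ u) :
    g + c • (w - w₀) + mu • w + lam • (τ' / ‖w‖) • w = 0 := by
  have hloc : IsLocalMin (colObj τ lam mu c g w₀) w := Filter.Eventually.of_forall hmin
  have h1 : HasFDerivAt (fun u : E => inner ℝ g (u - w₀)) (innerSL ℝ g) w := by
    exact (innerSL ℝ g).hasFDerivAt.comp w ((hasFDerivAt_id w).sub_const w₀)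
  have h2 : HasFDerivAt (fun u : E => c / 2 * ‖u - w₀‖ ^ 2) (c • innerSL ℝ (w - w₀)) w := by
    have h := ((hasStrictFDerivAt_norm_sq (w - w₀)).hasFDerivAt.comp w
      ((hasFDerivAt_id w).sub_const w₀)).const_mul (c / 2)
    refine HasFDerivAt.congr_fderiv h ?_
    ext u
    simp
    ring
  have h3 := (hasFDerivAt_comp_norm hw hτ').const_mul lam
  have h4 : HasFDerivAt (fun u : E => mu / 2 * ‖u‖ ^ 2) (mu • innerSL ℝ w) w := by
    have h := (hasStrictFDerivAt_norm_sq w).hasFDerivAt.const_mul (mu / 2)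
    refine HasFDerivAt.congr_fderiv h ?_
    ext u
    simp
    ring
  have h := hloc.hasFDerivAt_eq_zero (((h1.add h2).add h3).add h4)
  have hz : innerSL ℝ (g + c • (w - w₀) + mu • w + lam • (τ' / ‖w‖) • w) = 0 := by
    rw [← h]
    simp only [map_add, map_smul, map_sub]
    abel
  generalize g + c • (w - w₀) + mu • w + lam • (τ' / ‖w‖) • w = v at hz
  exact inner_self_eq_zero.1 (congrArg (fun F => F v) hz)

end ColumnProblem

/-! ### Splitting separable objectives into columns. -/

section Columns

/-- The `j`-th column as a Euclidean vector. -/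
def colVec {l : ℕ} {κ : Type*} (W : Matrix (Fin l) κ ℝ) (j : κ) : EuclideanSpace ℝ (Fin l) :=
  WithLp.toLp 2 (fun a => W a j)

theorem norm_colVec {l : ℕ} {κ : Type*} (W : Matrix (Fin l) κ ℝ) (j : κ) :
    ‖colVec W j‖ = colNorm W j := rfl

theorem colVec_apply {l : ℕ} {κ : Type*} (W : Matrix (Fin l) κ ℝ) (j : κ) (i : Fin l) :
    colVec W j i = W i j := rfl

theorem colVec_sub {l : ℕ} {κ : Type*} (W Z : Matrix (Fin l) κ ℝ) (j : κ) :
    colVec (W - Z) j = colVec W j - colVec Z j := rfl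

theorem inner_eq_sum_colVec {l : ℕ} {κ : Type*} [Fintype κ] (A B : Matrix (Fin l) κ ℝ) :
    inner ℝ A B = ∑ j, inner ℝ (colVec A j) (colVec B j) := by
  rw [inner_eq_sum]
  refine Finset.sum_congr rfl fun j _ => ?_
  simp [PiLp.inner_apply, colVec_apply, mul_comm]

theorem colVec_updateCol {l : ℕ} {κ : Type*} [DecidableEq κ] (W : Matrix (Fin l) κ ℝ) (j k : κ)
    (u : EuclideanSpace ℝ (Fin l)) :
    colVec (W.updateCol j u) k = if k = j then u else colVec W k := by
  ext i
  simp only [colVec_apply, Matrix.updateCol_apply]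
  split_ifs <;> rfl

/-- Taking the `j`-th column, as a continuous linear map. -/
def colCLM (l : ℕ) {κ : Type*} [Fintype κ] (j : κ) :
    Matrix (Fin l) κ ℝ →L[ℝ] EuclideanSpace ℝ (Fin l) :=
  LinearMap.toContinuousLinearMap
    { toFun := fun W => colVec W j
      map_add' := fun _ _ => rfl
      map_smul' := fun _ _ => rfl }

/-- The separable objective whose column problems are `colObj`. -/
def sepObj (τ : ℝ → ℝ) (lam mu : ℝ) {l : ℕ} {κ : Type*} [Fintype κ] (c : κ → ℝ)
    (G W₀ Z : Matrix (Fin l) κ ℝ) : ℝ :=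
  inner ℝ G (Z - W₀) + ∑ j, c j / 2 * colNorm (Z - W₀) j ^ 2 + lam * ∑ j, τ (colNorm Z j)
    + mu / 2 * ‖Z‖ ^ 2

theorem sepObj_eq_sum (τ : ℝ → ℝ) (lam mu : ℝ) {l : ℕ} {κ : Type*} [Fintype κ] (c : κ → ℝ)
    (G W₀ Z : Matrix (Fin l) κ ℝ) :
    sepObj τ lam mu c G W₀ Z
      = ∑ j, colObj τ lam mu (c j) (colVec G j) (colVec W₀ j) (colVec Z j) := by
  simp only [sepObj, colObj, Finset.sum_add_distrib, inner_eq_sum_colVec, norm_sq_eq_sum_colNorm,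
    Finset.mul_sum, colVec_sub, norm_colVec]
  rfl

theorem colObj_min_of_sepObj_min {τ : ℝ → ℝ} {lam mu : ℝ} {l : ℕ} {κ : Type*} [Fintype κ]
    {c : κ → ℝ} {G W₀ W : Matrix (Fin l) κ ℝ}
    (hmin : ∀ Z, sepObj τ lam mu c G W₀ W ≤ sepObj τ lam mu c G W₀ Z) (j : κ)
    (u : EuclideanSpace ℝ (Fin l)) :
    colObj τ lam mu (c j) (colVec G j) (colVec W₀ j) (colVec W j)
      ≤ colObj τ lam mu (c j) (colVec G j) (colVec W₀ j) u := by
  classical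
  have h := hmin (W.updateCol j u)
  rw [sepObj_eq_sum, sepObj_eq_sum, ← Finset.add_sum_erase _ _ (Finset.mem_univ j),
    ← Finset.add_sum_erase _ _ (Finset.mem_univ j), colVec_updateCol, if_pos rfl] at h
  have hrest : ∑ k ∈ Finset.univ.erase j, colObj τ lam mu (c k) (colVec G k) (colVec W₀ k)
        (colVec (W.updateCol j u) k)
      = ∑ k ∈ Finset.univ.erase j, colObj τ lam mu (c k) (colVec G k) (colVec W₀ k)
        (colVec W k) :=
    Finset.sum_congr rfl fun k hk => by
      rw [colVec_updateCol, if_neg (Finset.ne_of_mem_erase hk)]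
  rw [hrest] at h
  linarith

/-- The gradient of `∑ⱼ τ(‖Wⱼ‖)` at a matrix with nonzero columns. -/
def normGrad (τ : ℝ → ℝ) {l : ℕ} {κ : Type*} (W : Matrix (Fin l) κ ℝ) : Matrix (Fin l) κ ℝ :=
  Matrix.of fun i j => deriv τ (colNorm W j) / colNorm W j * W i j

theorem colVec_normGrad (τ : ℝ → ℝ) {l : ℕ} {κ : Type*} (W : Matrix (Fin l) κ ℝ) (j : κ) :
    colVec (normGrad τ W) j = (deriv τ (colNorm W j) / colNorm W j) • colVec W j := rfl

/-- General maps `A j` let the same formula serve sums over all columns of a matrix and sums over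
the leading columns of a larger one. -/
theorem hasFDerivAt_sum_comp_norm {E F κ : Type*} [NormedAddCommGroup E] [InnerProductSpace ℝ E]
    [NormedAddCommGroup F] [InnerProductSpace ℝ F] [Fintype κ] {τ : ℝ → ℝ} {τ' : κ → ℝ}
    {A : κ → E →L[ℝ] F} {w N : E} (hw : ∀ j, A j w ≠ 0)
    (hτ : ∀ j, HasDerivAt τ (τ' j) ‖A j w‖)
    (hN : ∀ x, inner ℝ N x = ∑ j, τ' j / ‖A j w‖ * inner ℝ (A j w) (A j x)) :
    HasFDerivAt (fun x => ∑ j, τ ‖A j x‖) (innerSL ℝ N) w := by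
  have h : ∀ j ∈ Finset.univ, HasFDerivAt (fun x => τ ‖A j x‖)
      (((τ' j / ‖A j w‖) • innerSL ℝ (A j w)).comp (A j)) w := fun j _ =>
    (hasFDerivAt_comp_norm (hw j) (hτ j)).comp w (A j).hasFDerivAt
  refine (HasFDerivAt.fun_sum h).congr_fderiv ?_
  ext x
  simp [hN]

theorem hasFDerivAt_sum_colNorm {τ : ℝ → ℝ} {l : ℕ} {κ : Type*} [Fintype κ]
    {W : Matrix (Fin l) κ ℝ} (hτ : ∀ t, 0 < t → DifferentiableAt ℝ τ t)
    (hW : ∀ j, colNorm W j ≠ 0) :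
    HasFDerivAt (fun Z => ∑ j, τ (colNorm Z j)) (innerSL ℝ (normGrad τ W)) W :=
  hasFDerivAt_sum_comp_norm (A := fun j => colCLM l j)
    (τ' := fun j => deriv τ (colNorm W j))
    (fun j => norm_ne_zero_iff.1 (hW j))
    (fun j => (hτ _ ((colNorm_nonneg W j).lt_of_ne' (hW j))).hasDerivAt) (fun Z => by
      rw [inner_eq_sum_colVec]
      exact Finset.sum_congr rfl fun j _ => by
        rw [colVec_normGrad, real_inner_smul_left]; rfl)

end Columns

/-! ### The model with real values. -/

section RealModel

variable {n m r : ℕ} (M : Model n m)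

/-- The real-valued version of `θ`. -/
def Model.tau (t : ℝ) : ℝ := (M.θ t).toReal

/-- The real-valued version of `ϑ`. -/
def Model.reg {l : ℕ} {κ : Type*} [Fintype κ] (W : Matrix (Fin l) κ ℝ) : ℝ :=
  ∑ j, M.tau (colNorm W j)

/-- The real-valued version of the objective. -/
def Model.phi (U : Mat n r) (V : Mat m r) : ℝ :=
  M.f (U * Vᵀ) + M.lam * (M.reg U + M.reg V) + M.mu / 2 * (‖U‖ ^ 2 + ‖V‖ ^ 2)

variable {M} (hM : M.Valid)

include hM

theorem Model.Valid.theta_nonneg {t : ℝ} (ht : 0 ≤ t) : 0 ≤ M.θ t := by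
  rcases ht.eq_or_lt with rfl | h
  · exact hM.theta_zero.ge
  · exact (hM.theta_pos t h).le

theorem Model.Valid.theta_eq {t : ℝ} (ht : 0 ≤ t) : M.θ t = (M.tau t : EReal) := by
  rw [Model.tau, EReal.coe_toReal]
  · rcases ht.eq_or_lt with rfl | h
    · simp [hM.theta_zero]
    · exact hM.theta_finite t h
  · exact fun h => by simpa [h] using hM.theta_nonneg ht

theorem Model.Valid.tau_zero : M.tau 0 = 0 := by
  simp [Model.tau, hM.theta_zero]

theorem Model.Valid.tau_nonneg {t : ℝ} (ht : 0 ≤ t) : 0 ≤ M.tau t :=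
  EReal.toReal_nonneg (hM.theta_nonneg ht)

theorem Model.Valid.tau_differentiableAt {t : ℝ} (ht : 0 < t) : DifferentiableAt ℝ M.tau t :=
  hM.theta_diff t ht

theorem Model.Valid.vartheta_eq {l : ℕ} {κ : Type*} [Fintype κ] (W : Matrix (Fin l) κ ℝ) :
    vartheta M.θ W = (M.reg W : EReal) := by
  classical
  rw [vartheta, Model.reg]
  induction (Finset.univ : Finset κ) using Finset.induction_on with
  | empty => simp
  | insert j t hj ih =>
    rw [Finset.sum_insert hj, Finset.sum_insert hj, ih, hM.theta_eq (colNorm_nonneg W j),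
      EReal.coe_add]

theorem Model.Valid.reg_nonneg {l : ℕ} {κ : Type*} [Fintype κ] (W : Matrix (Fin l) κ ℝ) :
    0 ≤ M.reg W :=
  Finset.sum_nonneg fun j _ => hM.tau_nonneg (colNorm_nonneg W j)

theorem Model.Valid.gradVartheta_eq {l : ℕ} {κ : Type*} [Fintype κ] {W : Matrix (Fin l) κ ℝ}
    (hW : ∀ j, colNorm W j ≠ 0) : gradVartheta M.θ W = normGrad M.tau W := by
  have h : (fun Z : Matrix (Fin l) κ ℝ => (vartheta M.θ Z).toReal)
      = fun Z => ∑ j, M.tau (colNorm Z j) := by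
    funext Z
    rw [hM.vartheta_eq, EReal.toReal_coe, Model.reg]
  rw [gradVartheta, h]
  refine HasGradientAt.gradient ?_
  rw [hasGradientAt_iff_hasFDerivAt]
  exact hasFDerivAt_sum_colNorm (fun t ht => hM.tau_differentiableAt ht) hW

theorem Model.Valid.Phi_eq (p : Pair n m r) : M.Phi p = (M.phi p.fst p.snd : EReal) := by
  rw [Model.Phi, hM.vartheta_eq, hM.vartheta_eq, Model.phi]
  push_cast
  rfl

theorem Model.Valid.PhiHat_eq (U : Mat n r) (V : Mat m r) (U' : Mat n r) (V' : Mat m r) :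
    M.PhiHat U V U' V' = ((M.Fhat U V U' V' + M.lam * (M.reg U + M.reg V)
      + M.mu / 2 * (‖U‖ ^ 2 + ‖V‖ ^ 2) : ℝ) : EReal) := by
  rw [Model.PhiHat, hM.vartheta_eq, hM.vartheta_eq]
  push_cast
  rfl

theorem Model.Valid.differentiable : Differentiable ℝ M.f :=
  hM.contDiff.differentiable one_ne_zero

theorem Model.Valid.le_Fhat (U : Mat n r) (V : Mat m r) (U' : Mat n r) (V' : Mat m r) :
    M.f (U * Vᵀ) ≤ M.Fhat U V U' V' :=
  le_add_inner_add_sq_of_lipschitz_gradient hM.differentiable hM.lipschitz _ _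

end RealModel

/-! ### Separability of the two subproblems. -/

section Subproblems

variable {n m r : ℕ} {M : Model n m} (hM : M.Valid)

theorem sum_colNorm_mul_diagonal {l : ℕ} (Z : Mat l r) (d : Fin r → ℝ) (L g : ℝ) :
    L / 2 * ‖Z * Matrix.diagonal d‖ ^ 2 + g / 2 * ‖Z‖ ^ 2
      = ∑ j, (L * d j ^ 2 + g) / 2 * colNorm Z j ^ 2 := by
  rw [norm_mul_diagonal_sq, norm_sq_eq_sum_colNorm, Finset.mul_sum, Finset.mul_sum,
    ← Finset.sum_add_distrib]
  refine Finset.sum_congr rfl fun j _ => ?_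
  rw [colNorm_sq]
  ring

include hM

/-- The subproblem in the first factor is separable over columns. -/
theorem Model.Valid.sepObj_min_fst {U W : Mat n r} {V : Mat m r} {P : Mat m r} {d : Fin r → ℝ}
    {g : ℝ} (hP : Pᵀ * P = 1) (hV : V = P * Matrix.diagonal d)
    (hmin : ∀ Z : Mat n r, M.PhiHat W V U V + ((g / 2 * ‖W - U‖ ^ 2 : ℝ) : EReal)
      ≤ M.PhiHat Z V U V + ((g / 2 * ‖Z - U‖ ^ 2 : ℝ) : EReal)) (Z : Mat n r) :
    sepObj M.tau M.lam M.mu (fun j => M.L * d j ^ 2 + g) (gradient M.f (U * Vᵀ) * V) U W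
      ≤ sepObj M.tau M.lam M.mu (fun j => M.L * d j ^ 2 + g) (gradient M.f (U * Vᵀ) * V) U Z := by
  have key : ∀ Z : Mat n r, M.PhiHat Z V U V + ((g / 2 * ‖Z - U‖ ^ 2 : ℝ) : EReal)
      = ((sepObj M.tau M.lam M.mu (fun j => M.L * d j ^ 2 + g) (gradient M.f (U * Vᵀ) * V) U Z
        + (M.f (U * Vᵀ) + M.lam * M.reg V + M.mu / 2 * ‖V‖ ^ 2) : ℝ) : EReal) := by
    intro Z
    rw [hM.PhiHat_eq, ← EReal.coe_add, sepObj, ← sum_colNorm_mul_diagonal, Model.Fhat]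
    have h1 : Z * Vᵀ - U * Vᵀ = (Z - U) * Vᵀ := (Matrix.sub_mul _ _ _).symm
    -- Orthogonality of the columns of `V` is what removes the coupling between columns.
    have h2 : ‖(Z - U) * Vᵀ‖ = ‖(Z - U) * Matrix.diagonal d‖ := by
      rw [hV, Matrix.transpose_mul, Matrix.diagonal_transpose, ← Matrix.mul_assoc,
        norm_mul_isometry_transpose hP]
    rw [h1, h2, inner_mul_right_eq (gradient M.f (U * Vᵀ)) V (Z - U)]
    congr 1
    simp only [Model.reg]
    ring
  have h := hmin Z
  rw [key, key, EReal.coe_le_coe_iff] at h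
  linarith

/-- The subproblem in the second factor is separable over columns. -/
theorem Model.Valid.sepObj_min_snd {U : Mat n r} {V W : Mat m r} {P : Mat n r} {d : Fin r → ℝ}
    {g : ℝ} (hP : Pᵀ * P = 1) (hU : U = P * Matrix.diagonal d)
    (hmin : ∀ Z : Mat m r, M.PhiHat U W U V + ((g / 2 * ‖W - V‖ ^ 2 : ℝ) : EReal)
      ≤ M.PhiHat U Z U V + ((g / 2 * ‖Z - V‖ ^ 2 : ℝ) : EReal)) (Z : Mat m r) :
    sepObj M.tau M.lam M.mu (fun j => M.L * d j ^ 2 + g) ((gradient M.f (U * Vᵀ))ᵀ * U) V W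
      ≤ sepObj M.tau M.lam M.mu (fun j => M.L * d j ^ 2 + g)
        ((gradient M.f (U * Vᵀ))ᵀ * U) V Z := by
  have key : ∀ Z : Mat m r, M.PhiHat U Z U V + ((g / 2 * ‖Z - V‖ ^ 2 : ℝ) : EReal)
      = ((sepObj M.tau M.lam M.mu (fun j => M.L * d j ^ 2 + g)
        ((gradient M.f (U * Vᵀ))ᵀ * U) V Z
        + (M.f (U * Vᵀ) + M.lam * M.reg U + M.mu / 2 * ‖U‖ ^ 2) : ℝ) : EReal) := by
    intro Z
    rw [hM.PhiHat_eq, ← EReal.coe_add, sepObj, ← sum_colNorm_mul_diagonal, Model.Fhat]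
    have h1 : U * Zᵀ - U * Vᵀ = ((Z - V) * Uᵀ)ᵀ := by
      rw [Matrix.transpose_mul, Matrix.transpose_transpose, Matrix.transpose_sub, Matrix.mul_sub]
    have h2 : ‖((Z - V) * Uᵀ)ᵀ‖ = ‖(Z - V) * Matrix.diagonal d‖ := by
      rw [Matrix.frobenius_norm_transpose, hU, Matrix.transpose_mul, Matrix.diagonal_transpose,
        ← Matrix.mul_assoc, norm_mul_isometry_transpose hP]
    have h3 : inner ℝ (gradient M.f (U * Vᵀ)) ((Z - V) * Uᵀ)ᵀ
        = inner ℝ ((gradient M.f (U * Vᵀ))ᵀ * U) (Z - V) := by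
      rw [inner_mul_right_eq, ← inner_transpose, Matrix.transpose_transpose]
    rw [h1, h2, h3]
    congr 1
    simp only [Model.reg]
    ring
  have h := hmin Z
  rw [key, key, EReal.coe_le_coe_iff] at h
  linarith

end Subproblems

theorem IsThinSVD.antitone {l r : ℕ} {Y P : Mat l r} {d : Fin r → ℝ} {Q : Mat r r}
    (h : IsThinSVD Y P d Q) : Antitone d := by
  intro i j hij
  refine le_of_sq_le_sq ?_ (h.nonneg i)
  rw [h.sq, h.sq]
  exact sv_antitone Y hij

/-! ### Balanced factorizations do not increase the objective. -/

section Balancing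

variable {n m r : ℕ} {X : Mat n m} {P : Mat n r} {d : Fin r → ℝ} {Q : Mat m r}

/-- `Σ dᵢ²` is the nuclear norm, so the balanced factorization has the least squared norm. -/
theorem IsBalanced.norm_sq_add_le (h : IsBalanced X P d Q) {U : Mat n r} {V : Mat m r}
    (hX : X = U * Vᵀ) :
    ‖P * Matrix.diagonal d‖ ^ 2 + ‖Q * Matrix.diagonal d‖ ^ 2 ≤ ‖U‖ ^ 2 + ‖V‖ ^ 2 := by
  rw [norm_isometry_mul h.orthP, norm_isometry_mul h.orthQ, norm_diagonal_sq]
  -- The trace of `Pᵀ * X * Q` with `X = U * Vᵀ`; Cauchy–Schwarz and the contractions by `P` and `Q`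
  -- then bound it by `‖U‖ * ‖V‖`.
  have h1 : ∑ i, d i ^ 2 = inner ℝ (Uᵀ * P) (Vᵀ * Q) := by
    have h2 := congrArg Matrix.trace h.diagonal_eq
    rw [Matrix.trace_diagonal] at h2
    rw [← h2, hX, inner_eq_trace, Matrix.transpose_mul, Matrix.transpose_transpose]
    simp only [Matrix.mul_assoc]
  have h3 : ‖Uᵀ * P‖ ≤ ‖U‖ := by
    rw [← Matrix.frobenius_norm_transpose U]
    exact norm_mul_isometry_le h.orthP _
  have h4 : ‖Vᵀ * Q‖ ≤ ‖V‖ := by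
    rw [← Matrix.frobenius_norm_transpose V]
    exact norm_mul_isometry_le h.orthQ _
  have h5 : ∑ i, d i ^ 2 ≤ ‖U‖ * ‖V‖ := by
    rw [h1]
    exact (real_inner_le_norm _ _).trans (mul_le_mul h3 h4 (norm_nonneg _) (norm_nonneg _))
  nlinarith [sq_nonneg (‖U‖ - ‖V‖)]

theorem IsBalanced.eq_mul_transpose (h : IsBalanced X P d Q) :
    X = P * Matrix.diagonal d * (Q * Matrix.diagonal d)ᵀ := by
  rw [Matrix.transpose_mul, Matrix.diagonal_transpose, Matrix.mul_assoc,
    ← Matrix.mul_assoc (Matrix.diagonal d), Matrix.diagonal_mul_diagonal, ← Matrix.mul_assoc]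
  simpa only [sq] using h.eq

/-- Replacing a factorization by the balanced one does not increase the objective. -/
theorem IsBalanced.phi_le {M : Model n m} (hM : M.Valid) {hrn : r ≤ n} {hnm : n ≤ m}
    (h1 : Assumption1 hrn hnm M.θ) (h : IsBalanced X P d Q) {U : Mat n r} {V : Mat m r}
    (hX : X = U * Vᵀ) :
    M.phi (P * Matrix.diagonal d) (Q * Matrix.diagonal d)
      ≤ M.f X + M.lam * (M.reg U + M.reg V) + M.mu / 2 * (‖U‖ ^ 2 + ‖V‖ ^ 2) := by
  have hreg : M.reg (P * Matrix.diagonal d) + M.reg (Q * Matrix.diagonal d)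
      ≤ M.reg U + M.reg V := by
    obtain ⟨Pf, Qf, hsvd, hPf, hQf⟩ := h.exists_fullSVD hrn hnm
    have heq := h1 X Pf Qf h.rank_le hsvd
    have hd : (fun i : Fin r => Real.sqrt (sv X i)) = d := by
      funext i
      rw [h.sv_fin (hrn.trans hnm), Real.sqrt_sq (h.nonneg i)]
    rw [hPf, hQf, hd] at heq
    have hle : (⨅ p : {p : Mat n r × Mat m r // X = p.1 * p.2ᵀ},
        (vartheta M.θ p.1.1 + vartheta M.θ p.1.2)) ≤ vartheta M.θ U + vartheta M.θ V :=
      iInf_le (fun p : {p : Mat n r × Mat m r // X = p.1 * p.2ᵀ} =>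
        vartheta M.θ p.1.1 + vartheta M.θ p.1.2) ⟨(U, V), hX⟩
    rw [← heq] at hle
    simp only [hM.vartheta_eq] at hle
    exact_mod_cast hle
  rw [Model.phi, ← h.eq_mul_transpose]
  have := mul_le_mul_of_nonneg_left hreg hM.lam_pos.le
  have := mul_le_mul_of_nonneg_left (h.norm_sq_add_le hX) hM.mu_pos.le
  linarith

end Balancing

/-! ### Structure of a run, sufficient decrease and boundedness. -/

namespace IsRun

variable {n m r : ℕ} {M : Model n m} {a : AlgParams} {s : Iterates n m r} (hs : IsRun M a s)

include hs

theorem isometry_Pbar (k : ℕ) : (s.Pbar k)ᵀ * s.Pbar k = 1 := by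
  cases k with
  | zero => exact hs.init_Pbar
  | succ k => exact (hs.step4_svd k).orthP

theorem isometry_Phat (k : ℕ) : (s.Phat k)ᵀ * s.Phat k = 1 := by
  cases k with
  | zero => exact hs.init_Phat
  | succ k => exact (hs.step2_svd k).orthP

theorem isometry_Qbar (k : ℕ) : (s.Qbar k)ᵀ * s.Qbar k = 1 := by
  cases k with
  | zero => simp [hs.init_Qbar]
  | succ k => exact orthogonal_transpose_mul (hs.step4_svd k).orthQ

theorem Vbar_eq (k : ℕ) : s.Vbar k = s.Pbar k * Matrix.diagonal (s.Dbar k) := by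
  cases k with
  | zero => simp [hs.init_Vbar, hs.init_Dbar]
  | succ k => exact hs.step4_Vbar k

theorem Ubar_eq (k : ℕ) : s.Ubar k = s.Phat k * s.Qbar k * Matrix.diagonal (s.Dbar k) := by
  cases k with
  | zero => simp [hs.init_Ubar, hs.init_Dbar, hs.init_Qbar]
  | succ k => exact hs.step4_Ubar k

theorem Dbar_nonneg (k : ℕ) (i : Fin r) : 0 ≤ s.Dbar k i := by
  cases k with
  | zero => simp [hs.init_Dbar]
  | succ k => exact (hs.step4_svd k).nonneg i

theorem Dbar_antitone (k : ℕ) : Antitone (s.Dbar k) := by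
  cases k with
  | zero => rw [hs.init_Dbar]; exact antitone_const
  | succ k => exact (hs.step4_svd k).antitone

theorem isometry_PhatQbar (k : ℕ) :
    (s.Phat k * s.Qbar k)ᵀ * (s.Phat k * s.Qbar k) = 1 :=
  isometry_mul_isometry (hs.isometry_Phat k) (hs.isometry_Qbar k)

theorem balanced_Xbar (k : ℕ) :
    IsBalanced (s.Xbar k) (s.Phat k * s.Qbar k) (s.Dbar k) (s.Pbar k) where
  orthP := hs.isometry_PhatQbar k
  orthQ := hs.isometry_Pbar k
  nonneg := hs.Dbar_nonneg k
  anti := hs.Dbar_antitone k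
  eq := by
    rw [hs.step4_Xbar, hs.Ubar_eq, hs.Vbar_eq, Matrix.transpose_mul, Matrix.diagonal_transpose,
      Matrix.mul_assoc _ (Matrix.diagonal _), ← Matrix.mul_assoc (Matrix.diagonal _),
      Matrix.diagonal_mul_diagonal, ← Matrix.mul_assoc]
    simp only [sq]

theorem balanced_Xhat (k : ℕ) :
    IsBalanced (s.Xhat (k + 1)) (s.Phat (k + 1)) (s.Dhat (k + 1)) (s.Pbar k * s.Qhat (k + 1)) where
  orthP := hs.isometry_Phat (k + 1)
  orthQ := isometry_mul_isometry (hs.isometry_Pbar k)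
    (orthogonal_transpose_mul (hs.step2_svd k).orthQ)
  nonneg := (hs.step2_svd k).nonneg
  anti := (hs.step2_svd k).antitone
  eq := by
    rw [hs.step2_Xhat, hs.step2_Uhat, hs.step2_Vhat, Matrix.transpose_mul,
      Matrix.diagonal_transpose,
      Matrix.mul_assoc _ (Matrix.diagonal _), ← Matrix.mul_assoc (Matrix.diagonal _),
      Matrix.diagonal_mul_diagonal, ← Matrix.mul_assoc]
    simp only [sq]

/-- The thin decomposition of `U * diagonal Dbar`, multiplied by `Pbarᵀ`, is the product before
correction: the correction only rebalances the factors. -/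
theorem Xhat_eq (k : ℕ) : s.Xhat (k + 1) = s.U (k + 1) * (s.Vbar k)ᵀ := by
  rw [hs.Vbar_eq, Matrix.transpose_mul, Matrix.diagonal_transpose, ← Matrix.mul_assoc,
    (hs.step2_svd k).eq, (hs.balanced_Xhat k).eq, Matrix.transpose_mul, Matrix.diagonal_pow,
    ← Matrix.mul_assoc]
  rfl

theorem Xbar_succ_eq (k : ℕ) : s.Xbar (k + 1) = s.Uhat (k + 1) * (s.V (k + 1))ᵀ := by
  have h : s.V (k + 1) * (s.Uhat (k + 1))ᵀ = (s.Xbar (k + 1))ᵀ := by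
    rw [hs.step2_Uhat, Matrix.transpose_mul, Matrix.diagonal_transpose, ← Matrix.mul_assoc,
      (hs.step4_svd k).eq, (hs.balanced_Xbar (k + 1)).transpose.eq, Matrix.transpose_mul,
      Matrix.diagonal_pow, ← Matrix.mul_assoc]
    rfl
  rw [← Matrix.transpose_transpose (s.Xbar (k + 1)), ← h, Matrix.transpose_mul,
    Matrix.transpose_transpose]

theorem U_min (hM : M.Valid) (k : ℕ) (Z : Mat n r) :
    sepObj M.tau M.lam M.mu (fun j => M.L * s.Dbar k j ^ 2 + s.gam1 k)
        (gradient M.f (s.Xbar k) * s.Vbar k) (s.Ubar k) (s.U (k + 1))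
      ≤ sepObj M.tau M.lam M.mu (fun j => M.L * s.Dbar k j ^ 2 + s.gam1 k)
        (gradient M.f (s.Xbar k) * s.Vbar k) (s.Ubar k) Z := by
  rw [hs.step4_Xbar]
  exact hM.sepObj_min_fst (hs.isometry_Pbar k) (hs.Vbar_eq k) (hs.step1 k) Z

theorem V_min (hM : M.Valid) (k : ℕ) (Z : Mat m r) :
    sepObj M.tau M.lam M.mu (fun j => M.L * s.Dhat (k + 1) j ^ 2 + s.gam2 k)
        ((gradient M.f (s.Xhat (k + 1)))ᵀ * s.Uhat (k + 1)) (s.Vhat (k + 1)) (s.V (k + 1))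
      ≤ sepObj M.tau M.lam M.mu (fun j => M.L * s.Dhat (k + 1) j ^ 2 + s.gam2 k)
        ((gradient M.f (s.Xhat (k + 1)))ᵀ * s.Uhat (k + 1)) (s.Vhat (k + 1)) Z := by
  rw [hs.step2_Xhat]
  exact hM.sepObj_min_snd (hs.isometry_Phat (k + 1)) (hs.step2_Uhat k) (hs.step3 k) Z

/-- The initial value enters because it may lie below `a.lo1`, which bounds the sequence only from
index `1` on. -/
theorem gam1_ge (k : ℕ) : min a.lo1 a.init1 ≤ s.gam1 k := by
  cases k with
  | zero => rw [hs.init_gam1]; exact min_le_right _ _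
  | succ k => rw [hs.step5_gam1]; exact (min_le_left _ _).trans (le_max_left _ _)

theorem gam2_ge (k : ℕ) : min a.lo2 a.init2 ≤ s.gam2 k := by
  cases k with
  | zero => rw [hs.init_gam2]; exact min_le_right _ _
  | succ k => rw [hs.step5_gam2]; exact (min_le_left _ _).trans (le_max_left _ _)

theorem gam1_pos (ha : a.Valid) (k : ℕ) : 0 < s.gam1 k :=
  (lt_min ha.lo1_pos ha.init1_pos).trans_le (hs.gam1_ge k)

theorem gam2_pos (ha : a.Valid) (k : ℕ) : 0 < s.gam2 k :=
  (lt_min ha.lo2_pos ha.init2_pos).trans_le (hs.gam2_ge k)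

/-- The majorization is exact at the current pair, the minimizer beats that pair by the proximal
term, and rebalancing the new product does not increase the objective. -/
theorem phi_hat_le (hM : M.Valid) {hrn : r ≤ n} {hnm : n ≤ m} (h1 : Assumption1 hrn hnm M.θ)
    (k : ℕ) : M.phi (s.Uhat (k + 1)) (s.Vhat (k + 1))
        + s.gam1 k / 2 * ‖s.U (k + 1) - s.Ubar k‖ ^ 2 ≤ M.phi (s.Ubar k) (s.Vbar k) := by
  have hb := (hs.balanced_Xhat k).phi_le hM h1 (hs.Xhat_eq k)
  rw [← hs.step2_Uhat, ← hs.step2_Vhat] at hb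
  have hstep := hs.step1 k (s.Ubar k)
  rw [hM.PhiHat_eq, hM.PhiHat_eq, ← EReal.coe_add, ← EReal.coe_add, EReal.coe_le_coe_iff] at hstep
  have hle := hM.le_Fhat (s.U (k + 1)) (s.Vbar k) (s.Ubar k) (s.Vbar k)
  rw [← hs.Xhat_eq] at hle
  have hself : M.Fhat (s.Ubar k) (s.Vbar k) (s.Ubar k) (s.Vbar k)
      = M.f (s.Ubar k * (s.Vbar k)ᵀ) := by
    simp [Model.Fhat]
  rw [hself, sub_self, norm_zero] at hstep
  simp only [Model.phi] at hb ⊢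
  linarith

theorem phi_bar_le (hM : M.Valid) {hrn : r ≤ n} {hnm : n ≤ m} (h1 : Assumption1 hrn hnm M.θ)
    (k : ℕ) : M.phi (s.Ubar (k + 1)) (s.Vbar (k + 1))
        + s.gam2 k / 2 * ‖s.V (k + 1) - s.Vhat (k + 1)‖ ^ 2
      ≤ M.phi (s.Uhat (k + 1)) (s.Vhat (k + 1)) := by
  have hb := (hs.balanced_Xbar (k + 1)).phi_le hM h1 (hs.Xbar_succ_eq k)
  rw [← hs.step4_Ubar, ← hs.step4_Vbar] at hb
  have hstep := hs.step3 k (s.Vhat (k + 1))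
  rw [hM.PhiHat_eq, hM.PhiHat_eq, ← EReal.coe_add, ← EReal.coe_add, EReal.coe_le_coe_iff] at hstep
  have hle := hM.le_Fhat (s.Uhat (k + 1)) (s.V (k + 1)) (s.Uhat (k + 1)) (s.Vhat (k + 1))
  rw [← hs.Xbar_succ_eq] at hle
  have hself : M.Fhat (s.Uhat (k + 1)) (s.Vhat (k + 1)) (s.Uhat (k + 1)) (s.Vhat (k + 1))
      = M.f (s.Uhat (k + 1) * (s.Vhat (k + 1))ᵀ) := by
    simp [Model.Fhat]
  rw [hself, sub_self, norm_zero] at hstep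
  simp only [Model.phi] at hb ⊢
  linarith

theorem phi_antitone (hM : M.Valid) (ha : a.Valid) {hrn : r ≤ n} {hnm : n ≤ m}
    (h1 : Assumption1 hrn hnm M.θ) : Antitone fun k => M.phi (s.Ubar k) (s.Vbar k) := by
  refine antitone_nat_of_succ_le fun k => ?_
  have := hs.phi_hat_le hM h1 k
  have := hs.phi_bar_le hM h1 k
  have := hs.gam1_pos ha k
  have := hs.gam2_pos ha k
  have : 0 ≤ s.gam1 k / 2 * ‖s.U (k + 1) - s.Ubar k‖ ^ 2 := by positivity
  have : 0 ≤ s.gam2 k / 2 * ‖s.V (k + 1) - s.Vhat (k + 1)‖ ^ 2 := by positivity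
  linarith

omit hs in
-- Coercivity: `f` is bounded below and the regularizer is nonnegative, so sublevel sets are bounded
-- through the `μ` term.
theorem exists_phi_lower (hM : M.Valid) : ∃ b : ℝ, ∀ (U : Mat n r) (V : Mat m r),
    b + M.mu / 2 * (‖U‖ ^ 2 + ‖V‖ ^ 2) ≤ M.phi U V := by
  obtain ⟨b, hb⟩ := hM.bddBelow
  refine ⟨b, fun U V => ?_⟩
  have h1 : b ≤ M.f (U * Vᵀ) := hb ⟨_, rfl⟩
  have h2 := mul_nonneg hM.lam_pos.le (add_nonneg (hM.reg_nonneg U) (hM.reg_nonneg V))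
  rw [Model.phi]
  linarith

theorem exists_bound (hM : M.Valid) (ha : a.Valid) {hrn : r ≤ n} {hnm : n ≤ m}
    (h1 : Assumption1 hrn hnm M.θ) : ∃ C : ℝ, 0 ≤ C ∧ ∀ k, ‖s.Ubar k‖ ≤ C ∧ ‖s.Vbar k‖ ≤ C ∧
      ‖s.Uhat (k + 1)‖ ≤ C ∧ ‖s.Vhat (k + 1)‖ ≤ C := by
  obtain ⟨b, hb⟩ := exists_phi_lower (r := r) hM
  set T := 2 / M.mu * (M.phi (s.Ubar 0) (s.Vbar 0) - b) with hT
  have hmu := hM.mu_pos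
  have key : ∀ (U : Mat n r) (V : Mat m r), M.phi U V ≤ M.phi (s.Ubar 0) (s.Vbar 0) →
      ‖U‖ ≤ Real.sqrt T ∧ ‖V‖ ≤ Real.sqrt T := by
    intro U V hUV
    have h2 := (hb U V).trans hUV
    have h3 : ‖U‖ ^ 2 + ‖V‖ ^ 2 ≤ T := by
      rw [hT, div_mul_eq_mul_div, le_div_iff₀ hmu]
      linarith
    exact ⟨Real.le_sqrt_of_sq_le (by nlinarith [sq_nonneg ‖V‖]),
      Real.le_sqrt_of_sq_le (by nlinarith [sq_nonneg ‖U‖])⟩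
  refine ⟨Real.sqrt T, Real.sqrt_nonneg _, fun k => ?_⟩
  have hk := hs.phi_antitone hM ha h1 (Nat.zero_le k)
  obtain ⟨h2, h3⟩ := key _ _ hk
  have h4 := hs.phi_hat_le hM h1 k
  have := hs.gam1_pos ha k
  have h5 : 0 ≤ s.gam1 k / 2 * ‖s.U (k + 1) - s.Ubar k‖ ^ 2 := by positivity
  obtain ⟨h6, h7⟩ := key (s.Uhat (k + 1)) (s.Vhat (k + 1)) (by dsimp only at hk; linarith)
  exact ⟨h2, h3, h6, h7⟩

omit hs in
theorem tendsto_zero_of_le_decrease {x φ : ℕ → ℝ} {c b : ℝ} (hc : 0 < c) (hφ : Antitone φ)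
    (hb : ∀ k, b ≤ φ k) (hx : ∀ k, c * x k ^ 2 ≤ φ k - φ (k + 1)) (hx0 : ∀ k, 0 ≤ x k) :
    Tendsto x atTop (𝓝 0) := by
  have hlim := tendsto_atTop_ciInf hφ ⟨b, by rintro _ ⟨k, rfl⟩; exact hb k⟩
  have h1 : Tendsto (fun k => (φ k - φ (k + 1)) / c) atTop (𝓝 0) := by
    simpa using (hlim.sub (hlim.comp (tendsto_add_atTop_nat 1))).div_const c
  have h2 : Tendsto (fun k => x k ^ 2) atTop (𝓝 0) :=
    squeeze_zero (fun k => sq_nonneg _) (fun k => by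
      rw [le_div_iff₀ hc, mul_comm]; exact hx k) h1
  have h3 := h2.sqrt
  simpa [Real.sqrt_sq (hx0 _)] using h3

theorem tendsto_U_sub (hM : M.Valid) (ha : a.Valid) {hrn : r ≤ n} {hnm : n ≤ m}
    (h1 : Assumption1 hrn hnm M.θ) :
    Tendsto (fun k => ‖s.U (k + 1) - s.Ubar k‖) atTop (𝓝 0) := by
  obtain ⟨b, hb⟩ := exists_phi_lower (r := r) hM
  have hmu := hM.mu_pos
  have hpos := lt_min ha.lo1_pos ha.init1_pos
  refine tendsto_zero_of_le_decrease (c := min a.lo1 a.init1 / 2) (by positivity)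
    (hs.phi_antitone hM ha h1) (b := b) (fun k => ?_) (fun k => ?_) fun k => norm_nonneg _
  · exact (le_add_of_nonneg_right (by positivity)).trans (hb (s.Ubar k) (s.Vbar k))
  · have h2 := hs.phi_hat_le hM h1 k
    have h3 := hs.phi_bar_le hM h1 k
    have := hs.gam2_pos ha k
    have h4 : 0 ≤ s.gam2 k / 2 * ‖s.V (k + 1) - s.Vhat (k + 1)‖ ^ 2 := by positivity
    have h5 := mul_le_mul_of_nonneg_right (hs.gam1_ge k)
      (sq_nonneg ‖s.U (k + 1) - s.Ubar k‖)
    linarith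

theorem tendsto_V_sub (hM : M.Valid) (ha : a.Valid) {hrn : r ≤ n} {hnm : n ≤ m}
    (h1 : Assumption1 hrn hnm M.θ) :
    Tendsto (fun k => ‖s.V (k + 1) - s.Vhat (k + 1)‖) atTop (𝓝 0) := by
  obtain ⟨b, hb⟩ := exists_phi_lower (r := r) hM
  have hmu := hM.mu_pos
  have hpos := lt_min ha.lo2_pos ha.init2_pos
  refine tendsto_zero_of_le_decrease (c := min a.lo2 a.init2 / 2) (by positivity)
    (hs.phi_antitone hM ha h1) (b := b) (fun k => ?_) (fun k => ?_) fun k => norm_nonneg _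
  · exact (le_add_of_nonneg_right (by positivity)).trans (hb (s.Ubar k) (s.Vbar k))
  · have h2 := hs.phi_hat_le hM h1 k
    have h3 := hs.phi_bar_le hM h1 k
    have := hs.gam1_pos ha k
    have h4 : 0 ≤ s.gam1 k / 2 * ‖s.U (k + 1) - s.Ubar k‖ ^ 2 := by positivity
    have h5 := mul_le_mul_of_nonneg_right (hs.gam2_ge k)
      (sq_nonneg ‖s.V (k + 1) - s.Vhat (k + 1)‖)
    linarith

end IsRun

/-! ### Rank of products with a diagonal factor. -/

section Rank

open Classical in
theorem rank_mul_diagonal_mul_le {n m r : ℕ} (A : Mat n r) (d : Fin r → ℝ) (B : Mat r m) :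
    (A * Matrix.diagonal d * B).rank ≤ Fintype.card {i // d i ≠ 0} := by
  rw [← Matrix.rank_diagonal]
  exact (Matrix.rank_mul_le_left _ _).trans (Matrix.rank_mul_le_right _ _)

open Classical in
-- A zero column of `A` allows `d j` to be replaced by zero without changing the product, which
-- loses one nonzero diagonal entry.
theorem rank_mul_diagonal_mul_lt {n m r : ℕ} {A : Mat n r} {d : Fin r → ℝ} (B : Mat r m)
    {j : Fin r} (hA : ∀ i, A i j = 0) (hd : d j ≠ 0) :
    (A * Matrix.diagonal d * B).rank < Fintype.card {i // d i ≠ 0} := by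
  have h : A * Matrix.diagonal d = A * Matrix.diagonal (Function.update d j 0) := by
    ext i k
    rw [Matrix.mul_diagonal, Matrix.mul_diagonal]
    by_cases hk : k = j
    · subst hk; simp [hA]
    · simp [hk]
  rw [h]
  refine (rank_mul_diagonal_mul_le _ _ _).trans_lt ?_
  rw [Fintype.card_subtype, Fintype.card_subtype]
  refine Finset.card_lt_card ⟨fun i hi => ?_, fun hsub => ?_⟩
  · simp only [Finset.mem_filter, Finset.mem_univ, true_and] at hi ⊢
    by_cases hij : i = j
    · subst hij; exact hd
    · simpa [hij] using hi
  · simpa using hsub (Finset.mem_filter.2 ⟨Finset.mem_univ j, hd⟩)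

namespace IsBalanced

variable {n m r : ℕ} {X : Mat n m} {P : Mat n r} {d : Fin r → ℝ} {Q : Mat m r}

theorem rank_le_of_mul {n' m' : ℕ} (h : IsBalanced X P d Q) (A : Mat n' r) (B : Mat r m') :
    (A * Matrix.diagonal d * B).rank ≤ X.rank := by
  classical
  rw [h.rank_eq]
  exact rank_mul_diagonal_mul_le A d B

theorem rank_lt_of_mul {n' m' : ℕ} (h : IsBalanced X P d Q) {A : Mat n' r} (B : Mat r m')
    {j : Fin r} (hA : colNorm A j = 0) (hd : d j ≠ 0) :
    (A * Matrix.diagonal d * B).rank < X.rank := by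
  classical
  rw [h.rank_eq]
  exact rank_mul_diagonal_mul_lt B ((colNorm_eq_zero_iff A j).1 hA) hd

/-- The descending order puts the nonzero entries first, so the active columns are the same index
set for all matrices of equal rank. -/
theorem ne_zero_iff (h : IsBalanced X P d Q) (hrm : r ≤ m) (i : Fin r) :
    d i ≠ 0 ↔ (i : ℕ) < X.rank := by
  have h1 : X.rank = Module.finrank ℝ (LinearMap.range (Matrix.toEuclideanLin X)) := by
    rw [Matrix.toEuclideanLin_eq_toLin_orthonormal]
    exact Matrix.rank_eq_finrank_range_toLin _ _ _
  have h2 := LinearMap.singularValues_pos_iff_lt_finrank_range (Matrix.toEuclideanLin X) (n := i)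
  have h3 : (Matrix.toEuclideanLin X).singularValues i = d i ^ 2 := h.sv_fin hrm i
  rw [h1, ← h2, h3]
  exact ⟨fun h => by positivity, fun h h0 => by simp [h0] at h⟩

end IsBalanced

end Rank

/-! ### Spectral norm against column norms and the Frobenius norm. -/

section SpecNorm

theorem colNorm_le_specNorm {a b : ℕ} (X : Mat a b) (j : Fin b) : colNorm X j ≤ specNorm X := by
  have h := (LinearMap.toContinuousLinearMap (Matrix.toEuclideanLin X)).le_opNorm
    (EuclideanSpace.single j (1 : ℝ))
  have h1 : Matrix.toEuclideanLin X (EuclideanSpace.single j (1 : ℝ)) = colVec X j := by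
    ext i
    simp [colVec_apply]
  rw [LinearMap.coe_toContinuousLinearMap', h1] at h
  rw [specNorm]
  simpa [norm_colVec] using h

theorem specNorm_le_norm {a b : ℕ} (X : Mat a b) : specNorm X ≤ ‖X‖ := by
  refine ContinuousLinearMap.opNorm_le_bound _ (norm_nonneg _) fun v => ?_
  have h := Matrix.frobenius_norm_mul X (Matrix.replicateCol Unit (fun i => v i))
  rw [← Matrix.replicateCol_mulVec, Matrix.frobenius_norm_replicateCol,
    Matrix.frobenius_norm_replicateCol] at h
  exact h

end SpecNorm

/-! ### Rank monotonicity, the column gap and part (a). -/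

namespace IsRun

variable {n m r : ℕ} {M : Model n m} {a : AlgParams} {s : Iterates n m r} (hs : IsRun M a s)

include hs

theorem Xhat_eq_mul_diagonal (k : ℕ) :
    s.Xhat (k + 1) = s.U (k + 1) * Matrix.diagonal (s.Dbar k) * (s.Pbar k)ᵀ := by
  rw [hs.Xhat_eq, hs.Vbar_eq, Matrix.transpose_mul, Matrix.diagonal_transpose, Matrix.mul_assoc]

theorem Xbar_transpose_eq_mul_diagonal (k : ℕ) : (s.Xbar (k + 1))ᵀ
    = s.V (k + 1) * Matrix.diagonal (s.Dhat (k + 1)) * (s.Phat (k + 1))ᵀ := by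
  rw [hs.Xbar_succ_eq, hs.step2_Uhat, Matrix.transpose_mul, Matrix.transpose_transpose,
    Matrix.transpose_mul, Matrix.diagonal_transpose, Matrix.mul_assoc]

theorem rank_Xhat_le (k : ℕ) : (s.Xhat (k + 1)).rank ≤ (s.Xbar k).rank := by
  rw [hs.Xhat_eq_mul_diagonal]
  exact (hs.balanced_Xbar k).rank_le_of_mul _ _

theorem rank_Xbar_succ_le (k : ℕ) : (s.Xbar (k + 1)).rank ≤ (s.Xhat (k + 1)).rank := by
  rw [← Matrix.rank_transpose, hs.Xbar_transpose_eq_mul_diagonal]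
  exact (hs.balanced_Xhat k).rank_le_of_mul _ _

/-- Columns of the iterates that carry the rank do not vanish. -/
theorem colNorm_U_ne_zero {k : ℕ} (h : (s.Xhat (k + 1)).rank = (s.Xbar k).rank) {j : Fin r}
    (hd : s.Dbar k j ≠ 0) : colNorm (s.U (k + 1)) j ≠ 0 := fun h0 =>
  absurd h (ne_of_lt (by
    conv_lhs => rw [hs.Xhat_eq_mul_diagonal]
    exact (hs.balanced_Xbar k).rank_lt_of_mul _ h0 hd))

theorem colNorm_V_ne_zero {k : ℕ} (h : (s.Xbar (k + 1)).rank = (s.Xhat (k + 1)).rank) {j : Fin r}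
    (hd : s.Dhat (k + 1) j ≠ 0) : colNorm (s.V (k + 1)) j ≠ 0 := fun h0 =>
  absurd h (ne_of_lt (by
    conv_lhs => rw [← Matrix.rank_transpose, hs.Xbar_transpose_eq_mul_diagonal]
    exact (hs.balanced_Xhat k).rank_lt_of_mul _ h0 hd))

theorem colNorm_Ubar (k : ℕ) (j : Fin r) : colNorm (s.Ubar k) j = s.Dbar k j := by
  rw [hs.Ubar_eq, colNorm_isometry_mul_diagonal (hs.isometry_PhatQbar k),
    abs_of_nonneg (hs.Dbar_nonneg k j)]

theorem colNorm_Vbar (k : ℕ) (j : Fin r) : colNorm (s.Vbar k) j = s.Dbar k j := by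
  rw [hs.Vbar_eq, colNorm_isometry_mul_diagonal (hs.isometry_Pbar k),
    abs_of_nonneg (hs.Dbar_nonneg k j)]

theorem colNorm_Uhat (k : ℕ) (j : Fin r) : colNorm (s.Uhat (k + 1)) j = s.Dhat (k + 1) j := by
  rw [hs.step2_Uhat, colNorm_isometry_mul_diagonal (hs.isometry_Phat (k + 1)),
    abs_of_nonneg ((hs.step2_svd k).nonneg j)]

theorem colNorm_Vhat (k : ℕ) (j : Fin r) : colNorm (s.Vhat (k + 1)) j = s.Dhat (k + 1) j := by
  rw [hs.step2_Vhat, colNorm_isometry_mul_diagonal (hs.balanced_Xhat k).orthQ,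
    abs_of_nonneg ((hs.step2_svd k).nonneg j)]

omit hs in
theorem mem_prox_of_min (hM : M.Valid) {γ t x : ℝ} (hx : 0 ≤ x)
    (h : ∀ y, 0 ≤ y → 1 / (2 * γ) * (t - x) ^ 2 + M.tau x ≤ 1 / (2 * γ) * (t - y) ^ 2 + M.tau y) :
    x ∈ prox γ M.θ t := by
  intro y
  rcases lt_or_ge y 0 with hy | hy
  · rw [hM.theta_neg y hy, EReal.coe_add_top]
    exact le_top
  · rw [hM.theta_eq hx, hM.theta_eq hy, ← EReal.coe_add, ← EReal.coe_add, EReal.coe_le_coe_iff]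
    exact h y hy

/-- Uniform lower bound on the nonzero columns of `Uᵏ` and `Vᵏ`. -/
theorem exists_column_gap (hr : 1 ≤ r) (hM : M.Valid) (ha : a.Valid) (h2 : Assumption2 M a s) :
    ∃ cp : ℝ, 0 < cp ∧ ∀ k (j : Fin r),
      (colNorm (s.U (k + 1)) j ≠ 0 → cp ≤ colNorm (s.U (k + 1)) j) ∧
      (colNorm (s.V (k + 1)) j ≠ 0 → cp ≤ colNorm (s.V (k + 1)) j) := by
  obtain ⟨β, hβ, hbd, hprox⟩ := h2
  have hmu := hM.mu_pos
  -- The parameter `λ / β` must lie in the range of Assumption 2. Index `1` is used because `s.gam1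
  -- 0` may be smaller than `a.lo1`; a column index exists since `1 ≤ r`.
  have hγ : M.lam * β⁻¹ ≤ M.lam * (M.mu + min a.lo1 a.lo2)⁻¹ := by
    refine mul_le_mul_of_nonneg_left ?_ hM.lam_pos.le
    have hpos := lt_min ha.lo1_pos ha.lo2_pos
    refine inv_anti₀ (by positivity) ?_
    have h := (hbd 1 ⟨0, hr⟩).1
    have h3 : a.lo1 ≤ s.gam1 1 := by rw [hs.step5_gam1]; exact le_max_left _ _
    have h4 : 0 ≤ (M.L : ℝ) * s.Dbar 1 ⟨0, hr⟩ ^ 2 := by positivity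
    linarith [min_le_left a.lo1 a.lo2]
  obtain ⟨cp, hcp, hgap⟩ := hprox _ le_rfl hγ
  have key : ∀ {l : ℕ} {c : Fin r → ℝ} {G W₀ W : Mat l r},
      (∀ Z, sepObj M.tau M.lam M.mu c G W₀ W ≤ sepObj M.tau M.lam M.mu c G W₀ Z) →
      ∀ j, 0 ≤ c j → c j + M.mu ≤ β → colNorm W j ≠ 0 → cp ≤ colNorm W j := by
    intro l c G W₀ W hmin j hc hcβ hne
    obtain ⟨t, ht, htmin⟩ := exists_prox_of_colObj_min hM.tau_zero (fun t ht => hM.tau_nonneg ht)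
      hM.lam_pos hM.mu_pos hc hcβ (norm_ne_zero_iff.1 hne) (colObj_min_of_sepObj_min hmin j)
    exact (hgap t ht _ (mem_prox_of_min hM (norm_nonneg _) htmin)).resolve_left hne
  refine ⟨cp, hcp, fun k j => ⟨?_, ?_⟩⟩
  · have := hs.gam1_pos ha k
    exact key (hs.U_min hM k) j (by positivity) (by linarith [(hbd k j).1])
  · have := hs.gam2_pos ha k
    exact key (hs.V_min hM k) j (by positivity) (by linarith [(hbd k j).2])

theorem exists_stableFrom (hr : 1 ≤ r) (hrn : r ≤ n) (hnm : n ≤ m) (hM : M.Valid) (ha : a.Valid)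
    (h1 : Assumption1 hrn hnm M.θ) (h2 : Assumption2 M a s) :
    ∃ (rbar : ℕ) (α : ℝ) (kt : ℕ), StableFrom s rbar α kt := by
  have hrm := hrn.trans hnm
  obtain ⟨cp, hcp, hgap⟩ := hs.exists_column_gap hr hM ha h2
  have hanti : Antitone fun k => (s.Xbar k).rank :=
    antitone_nat_of_succ_le fun k => (hs.rank_Xbar_succ_le k).trans (hs.rank_Xhat_le k)
  -- A decreasing sequence of naturals stays at its minimum once attained; the ranks of `Xhat` are
  -- squeezed between consecutive ranks of `Xbar`.
  obtain ⟨_, ⟨k₀, rfl⟩, hk₀⟩ := (wellFounded_lt (α := ℕ)).has_min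
    (range fun k => (s.Xbar k).rank) ⟨_, mem_range_self 0⟩
  set ρ := (s.Xbar k₀).rank with hρ
  have hbar : ∀ k ≥ k₀, (s.Xbar k).rank = ρ := fun k hk =>
    le_antisymm (hanti hk) (not_lt.1 (hk₀ _ (mem_range_self k)))
  have hhat : ∀ k ≥ k₀, (s.Xhat (k + 1)).rank = ρ := fun k hk =>
    le_antisymm ((hs.rank_Xhat_le k).trans (hbar k hk).le)
      ((hbar (k + 1) (by omega)).ge.trans (hs.rank_Xbar_succ_le k))
  have hev : ∀ᶠ k in atTop, ‖s.U (k + 1) - s.Ubar k‖ < cp / 2 ∧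
      ‖s.V (k + 1) - s.Vhat (k + 1)‖ < cp / 2 :=
    ((hs.tendsto_U_sub hM ha h1).eventually_lt_const (half_pos hcp)).and
      ((hs.tendsto_V_sub hM ha h1).eventually_lt_const (half_pos hcp))
  obtain ⟨K, hK⟩ := eventually_atTop.1 hev
  have hρr : ρ ≤ r := (hs.balanced_Xbar k₀).rank_le
  -- Constant rank forbids a zero active column of `U (k + 1)`, so its norm is at least `cp`. The
  -- column of `Ubar k`, of norm `Dbar k j`, differs from it by less than `cp / 2`.
  have hDbar : ∀ k ≥ max k₀ K, ∀ j : Fin r, (j : ℕ) < ρ → cp / 2 ≤ s.Dbar k j := by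
    intro k hk j hj
    have hk1 : k₀ ≤ k := (le_max_left _ _).trans hk
    have hne := ((hs.balanced_Xbar k).ne_zero_iff hrm j).2 (by rwa [hbar k hk1])
    have h3 := (hgap k j).1 (hs.colNorm_U_ne_zero ((hhat k hk1).trans (hbar k hk1).symm) hne)
    have h4 := colNorm_sub_le (s.U (k + 1)) (s.Ubar k) j
    have h5 := colNorm_le_norm (s.U (k + 1) - s.Ubar k) j
    have h6 := (hK k ((le_max_right _ _).trans hk)).1
    rw [hs.colNorm_Ubar] at h4
    linarith
  have hDhat : ∀ k ≥ max k₀ K, ∀ j : Fin r, (j : ℕ) < ρ → cp / 2 ≤ s.Dhat (k + 1) j := by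
    intro k hk j hj
    have hk1 : k₀ ≤ k := (le_max_left _ _).trans hk
    have hne := ((hs.balanced_Xhat k).ne_zero_iff hrm j).2 (by rwa [hhat k hk1])
    have h3 := (hgap k j).2 (hs.colNorm_V_ne_zero
      ((hbar (k + 1) (by omega)).trans (hhat k hk1).symm) hne)
    have h4 := colNorm_sub_le (s.V (k + 1)) (s.Vhat (k + 1)) j
    have h5 := colNorm_le_norm (s.V (k + 1) - s.Vhat (k + 1)) j
    have h6 := (hK k ((le_max_right _ _).trans hk)).2
    rw [hs.colNorm_Vhat] at h4
    linarith
  -- Singular values are the squares of the diagonal entries, hence the square in `α`. The shift by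
  -- one accounts for the bounds on `Dhat (k + 1)`.
  refine ⟨ρ, (cp / 2) ^ 2, max k₀ K + 1, by omega, by positivity, fun k hk => ?_, fun k hk => ?_,
    fun k hk i hi => ?_, fun k hk i hi => ?_⟩
  · exact hbar k (by have := le_max_left k₀ K; omega)
  · obtain ⟨k', rfl⟩ : ∃ k', k = k' + 1 := ⟨k - 1, by omega⟩
    exact hhat k' (by have := le_max_left k₀ K; omega)
  · rw [(hs.balanced_Xbar k).sv_fin hrm ⟨i, hi.trans_le hρr⟩]
    exact pow_le_pow_left₀ (by positivity) (hDbar k (by omega) _ hi) 2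
  · obtain ⟨k', rfl⟩ : ∃ k', k = k' + 1 := ⟨k - 1, by omega⟩
    rw [(hs.balanced_Xhat k').sv_fin hrm ⟨i, hi.trans_le hρr⟩]
    exact pow_le_pow_left₀ (by positivity) (hDhat k' (by omega) _ hi) 2

end IsRun

/-! ### The stable phase and existence of the aligning matrices. -/

section Stable

variable {n m r : ℕ} {M : Model n m} {a : AlgParams} {s : Iterates n m r} (hs : IsRun M a s)
  {rbar kt : ℕ} {α : ℝ}

include hs

theorem StableFrom.le_sq_Dbar (h : StableFrom s rbar α kt) (hrm : r ≤ m) {k : ℕ} (hk : kt ≤ k)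
    (i : Fin r) (hi : (i : ℕ) < rbar) : α ≤ s.Dbar k i ^ 2 := by
  rw [← (hs.balanced_Xbar k).sv_fin hrm i]
  exact h.sv_bar k hk i hi

theorem StableFrom.le_sq_Dhat (h : StableFrom s rbar α kt) (hrm : r ≤ m) {k : ℕ} (hk : kt ≤ k)
    (i : Fin r) (hi : (i : ℕ) < rbar) : α ≤ s.Dhat (k + 1) i ^ 2 := by
  rw [← (hs.balanced_Xhat k).sv_fin hrm i]
  exact h.sv_hat (k + 1) (by omega) i hi

theorem StableFrom.Dbar_eq_zero (h : StableFrom s rbar α kt) (hrm : r ≤ m) {k : ℕ} (hk : kt ≤ k)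
    (i : Fin r) (hi : rbar ≤ i) : s.Dbar k i = 0 := by
  by_contra h0
  have := ((hs.balanced_Xbar k).ne_zero_iff hrm i).1 h0
  rw [h.rank_bar k hk] at this
  omega

theorem StableFrom.Dhat_eq_zero (h : StableFrom s rbar α kt) (hrm : r ≤ m) {k : ℕ} (hk : kt ≤ k)
    (i : Fin r) (hi : rbar ≤ i) : s.Dhat (k + 1) i = 0 := by
  by_contra h0
  have := ((hs.balanced_Xhat k).ne_zero_iff hrm i).1 h0
  rw [h.rank_hat (k + 1) (by omega)] at this
  omega

/-- A real `⨆` over an unbounded family takes a default value; boundedness of the iterates, through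
the Frobenius norm, makes `betaBar` a genuine supremum. -/
theorem IsRun.le_betaBar (hM : M.Valid) (ha : a.Valid) {hrn : r ≤ n} {hnm : n ≤ m}
    (h1 : Assumption1 hrn hnm M.θ) (k : ℕ) :
    max (specNorm (s.Vbar k)) (specNorm (s.Uhat (k + 1))) ≤ betaBar s := by
  obtain ⟨C, _, hC⟩ := hs.exists_bound hM ha h1
  refine le_ciSup (f := fun k => max (specNorm (s.Vbar k)) (specNorm (s.Uhat (k + 1)))) ⟨C, ?_⟩ k
  rintro _ ⟨k, rfl⟩
  obtain ⟨_, h2, h3, _⟩ := hC k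
  exact max_le ((specNorm_le_norm _).trans h2) ((specNorm_le_norm _).trans h3)

theorem IsRun.betaBar_nonneg (hM : M.Valid) (ha : a.Valid) {hrn : r ≤ n} {hnm : n ≤ m}
    (h1 : Assumption1 hrn hnm M.θ) : 0 ≤ betaBar s :=
  le_trans (norm_nonneg _) ((le_max_left _ _).trans (hs.le_betaBar hM ha h1 0))

theorem StableFrom.exists_alignHat (h : StableFrom s rbar α kt) (hM : M.Valid) (ha : a.Valid)
    {hrn : r ≤ n} {hnm : n ≤ m} (h1 : Assumption1 hrn hnm M.θ) {k : ℕ} (hk : kt ≤ k) :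
    ∃ R, AlignHat s rbar α k R := by
  have hrm := hrn.trans hnm
  have hk1 : kt ≤ k + 1 := by omega
  have := (hs.balanced_Xhat k).exists_alignment (hs.balanced_Xbar (k + 1)) hrm h.alpha_pos
    (hs.betaBar_nonneg hM ha h1)
    (fun i => by
      rw [← hs.colNorm_Uhat]
      exact (colNorm_le_specNorm _ _).trans ((le_max_right _ _).trans (hs.le_betaBar hM ha h1 k)))
    (h.le_sq_Dhat hs hrm hk) (h.Dhat_eq_zero hs hrm hk) (h.le_sq_Dbar hs hrm hk1)
    (h.Dbar_eq_zero hs hrm hk1)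
  rw [← hs.Ubar_eq, ← hs.Vbar_eq, ← hs.step2_Uhat, ← hs.step2_Vhat] at this
  obtain ⟨R, hR, hle⟩ := this
  exact ⟨R, hR, hle⟩

theorem StableFrom.exists_alignBar (h : StableFrom s rbar α kt) (hM : M.Valid) (ha : a.Valid)
    {hrn : r ≤ n} {hnm : n ≤ m} (h1 : Assumption1 hrn hnm M.θ) {k : ℕ} (hk : kt ≤ k) :
    ∃ R, AlignBar s rbar α k R := by
  have hrm := hrn.trans hnm
  have hk1 : kt ≤ k + 1 := by omega
  have := (hs.balanced_Xbar k).exists_alignment (hs.balanced_Xbar (k + 1)) hrm h.alpha_pos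
    (hs.betaBar_nonneg hM ha h1)
    (fun i => by
      rw [← hs.colNorm_Vbar]
      exact (colNorm_le_specNorm _ _).trans ((le_max_left _ _).trans (hs.le_betaBar hM ha h1 k)))
    (h.le_sq_Dbar hs hrm hk) (h.Dbar_eq_zero hs hrm hk) (h.le_sq_Dbar hs hrm hk1)
    (h.Dbar_eq_zero hs hrm hk1)
  simp only [← hs.Ubar_eq, ← hs.Vbar_eq] at this
  obtain ⟨R, hR, hle⟩ := this
  exact ⟨R, hR, hle⟩

end Stable

/-! ### A limiting subgradient of the objective. -/

section Subdifferential

/-- The gradient of a smooth minorant that touches `h` is a limiting subgradient. -/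
theorem mem_limitingSubdiff_of_hasFDerivAt {E : Type*} [NormedAddCommGroup E]
    [InnerProductSpace ℝ E] {h : E → EReal} {ψ : E → ℝ} {x ω : E}
    (hψ : HasFDerivAt ψ (innerSL ℝ ω) x) (hle : ∀ y, (ψ y : EReal) ≤ h y) (heq : h x = ψ x) :
    ω ∈ limitingSubdiff h x := by
  have hreg : ω ∈ regularSubdiff h x := by
    refine ⟨by simp [heq], by simp [heq], fun ε hε => ?_⟩
    filter_upwards [hψ.isLittleO.def hε] with y hy
    refine le_trans ?_ (hle y)
    rw [heq, ← EReal.coe_add, EReal.coe_le_coe_iff]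
    rw [Real.norm_eq_abs, innerSL_apply_apply] at hy
    linarith [neg_abs_le (ψ y - ψ x - inner ℝ ω (y - x))]
  exact ⟨by simp [heq], by simp [heq], fun _ => x, fun _ => ω, tendsto_const_nhds,
    tendsto_const_nhds, tendsto_const_nhds, fun _ => hreg⟩

variable {E F G : Type*} [NormedAddCommGroup E] [InnerProductSpace ℝ E]
  [NormedAddCommGroup F] [InnerProductSpace ℝ F] [NormedAddCommGroup G] [InnerProductSpace ℝ G]

theorem hasFDerivAt_comp_fst {g : E → ℝ} {p : WithLp 2 (E × F)} {u : E}
    (h : HasFDerivAt g (innerSL ℝ u) p.fst) :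
    HasFDerivAt (fun q : WithLp 2 (E × F) => g q.fst)
      (innerSL ℝ (WithLp.toLp 2 (u, (0 : F)))) p := by
  have h1 : HasFDerivAt (fun q : WithLp 2 (E × F) => q.fst)
      ((ContinuousLinearMap.fst ℝ E F).comp
        (WithLp.prodContinuousLinearEquiv 2 ℝ E F).toContinuousLinearMap) p :=
    ((ContinuousLinearMap.fst ℝ E F).comp
      (WithLp.prodContinuousLinearEquiv 2 ℝ E F).toContinuousLinearMap).hasFDerivAt
  refine (h.comp p h1).congr_fderiv ?_
  ext q
  simp [WithLp.prod_inner_apply]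

theorem hasFDerivAt_comp_snd {g : F → ℝ} {p : WithLp 2 (E × F)} {v : F}
    (h : HasFDerivAt g (innerSL ℝ v) p.snd) :
    HasFDerivAt (fun q : WithLp 2 (E × F) => g q.snd)
      (innerSL ℝ (WithLp.toLp 2 ((0 : E), v))) p := by
  have h1 : HasFDerivAt (fun q : WithLp 2 (E × F) => q.snd)
      ((ContinuousLinearMap.snd ℝ E F).comp
        (WithLp.prodContinuousLinearEquiv 2 ℝ E F).toContinuousLinearMap) p :=
    ((ContinuousLinearMap.snd ℝ E F).comp
      (WithLp.prodContinuousLinearEquiv 2 ℝ E F).toContinuousLinearMap).hasFDerivAt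
  refine (h.comp p h1).congr_fderiv ?_
  ext q
  simp [WithLp.prod_inner_apply]

/-- Product rule in gradient form: `u` and `v` represent the adjoints of the two partial maps of `B`
applied to the gradient `y`. -/
theorem hasFDerivAt_comp_bilinear {f : G → ℝ} {B : E → F → G}
    (hB : IsBoundedBilinearMap ℝ fun q : E × F => B q.1 q.2) {p : WithLp 2 (E × F)} {y : G}
    {u : E} {v : F} (hf : HasFDerivAt f (innerSL ℝ y) (B p.fst p.snd))
    (hu : ∀ x, inner ℝ y (B x p.snd) = inner ℝ u x)
    (hv : ∀ x, inner ℝ y (B p.fst x) = inner ℝ v x) :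
    HasFDerivAt (fun q : WithLp 2 (E × F) => f (B q.fst q.snd))
      (innerSL ℝ (WithLp.toLp 2 (u, v))) p := by
  have h1 : HasFDerivAt (fun q : WithLp 2 (E × F) => (q.fst, q.snd))
      (WithLp.prodContinuousLinearEquiv 2 ℝ E F).toContinuousLinearMap p :=
    ContinuousLinearMap.hasFDerivAt (WithLp.prodContinuousLinearEquiv 2 ℝ E F).toContinuousLinearMap
  have h2 := (hB.hasFDerivAt (p.fst, p.snd)).comp p h1
  have h3 : HasFDerivAt (fun q : WithLp 2 (E × F) => f (B q.fst q.snd)) _ p := hf.comp p h2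
  refine h3.congr_fderiv ?_
  ext q
  simp [WithLp.prod_inner_apply, inner_add_right, hu, hv, add_comm]

theorem hasFDerivAt_half_norm_sq (c : ℝ) (w : E) :
    HasFDerivAt (fun u : E => c / 2 * ‖u‖ ^ 2) (innerSL ℝ (c • w)) w := by
  refine ((hasStrictFDerivAt_norm_sq w).hasFDerivAt.const_mul (c / 2)).congr_fderiv ?_
  ext u
  simp
  ring

theorem isBoundedBilinearMap_mul_transpose (n m r : ℕ) :
    IsBoundedBilinearMap ℝ fun q : Mat n r × Mat m r => q.1 * q.2ᵀ where
  add_left := fun _ _ _ => Matrix.add_mul _ _ _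
  smul_left := fun _ _ _ => Matrix.smul_mul _ _ _
  add_right := fun _ _ _ => by simp [Matrix.mul_add]
  smul_right := fun _ _ _ => by simp
  bound := ⟨1, one_pos, fun U V => by
    rw [one_mul]
    exact (Matrix.frobenius_norm_mul _ _).trans_eq (by rw [Matrix.frobenius_norm_transpose])⟩

/-- Extension of the leading columns by zero. -/
def leadExt {l r ρ : ℕ} (A : Matrix (Fin l) (Lead r ρ) ℝ) : Mat l r :=
  Matrix.of fun i j => if h : (j : ℕ) < ρ then A i ⟨j, h⟩ else 0

theorem leadCols_leadExt {l r ρ : ℕ} (A : Matrix (Fin l) (Lead r ρ) ℝ) :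
    leadCols ρ (leadExt A) = A := by
  ext i j
  simp [leadCols_apply, leadExt, j.2]

theorem leadExt_apply_of_le {l r ρ : ℕ} (A : Matrix (Fin l) (Lead r ρ) ℝ) (i : Fin l) {j : Fin r}
    (hj : ρ ≤ j) : leadExt A i j = 0 := by
  simp [leadExt, not_lt.2 hj]

theorem inner_leadExt {l r ρ : ℕ} (A : Matrix (Fin l) (Lead r ρ) ℝ) (Z : Mat l r) :
    inner ℝ (leadExt A) Z = inner ℝ A (leadCols ρ Z) := by
  rw [inner_eq_sum, inner_eq_sum,
    ← sum_lead_eq (ρ := ρ) (fun j => ∑ i, leadExt A i j * Z i j)]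
  · refine Finset.sum_congr rfl fun j _ => Finset.sum_congr rfl fun i _ => ?_
    rw [leadCols_apply, ← leadCols_apply (leadExt A), leadCols_leadExt]
  · intro j hj
    simp [leadExt_apply_of_le A _ hj]

theorem hasFDerivAt_sum_colNorm_leadCols {τ : ℝ → ℝ} {l r ρ : ℕ} {W : Mat l r}
    (hτ : ∀ t, 0 < t → DifferentiableAt ℝ τ t) (hW : ∀ j : Lead r ρ, colNorm W j.1 ≠ 0) :
    HasFDerivAt (fun Z : Mat l r => ∑ j, τ (colNorm (leadCols ρ Z) j))
      (innerSL ℝ (leadExt (normGrad τ (leadCols ρ W)))) W := by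
  have h1 : ∀ j : Lead r ρ, colCLM l j.1 W ≠ 0 := fun j => norm_ne_zero_iff.1 (hW j)
  have h2 : ∀ j : Lead r ρ, HasDerivAt τ (deriv τ (colNorm W j.1)) ‖colCLM l j.1 W‖ := fun j =>
    (hτ _ ((colNorm_nonneg W j.1).lt_of_ne' (hW j))).hasDerivAt
  have h3 : ∀ Z : Mat l r, inner ℝ (leadExt (normGrad τ (leadCols ρ W))) Z
      = ∑ j : Lead r ρ, deriv τ (colNorm W j.1) / ‖colCLM l j.1 W‖
        * inner ℝ (colCLM l j.1 W) (colCLM l j.1 Z) := by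
    intro Z
    rw [inner_leadExt, inner_eq_sum_colVec]
    refine Finset.sum_congr rfl fun j _ => ?_
    rw [colVec_normGrad, real_inner_smul_left]
    rfl
  exact hasFDerivAt_sum_comp_norm h1 h2 h3

/-- The omitted terms are nonnegative. This makes the regularizer on the leading columns a minorant,
smooth where those columns do not vanish. -/
theorem Model.Valid.reg_leadCols_le {n m l r ρ : ℕ} {M : Model n m} (hM : M.Valid) (W : Mat l r) :
    M.reg (leadCols ρ W) ≤ M.reg W := by
  have := Finset.sum_le_sum_of_subset_of_nonneg
    (Finset.subset_univ (Finset.univ.filter fun j : Fin r => (j : ℕ) < ρ))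
    (f := fun j => M.tau (colNorm W j)) (fun j _ _ => hM.tau_nonneg (colNorm_nonneg W j))
  rw [Finset.sum_subtype (p := fun j : Fin r => (j : ℕ) < ρ) _ (by simp)] at this
  exact this

theorem Model.Valid.reg_leadCols_eq {n m l r ρ : ℕ} {M : Model n m} (hM : M.Valid) {W : Mat l r}
    (hW : ∀ j : Fin r, ρ ≤ j → colNorm W j = 0) : M.reg (leadCols ρ W) = M.reg W :=
  sum_lead_eq (fun j => M.tau (colNorm W j)) fun j hj => by rw [hW j hj, hM.tau_zero]

/-- A limiting subgradient of the objective at a pair whose columns vanish exactly outside the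
leading block. -/
theorem Model.Valid.mem_limitingSubdiff_Phi {n m r ρ : ℕ} {M : Model n m} (hM : M.Valid)
    {U : Mat n r} {V : Mat m r} (hU : ∀ j : Lead r ρ, colNorm U j.1 ≠ 0)
    (hV : ∀ j : Lead r ρ, colNorm V j.1 ≠ 0) (hU0 : ∀ j : Fin r, ρ ≤ j → colNorm U j = 0)
    (hV0 : ∀ j : Fin r, ρ ≤ j → colNorm V j = 0) :
    WithLp.toLp 2
      (gradient M.f (U * Vᵀ) * V + M.lam • leadExt (normGrad M.tau (leadCols ρ U)) + M.mu • U,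
        (gradient M.f (U * Vᵀ))ᵀ * U + M.lam • leadExt (normGrad M.tau (leadCols ρ V))
          + M.mu • V)
      ∈ limitingSubdiff (M.Phi (r := r)) (WithLp.toLp 2 (U, V)) := by
  set p : Pair n m r := WithLp.toLp 2 (U, V) with hp
  have h1 : HasFDerivAt (fun q : Pair n m r => M.f (q.fst * q.sndᵀ))
      (innerSL ℝ (WithLp.toLp 2
        (gradient M.f (U * Vᵀ) * V, (gradient M.f (U * Vᵀ))ᵀ * U) : Pair n m r)) p := by
    refine hasFDerivAt_comp_bilinear (B := fun (U : Mat n r) (V : Mat m r) => U * Vᵀ)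
      (isBoundedBilinearMap_mul_transpose n m r)
      (hM.differentiable (U * Vᵀ)).hasGradientAt.hasFDerivAt (fun Z => ?_) (fun Z => ?_)
    · exact (inner_mul_right_eq _ _ _).symm
    · have h2 : U * Zᵀ = (Z * Uᵀ)ᵀ := by simp
      change inner ℝ (gradient M.f (U * Vᵀ)) (U * Zᵀ) = _
      rw [h2, inner_mul_right_eq, ← inner_transpose, Matrix.transpose_transpose]
  have hτ : ∀ t, 0 < t → DifferentiableAt ℝ M.tau t := fun t ht => hM.tau_differentiableAt ht
  have h2 := (hasFDerivAt_comp_fst (F := Mat m r) (p := p)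
    (hasFDerivAt_sum_colNorm_leadCols hτ hU)).const_mul M.lam
  have h3 := (hasFDerivAt_comp_snd (E := Mat n r) (p := p)
    (hasFDerivAt_sum_colNorm_leadCols hτ hV)).const_mul M.lam
  have h4 := hasFDerivAt_half_norm_sq M.mu p
  have h5 := ((h1.add h2).add h3).add h4
  -- The minorant omits the trailing columns from the regularizer, so possible nonsmoothness of `θ`
  -- at zero does not matter; equality holds at `p` because these columns vanish there and `θ(0) =
  -- 0`.
  refine mem_limitingSubdiff_of_hasFDerivAt (ψ := fun q : Pair n m r => M.f (q.fst * q.sndᵀ)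
    + M.lam * M.reg (leadCols ρ q.fst) + M.lam * M.reg (leadCols ρ q.snd)
    + M.mu / 2 * ‖q‖ ^ 2) (h5.congr_fderiv ?_) (fun q => ?_) ?_
  · rw [← map_smul, ← map_smul, ← map_add, ← map_add, ← map_add]
    congr 1
    rw [hp, ← WithLp.toLp_smul, ← WithLp.toLp_smul, ← WithLp.toLp_smul, ← WithLp.toLp_add,
      ← WithLp.toLp_add, ← WithLp.toLp_add]
    simp
  · rw [hM.Phi_eq, EReal.coe_le_coe_iff, Model.phi, WithLp.prod_norm_sq_eq_of_L2]
    have h6 := mul_le_mul_of_nonneg_left (hM.reg_leadCols_le (ρ := ρ) q.fst) hM.lam_pos.le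
    have h7 := mul_le_mul_of_nonneg_left (hM.reg_leadCols_le (ρ := ρ) q.snd) hM.lam_pos.le
    linarith
  · rw [hM.Phi_eq, EReal.coe_eq_coe_iff, Model.phi, WithLp.prod_norm_sq_eq_of_L2]
    have h6 : M.reg (leadCols ρ p.fst) = M.reg p.fst := hM.reg_leadCols_eq hU0
    have h7 : M.reg (leadCols ρ p.snd) = M.reg p.snd := hM.reg_leadCols_eq hV0
    rw [h6, h7]
    ring

end Subdifferential

/-! ### The relative error bound. -/

section RelativeError

/-- Fermat's rule for a separable subproblem, restricted to the leading columns. -/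
theorem sepObj_min_fermat {τ : ℝ → ℝ} {lam mu : ℝ} {l r ρ : ℕ} {c : Fin r → ℝ} {G W₀ W : Mat l r}
    (hτ : ∀ t, 0 < t → DifferentiableAt ℝ τ t)
    (hmin : ∀ Z, sepObj τ lam mu c G W₀ W ≤ sepObj τ lam mu c G W₀ Z)
    (hW : ∀ j : Lead r ρ, colNorm W j.1 ≠ 0) :
    leadCols ρ G + leadCols ρ (W - W₀) * Matrix.diagonal (fun j : Lead r ρ => c j)
      + mu • leadCols ρ W + lam • normGrad τ (leadCols ρ W) = 0 := by
  ext i j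
  have h := colObj_min_fermat (norm_ne_zero_iff.1 (hW j))
    (hτ _ ((colNorm_nonneg W j.1).lt_of_ne' (hW j))).hasDerivAt (colObj_min_of_sepObj_min hmin j.1)
  have h1 := congrArg (fun v : EuclideanSpace ℝ (Fin l) => v i) h
  simp only [PiLp.add_apply, PiLp.smul_apply, PiLp.sub_apply, PiLp.zero_apply, colVec_apply,
    smul_eq_mul] at h1
  simp only [Matrix.add_apply, Matrix.smul_apply, Matrix.mul_diagonal, leadCols_apply,
    Matrix.sub_apply, normGrad, Matrix.of_apply, smul_eq_mul, Matrix.zero_apply]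
  rw [← h1]
  change _ = _ + lam * (deriv τ (colNorm (leadCols ρ W) j) / colNorm (leadCols ρ W) j * W i j)
  ring

/-- Comparison of a partial gradient at an aligned iterate with the optimality condition of the
subproblem that produced it. -/
theorem norm_partial_gradient_le {κ : Type*} [Fintype κ] [DecidableEq κ] {l q : ℕ} {F F' : Mat l q}
    {Y Y' : Matrix (Fin q) κ ℝ} {W W' D N N' : Matrix (Fin l) κ ℝ} {W₀ : Matrix (Fin l) κ ℝ}
    {B : Matrix κ κ ℝ} {c : κ → ℝ} {lam mu L x Fb C C₁ Bc β : ℝ} (hlam : 0 ≤ lam) (hmu : 0 ≤ mu)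
    (hD : D = W - W₀)
    (hfermat : F * Y + D * Matrix.diagonal c + mu • W + lam • N = 0)
    (hgap : ‖N' - N * B‖ ≤ ‖W' - W * B‖) (hF : ‖F' - F‖ ≤ L * x) (hFb : ‖F‖ ≤ Fb)
    (hY : ‖Y'‖ ≤ C) (hYB : ‖Y' - Y * B‖ ≤ C₁ * x) (hWB : ‖W' - W₀ * B‖ ≤ C₁ * x)
    (hB : ‖B‖ ≤ Bc) (hβ : 0 ≤ β) (hc : ∀ j, |c j| ≤ β) :
    ‖F' * Y' + lam • N' + mu • W'‖
      ≤ (L * C + Fb * C₁ + (lam + mu) * C₁) * x + ((lam + mu) * Bc + β * Bc) * ‖D‖ := by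
  have hW : W' - W * B = (W' - W₀ * B) - D * B := by
    rw [hD, Matrix.sub_mul]; abel
  have hDB : ‖D * B‖ ≤ Bc * ‖D‖ := by
    refine (Matrix.frobenius_norm_mul _ _).trans ?_
    rw [mul_comm]
    exact mul_le_mul_of_nonneg_right hB (norm_nonneg _)
  have hWn : ‖W' - W * B‖ ≤ C₁ * x + Bc * ‖D‖ := by
    rw [hW]
    exact (norm_sub_le _ _).trans (add_le_add hWB hDB)
  have hDc : ‖D * Matrix.diagonal c * B‖ ≤ β * Bc * ‖D‖ := by
    refine (Matrix.frobenius_norm_mul _ _).trans ?_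
    have h1 := norm_mul_diagonal_le D hβ hc
    calc ‖D * Matrix.diagonal c‖ * ‖B‖ ≤ (β * ‖D‖) * Bc :=
          mul_le_mul h1 hB (norm_nonneg _) (by positivity)
      _ = β * Bc * ‖D‖ := by ring
  have hF1 : ‖(F' - F) * Y'‖ ≤ L * C * x := by
    refine (Matrix.frobenius_norm_mul _ _).trans ?_
    calc ‖F' - F‖ * ‖Y'‖ ≤ (L * x) * C :=
          mul_le_mul hF hY (norm_nonneg _) ((norm_nonneg _).trans hF)
      _ = L * C * x := by ring
  have hF2 : ‖F * (Y' - Y * B)‖ ≤ Fb * C₁ * x := by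
    refine (Matrix.frobenius_norm_mul _ _).trans ?_
    calc ‖F‖ * ‖Y' - Y * B‖ ≤ Fb * (C₁ * x) :=
          mul_le_mul hFb hYB (norm_nonneg _) ((norm_nonneg _).trans hFb)
      _ = Fb * C₁ * x := by ring
  -- The optimality condition multiplied by `B` on the right is subtracted, so each term becomes a
  -- difference between new and aligned old quantities; the proximal and quadratic terms leave `D *
  -- diagonal c * B`.
  have hsplit : F' * Y' + lam • N' + mu • W'
      = (F' - F) * Y' + F * (Y' - Y * B) + lam • (N' - N * B) + mu • (W' - W * B)
        - D * Matrix.diagonal c * B := by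
    have h := congrArg (fun A => A * B) hfermat
    simp only [Matrix.add_mul, Matrix.zero_mul, Matrix.smul_mul] at h
    rw [← sub_eq_zero, ← h, Matrix.sub_mul, Matrix.mul_sub, ← Matrix.mul_assoc F Y B]
    module
  rw [hsplit]
  have h1 : ‖lam • (N' - N * B)‖ ≤ lam * (C₁ * x + Bc * ‖D‖) := by
    rw [norm_smul, Real.norm_of_nonneg hlam]
    exact mul_le_mul_of_nonneg_left (hgap.trans hWn) hlam
  have h2 : ‖mu • (W' - W * B)‖ ≤ mu * (C₁ * x + Bc * ‖D‖) := by
    rw [norm_smul, Real.norm_of_nonneg hmu]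
    exact mul_le_mul_of_nonneg_left hWn hmu
  calc _ ≤ ‖(F' - F) * Y'‖ + ‖F * (Y' - Y * B)‖ + ‖lam • (N' - N * B)‖ + ‖mu • (W' - W * B)‖
        + ‖D * Matrix.diagonal c * B‖ :=
        (norm_sub_le _ _).trans (add_le_add_left ((norm_add_le _ _).trans
          (add_le_add_left ((norm_add_le _ _).trans
            (add_le_add_left (norm_add_le _ _) _)) _)) _)
    _ ≤ _ := by linarith

/-- The factor `R * D` has the norm of `D`, at most `C`, and the inverse of the diagonal costs `1 /
√α`. Transposing turns that left factor into right multiplication by a diagonal matrix. -/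
theorem norm_conjD_le {r ρ l : ℕ} {P : Mat l r} (hP : Pᵀ * P = 1) {d : Fin r → ℝ} {α C : ℝ}
    (hα : 0 < α) (hd : ∀ i : Fin r, (i : ℕ) < ρ → α ≤ d i ^ 2) (hC : ‖P * Matrix.diagonal d‖ ≤ C)
    {R : Matrix (Lead r ρ) (Lead r ρ) ℝ} (hR : R ∈ Matrix.orthogonalGroup (Lead r ρ) ℝ) :
    ‖conjD d R‖ ≤ C / Real.sqrt α := by
  have hne : ∀ i : Fin r, (i : ℕ) < ρ → d i ≠ 0 := fun i hi h0 => by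
    have := hd i hi
    rw [h0] at this
    simp at this
    linarith
  set D : Matrix (Lead r ρ) (Lead r ρ) ℝ := Matrix.diagonal fun i => d i with hD
  have h1 : ‖R * D‖ ≤ C := by
    rw [norm_isometry_mul (orthogonal_transpose_mul hR)]
    refine le_trans ?_ hC
    rw [← norm_isometry_mul (leadCols_isometry (ρ := ρ) hP) D, hD, ← leadCols_mul_diagonal]
    exact norm_leadCols_le _
  have h2 : (conjD d R)ᵀ
      = (R * D)ᵀ * Matrix.diagonal (fun i : Lead r ρ => (d i)⁻¹) := by
    rw [← diagonal_mul_conjD hne R, Matrix.transpose_mul, Matrix.diagonal_transpose,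
      Matrix.mul_assoc, Matrix.diagonal_mul_diagonal]
    have : (fun i : Lead r ρ => d i * (d i)⁻¹) = fun _ => 1 := by
      funext i
      exact mul_inv_cancel₀ (hne i i.2)
    rw [this, Matrix.diagonal_one, Matrix.mul_one]
  rw [← Matrix.frobenius_norm_transpose, h2]
  refine (norm_mul_diagonal_le _ (c := (Real.sqrt α)⁻¹) (by positivity) fun i => ?_).trans ?_
  · rw [abs_inv]
    refine inv_anti₀ (Real.sqrt_pos.2 hα) ?_
    rw [← Real.sqrt_sq_eq_abs]
    exact Real.sqrt_le_sqrt (hd i i.2)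
  · rw [Matrix.frobenius_norm_transpose, div_eq_inv_mul]
    exact mul_le_mul_of_nonneg_left h1 (by positivity)

theorem norm_leadCols_sub_blk_le {l r ρ : ℕ} (Z' Z : Mat l r)
    (A : Matrix (Lead r ρ) (Lead r ρ) ℝ) :
    ‖leadCols ρ Z' - leadCols ρ Z * A‖ ≤ ‖Z' - Z * blk A‖ := by
  rw [← leadCols_mul_blk, ← leadCols_sub]
  exact norm_leadCols_le _

theorem norm_add_leadExt_eq {l q r ρ : ℕ} {lam mu : ℝ} (F : Mat l q) {Y : Mat q r}
    (N : Matrix (Fin l) (Lead r ρ) ℝ) {W : Mat l r} (hY : ∀ j : Fin r, ρ ≤ j → colNorm Y j = 0)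
    (hW : ∀ j : Fin r, ρ ≤ j → colNorm W j = 0) :
    ‖F * Y + lam • leadExt N + mu • W‖ = ‖F * leadCols ρ Y + lam • N + mu • leadCols ρ W‖ := by
  rw [← norm_leadCols_eq (ρ := ρ)]
  · congr 1
    conv_rhs => rw [← leadCols_leadExt N]
    rfl
  · intro i j hj
    have hY' := (colNorm_eq_zero_iff Y j).1 (hY j hj)
    have hW' := (colNorm_eq_zero_iff W j).1 (hW j hj)
    simp [Matrix.mul_apply, hY', hW', leadExt_apply_of_le N i hj]

theorem norm_toLp_le_add {n m r : ℕ} (A : Mat n r) (B : Mat m r) :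
    ‖(WithLp.toLp 2 (A, B) : Pair n m r)‖ ≤ ‖A‖ + ‖B‖ := by
  refine le_of_sq_le_sq ?_ (by positivity)
  rw [WithLp.prod_norm_sq_eq_of_L2]
  change ‖A‖ ^ 2 + ‖B‖ ^ 2 ≤ _
  nlinarith [mul_nonneg (norm_nonneg A) (norm_nonneg B)]

variable {n m r : ℕ} {M : Model n m} {a : AlgParams} {s : Iterates n m r}

section Bounds

variable {rbar kt : ℕ} {α : ℝ} (h : StableFrom s rbar α kt) (hs : IsRun M a s)

include h hs

theorem StableFrom.Dbar_ne_zero (hrm : r ≤ m) {k : ℕ} (hk : kt ≤ k) (j : Lead r rbar) :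
    s.Dbar k j.1 ≠ 0 := fun h0 => by
  have h1 := h.le_sq_Dbar hs hrm hk j.1 j.2
  have h2 := h.alpha_pos
  rw [h0] at h1
  norm_num at h1
  linarith

theorem StableFrom.Dhat_ne_zero (hrm : r ≤ m) {k : ℕ} (hk : kt ≤ k) (j : Lead r rbar) :
    s.Dhat (k + 1) j.1 ≠ 0 := fun h0 => by
  have h1 := h.le_sq_Dhat hs hrm hk j.1 j.2
  have h2 := h.alpha_pos
  rw [h0] at h1
  norm_num at h1
  linarith

theorem StableFrom.colNorm_U_ne_zero (hrm : r ≤ m) {k : ℕ} (hk : kt ≤ k) (j : Lead r rbar) :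
    colNorm (s.U (k + 1)) j.1 ≠ 0 :=
  hs.colNorm_U_ne_zero ((h.rank_hat _ (by omega)).trans (h.rank_bar _ hk).symm)
    (h.Dbar_ne_zero hs hrm hk j)

theorem StableFrom.colNorm_V_ne_zero (hrm : r ≤ m) {k : ℕ} (hk : kt ≤ k) (j : Lead r rbar) :
    colNorm (s.V (k + 1)) j.1 ≠ 0 :=
  hs.colNorm_V_ne_zero ((h.rank_bar _ (by omega)).trans (h.rank_hat _ (by omega)).symm)
    (h.Dhat_ne_zero hs hrm hk j)

theorem StableFrom.colNorm_Ubar_ne_zero (hrm : r ≤ m) {k : ℕ} (hk : kt ≤ k) (j : Lead r rbar) :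
    colNorm (s.Ubar k) j.1 ≠ 0 := by
  rw [hs.colNorm_Ubar]; exact h.Dbar_ne_zero hs hrm hk j

theorem StableFrom.colNorm_Vbar_ne_zero (hrm : r ≤ m) {k : ℕ} (hk : kt ≤ k) (j : Lead r rbar) :
    colNorm (s.Vbar k) j.1 ≠ 0 := by
  rw [hs.colNorm_Vbar]; exact h.Dbar_ne_zero hs hrm hk j

theorem StableFrom.norm_partial_gradient_fst_le (hM : M.Valid) (ha : a.Valid) (hrm : r ≤ m)
    {C Fb β C₁ : ℝ} {k : ℕ} (hk : kt ≤ k)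
    (hC₁ : C₁ = (Real.sqrt α + 4 * betaBar s) / (2 * α)) (hC : ∀ k, ‖s.Vbar k‖ ≤ C)
    (hFb : ‖gradient M.f (s.Xbar k)‖ ≤ Fb)
    (hβ : ∀ i : Fin r, M.L * s.Dbar k i ^ 2 + (M.mu + s.gam1 k) ≤ β) (hβ0 : 0 ≤ β)
    {R : Matrix (Lead r rbar) (Lead r rbar) ℝ} (hR : AlignBar s rbar α k R)
    (hg : GapU M.θ s rbar k R) :
    ‖gradient M.f (s.Xbar (k + 1)) * leadCols rbar (s.Vbar (k + 1))
        + M.lam • normGrad M.tau (leadCols rbar (s.Ubar (k + 1)))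
        + M.mu • leadCols rbar (s.Ubar (k + 1))‖
      ≤ (M.L * C + Fb * C₁ + (M.lam + M.mu) * C₁) * ‖s.Xbar (k + 1) - s.Xbar k‖
        + ((M.lam + M.mu) * (C / Real.sqrt α) + β * (C / Real.sqrt α))
          * ‖leadCols rbar (s.U (k + 1) - s.Ubar k)‖ := by
  have hmu := hM.mu_pos
  have hU := h.colNorm_U_ne_zero hs hrm hk
  rw [GapU, hM.gradVartheta_eq (W := leadCols rbar (s.Ubar (k + 1)))
      (h.colNorm_Ubar_ne_zero hs hrm (by omega)),
    hM.gradVartheta_eq (W := leadCols rbar (s.U (k + 1))) hU] at hg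
  obtain ⟨hRo, hRle⟩ := hR
  rw [← hC₁] at hRle
  have hB : ‖conjD (s.Dbar k) R‖ ≤ C / Real.sqrt α :=
    norm_conjD_le (hs.isometry_Pbar k) h.alpha_pos (h.le_sq_Dbar hs hrm hk)
      (by rw [← hs.Vbar_eq]; exact hC k) hRo
  have hf : gradient M.f (s.Xbar k) * leadCols rbar (s.Vbar k)
      + leadCols rbar (s.U (k + 1) - s.Ubar k)
        * Matrix.diagonal (fun j : Lead r rbar => M.L * s.Dbar k j ^ 2 + s.gam1 k)
      + M.mu • leadCols rbar (s.U (k + 1))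
      + M.lam • normGrad M.tau (leadCols rbar (s.U (k + 1))) = 0 :=
    sepObj_min_fermat (ρ := rbar) (fun t ht => hM.tau_differentiableAt ht) (hs.U_min hM k) hU
  refine norm_partial_gradient_le (W₀ := leadCols rbar (s.Ubar k)) hM.lam_pos.le hmu.le
    (leadCols_sub _ _) hf hg
    (hM.lipschitz.norm_sub_le (s.Xbar (k + 1)) (s.Xbar k)) hFb
    ((norm_leadCols_le _).trans (hC (k + 1)))
    ((norm_leadCols_sub_blk_le _ _ _).trans ((le_max_right _ _).trans hRle))
    ((norm_leadCols_sub_blk_le _ _ _).trans ((le_max_left _ _).trans hRle)) hB hβ0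
    (fun j => ?_)
  have := hs.gam1_pos ha k
  have := hβ j.1
  rw [abs_of_nonneg (by positivity)]
  linarith

theorem StableFrom.norm_partial_gradient_snd_le (hM : M.Valid) (ha : a.Valid) (hrm : r ≤ m)
    {C Fb β C₁ : ℝ} {k : ℕ} (hk : kt ≤ k)
    (hC₁ : C₁ = (Real.sqrt α + 4 * betaBar s) / (2 * α)) (hC : ‖s.Ubar (k + 1)‖ ≤ C)
    (hC' : ‖s.Uhat (k + 1)‖ ≤ C) (hFb : ‖gradient M.f (s.Xhat (k + 1))‖ ≤ Fb)
    (hβ : ∀ i : Fin r, M.L * s.Dhat (k + 1) i ^ 2 + (M.mu + s.gam2 k) ≤ β) (hβ0 : 0 ≤ β)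
    {R : Matrix (Lead r rbar) (Lead r rbar) ℝ} (hR : AlignHat s rbar α k R)
    (hg : GapV M.θ s rbar k R) :
    ‖(gradient M.f (s.Xbar (k + 1)))ᵀ * leadCols rbar (s.Ubar (k + 1))
        + M.lam • normGrad M.tau (leadCols rbar (s.Vbar (k + 1)))
        + M.mu • leadCols rbar (s.Vbar (k + 1))‖
      ≤ (M.L * C + Fb * C₁ + (M.lam + M.mu) * C₁) * ‖s.Xbar (k + 1) - s.Xhat (k + 1)‖
        + ((M.lam + M.mu) * (C / Real.sqrt α) + β * (C / Real.sqrt α))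
          * ‖leadCols rbar (s.V (k + 1) - s.Vhat (k + 1))‖ := by
  have hmu := hM.mu_pos
  have hV := h.colNorm_V_ne_zero hs hrm hk
  rw [GapV, hM.gradVartheta_eq (W := leadCols rbar (s.Vbar (k + 1)))
      (h.colNorm_Vbar_ne_zero hs hrm (by omega)),
    hM.gradVartheta_eq (W := leadCols rbar (s.V (k + 1))) hV] at hg
  obtain ⟨hRo, hRle⟩ := hR
  rw [← hC₁] at hRle
  have hA : ‖conjD (s.Dhat (k + 1)) R‖ ≤ C / Real.sqrt α :=
    norm_conjD_le (hs.isometry_Phat (k + 1)) h.alpha_pos (h.le_sq_Dhat hs hrm hk)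
      (by rw [← hs.step2_Uhat]; exact hC') hRo
  have hf : (gradient M.f (s.Xhat (k + 1)))ᵀ * leadCols rbar (s.Uhat (k + 1))
      + leadCols rbar (s.V (k + 1) - s.Vhat (k + 1))
        * Matrix.diagonal (fun j : Lead r rbar => M.L * s.Dhat (k + 1) j ^ 2 + s.gam2 k)
      + M.mu • leadCols rbar (s.V (k + 1))
      + M.lam • normGrad M.tau (leadCols rbar (s.V (k + 1))) = 0 :=
    sepObj_min_fermat (ρ := rbar) (fun t ht => hM.tau_differentiableAt ht) (hs.V_min hM k) hV
  have hF : ‖(gradient M.f (s.Xbar (k + 1)))ᵀ - (gradient M.f (s.Xhat (k + 1)))ᵀ‖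
      ≤ M.L * ‖s.Xbar (k + 1) - s.Xhat (k + 1)‖ := by
    rw [← Matrix.transpose_sub, Matrix.frobenius_norm_transpose]
    exact hM.lipschitz.norm_sub_le (s.Xbar (k + 1)) (s.Xhat (k + 1))
  refine norm_partial_gradient_le (W₀ := leadCols rbar (s.Vhat (k + 1))) hM.lam_pos.le hmu.le
    (leadCols_sub _ _) hf hg hF
    ((Matrix.frobenius_norm_transpose _).trans_le hFb)
    ((norm_leadCols_le _).trans hC)
    ((norm_leadCols_sub_blk_le _ _ _).trans ((le_max_left _ _).trans hRle))
    ((norm_leadCols_sub_blk_le _ _ _).trans ((le_max_right _ _).trans hRle)) hA hβ0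
    (fun j => ?_)
  have := hs.gam2_pos ha k
  have := hβ j.1
  rw [abs_of_nonneg (by positivity)]
  linarith

/-- The gradient of the smooth minorant is an explicit element of the subdifferential, and its zero
trailing columns do not contribute to the norm. The extended distance to an empty set is `⊤`, so an
actual subgradient has to be exhibited. -/
theorem StableFrom.infEDist_le_norm_add (hM : M.Valid) (hrm : r ≤ m) {k : ℕ} (hk : kt ≤ k) :
    Metric.infEDist 0 (limitingSubdiff (M.Phi (r := r)) (WithLp.toLp 2 (s.Ubar k, s.Vbar k)))
      ≤ ENNReal.ofReal
        (‖gradient M.f (s.Xbar k) * leadCols rbar (s.Vbar k)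
          + M.lam • normGrad M.tau (leadCols rbar (s.Ubar k))
          + M.mu • leadCols rbar (s.Ubar k)‖
        + ‖(gradient M.f (s.Xbar k))ᵀ * leadCols rbar (s.Ubar k)
          + M.lam • normGrad M.tau (leadCols rbar (s.Vbar k))
          + M.mu • leadCols rbar (s.Vbar k)‖) := by
  have hU0 : ∀ j : Fin r, rbar ≤ j → colNorm (s.Ubar k) j = 0 := fun j hj => by
    rw [hs.colNorm_Ubar]; exact h.Dbar_eq_zero hs hrm hk j hj
  have hV0 : ∀ j : Fin r, rbar ≤ j → colNorm (s.Vbar k) j = 0 := fun j hj => by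
    rw [hs.colNorm_Vbar]; exact h.Dbar_eq_zero hs hrm hk j hj
  have hmem := hM.mem_limitingSubdiff_Phi (ρ := rbar) (h.colNorm_Ubar_ne_zero hs hrm hk)
    (h.colNorm_Vbar_ne_zero hs hrm hk) hU0 hV0
  rw [← hs.step4_Xbar] at hmem
  refine (Metric.infEDist_le_edist_of_mem hmem).trans ?_
  rw [edist_dist, dist_zero_left]
  refine ENNReal.ofReal_le_ofReal ((norm_toLp_le_add _ _).trans_eq ?_)
  rw [norm_add_leadExt_eq _ _ hV0 hU0, norm_add_leadExt_eq _ _ hU0 hV0]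

/-- The relative error bound, with all constants made explicit. -/
theorem StableFrom.infEDist_le (hM : M.Valid) (ha : a.Valid) (hrm : r ≤ m) {C Fb β C₁ : ℝ} {k : ℕ}
    (hk : kt ≤ k) (hC₁ : C₁ = (Real.sqrt α + 4 * betaBar s) / (2 * α)) (hC₁0 : 0 ≤ C₁)
    (hC : ∀ k, ‖s.Ubar k‖ ≤ C ∧ ‖s.Vbar k‖ ≤ C ∧ ‖s.Uhat (k + 1)‖ ≤ C ∧ ‖s.Vhat (k + 1)‖ ≤ C)
    (hFb : ∀ k, ‖gradient M.f (s.Xbar k)‖ ≤ Fb ∧ ‖gradient M.f (s.Xhat (k + 1))‖ ≤ Fb)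
    (hβ : ∀ (k : ℕ) (i : Fin r), M.L * s.Dbar k i ^ 2 + (M.mu + s.gam1 k) ≤ β ∧
      M.L * s.Dhat (k + 1) i ^ 2 + (M.mu + s.gam2 k) ≤ β) (hβ0 : 0 ≤ β)
    {R₁ R₂ : Matrix (Lead r rbar) (Lead r rbar) ℝ} (hR₁ : AlignHat s rbar α k R₁)
    (hR₂ : AlignBar s rbar α k R₂) (hgU : GapU M.θ s rbar k R₂) (hgV : GapV M.θ s rbar k R₁) :
    Metric.infEDist 0 (limitingSubdiff (M.Phi (r := r))
        (WithLp.toLp 2 (s.Ubar (k + 1), s.Vbar (k + 1))))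
      ≤ ENNReal.ofReal (((M.L * C + Fb * C₁ + (M.lam + M.mu) * C₁)
          + ((M.lam + M.mu) * (C / Real.sqrt α) + β * (C / Real.sqrt α)))
        * (‖s.Xbar (k + 1) - s.Xbar k‖ + ‖s.Xhat (k + 1) - s.Xbar (k + 1)‖
          + ‖s.U (k + 1) - s.Ubar k‖ + ‖s.V (k + 1) - s.Vhat (k + 1)‖)) := by
  have hC0 : 0 ≤ C := (norm_nonneg _).trans (hC 0).1
  have hFb0 : 0 ≤ Fb := (norm_nonneg _).trans (hFb 0).1
  have hlam := hM.lam_pos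
  have hmu := hM.mu_pos
  refine (h.infEDist_le_norm_add hs hM hrm (k := k + 1) (by omega)).trans
    (ENNReal.ofReal_le_ofReal ?_)
  have hU := h.norm_partial_gradient_fst_le hs hM ha hrm hk hC₁ (fun k => (hC k).2.1) (hFb k).1
    (fun i => (hβ k i).1) hβ0 hR₂ hgU
  have hV := h.norm_partial_gradient_snd_le hs hM ha hrm hk hC₁ (hC (k + 1)).1 (hC k).2.2.1
    (hFb k).2 (fun i => (hβ k i).2) hβ0 hR₁ hgV
  rw [norm_sub_rev (s.Xbar (k + 1)) (s.Xhat (k + 1))] at hV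
  have hbU := norm_leadCols_le (ρ := rbar) (s.U (k + 1) - s.Ubar k)
  have hbV := norm_leadCols_le (ρ := rbar) (s.V (k + 1) - s.Vhat (k + 1))
  set K₁ := M.L * C + Fb * C₁ + (M.lam + M.mu) * C₁ with hK₁
  set K₂ := (M.lam + M.mu) * (C / Real.sqrt α) + β * (C / Real.sqrt α) with hK₂
  have hK₁0 : 0 ≤ K₁ := by positivity
  have hK₂0 : 0 ≤ K₂ := by positivity
  -- The two bounds involve `K₁` times a change in `X` and `K₂` times a proximal step; using `K₁ +
  -- K₂` for all four distances only adds nonnegative cross terms.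
  have h1 := mul_le_mul_of_nonneg_left hbU hK₂0
  have h2 := mul_le_mul_of_nonneg_left hbV hK₂0
  have h3 := mul_nonneg hK₂0 (norm_nonneg (s.Xbar (k + 1) - s.Xbar k))
  have h4 := mul_nonneg hK₂0 (norm_nonneg (s.Xhat (k + 1) - s.Xbar (k + 1)))
  have h5 := mul_nonneg hK₁0 (norm_nonneg (s.U (k + 1) - s.Ubar k))
  have h6 := mul_nonneg hK₁0 (norm_nonneg (s.V (k + 1) - s.Vhat (k + 1)))
  linarith

end Bounds

/-- A Lipschitz gradient grows at most linearly from its value at `0`, and the products of bounded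
factors are bounded. -/
theorem IsRun.exists_gradient_bound (hs : IsRun M a s) (hM : M.Valid) {C : ℝ}
    (hC : ∀ k, ‖s.Ubar k‖ ≤ C ∧ ‖s.Vbar k‖ ≤ C ∧ ‖s.Uhat (k + 1)‖ ≤ C ∧ ‖s.Vhat (k + 1)‖ ≤ C) :
    ∃ Fb : ℝ, ∀ k, ‖gradient M.f (s.Xbar k)‖ ≤ Fb ∧ ‖gradient M.f (s.Xhat (k + 1))‖ ≤ Fb := by
  have hC0 : 0 ≤ C := (norm_nonneg _).trans (hC 0).1
  have key : ∀ (U : Mat n r) (V : Mat m r), ‖U‖ ≤ C → ‖V‖ ≤ C →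
      ‖gradient M.f (U * Vᵀ)‖ ≤ ‖gradient M.f 0‖ + M.L * (C * C) := by
    intro U V hU hV
    have h1 := hM.lipschitz.norm_sub_le (U * Vᵀ) 0
    rw [sub_zero] at h1
    have h2 : ‖U * Vᵀ‖ ≤ C * C := (Matrix.frobenius_norm_mul _ _).trans (by
      rw [Matrix.frobenius_norm_transpose]
      exact mul_le_mul hU hV (norm_nonneg _) hC0)
    have h3 := norm_sub_norm_le (gradient M.f (U * Vᵀ)) (gradient M.f 0)
    have h4 := mul_le_mul_of_nonneg_left h2 M.L.coe_nonneg
    linarith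
  refine ⟨‖gradient M.f 0‖ + M.L * (C * C), fun k => ⟨?_, ?_⟩⟩
  · rw [hs.step4_Xbar]; exact key _ _ (hC k).1 (hC k).2.1
  · rw [hs.step2_Xhat]; exact key _ _ (hC k).2.2.1 (hC k).2.2.2

end RelativeError

end LowRankFactor

end

/-! ### The proposition. -/

theorem proposition4p3 {n m r : ℕ} (hr : 1 ≤ r) (hrn : r ≤ n) (hnm : n ≤ m)
    (M : LowRankFactor.Model n m) (hM : M.Valid)
    (a : LowRankFactor.AlgParams) (ha : a.Valid)
    (s : LowRankFactor.Iterates n m r) (hs : LowRankFactor.IsRun M a s)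
    (h1 : LowRankFactor.Assumption1 hrn hnm M.θ)
    (h2 : LowRankFactor.Assumption2 M a s) :
    (∃ (rbar : ℕ) (α : ℝ) (kt : ℕ), LowRankFactor.StableFrom s rbar α kt) ∧
    ∀ (rbar : ℕ) (α : ℝ) (kt : ℕ), LowRankFactor.StableFrom s rbar α kt →
      (∀ k ≥ kt, ∃ R₁ R₂ : Matrix (LowRankFactor.Lead r rbar) (LowRankFactor.Lead r rbar) ℝ,
        LowRankFactor.AlignHat s rbar α k R₁ ∧ LowRankFactor.AlignBar s rbar α k R₂) ∧
      ∀ R₁ R₂ : ℕ → Matrix (LowRankFactor.Lead r rbar) (LowRankFactor.Lead r rbar) ℝ,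
        (∀ k ≥ kt, LowRankFactor.AlignHat s rbar α k (R₁ (k + 1)) ∧
          LowRankFactor.AlignBar s rbar α k (R₂ k)) →
        (∀ k ≥ kt, LowRankFactor.GapU M.θ s rbar k (R₂ k) ∧
          LowRankFactor.GapV M.θ s rbar k (R₁ (k + 1))) →
        ∃ cs : ℝ, 0 < cs ∧ ∀ k ≥ kt,
          Metric.infEDist 0 (LowRankFactor.limitingSubdiff (M.Phi (r := r))
              (WithLp.toLp 2 (s.Ubar (k + 1), s.Vbar (k + 1))))
            ≤ ENNReal.ofReal (cs * (‖s.Xbar (k + 1) - s.Xbar k‖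
                + ‖s.Xhat (k + 1) - s.Xbar (k + 1)‖
                + ‖s.U (k + 1) - s.Ubar k‖ + ‖s.V (k + 1) - s.Vhat (k + 1)‖)) := by
  have hrm := hrn.trans hnm
  refine ⟨hs.exists_stableFrom hr hrn hnm hM ha h1 h2, fun rbar α kt hst => ⟨fun k hk => ?_, ?_⟩⟩
  · obtain ⟨R₁, hR₁⟩ := hst.exists_alignHat hs hM ha h1 hk
    obtain ⟨R₂, hR₂⟩ := hst.exists_alignBar hs hM ha h1 hk
    exact ⟨R₁, R₂, hR₁, hR₂⟩
  · intro R₁ R₂ hR hgap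
    obtain ⟨C, hC0, hC⟩ := hs.exists_bound hM ha h1
    obtain ⟨Fb, hFb⟩ := hs.exists_gradient_bound hM hC
    obtain ⟨β, hβ0, hβ, -⟩ := h2
    have hlam := hM.lam_pos
    have hmu := hM.mu_pos
    have hα := hst.alpha_pos
    have hFb0 : 0 ≤ Fb := (norm_nonneg _).trans (hFb 0).1
    have hb := hs.betaBar_nonneg hM ha h1
    -- The constant is independent of `k`: `C` bounds the iterates, `Fb` the gradients, `β` the
    -- column coefficients, and `C / √α` the conjugated orthogonal matrices.
    refine ⟨((M.L * C + Fb * ((Real.sqrt α + 4 * LowRankFactor.betaBar s) / (2 * α))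
        + (M.lam + M.mu) * ((Real.sqrt α + 4 * LowRankFactor.betaBar s) / (2 * α)))
      + ((M.lam + M.mu) * (C / Real.sqrt α) + β * (C / Real.sqrt α))), by positivity,
      fun k hk => ?_⟩
    exact hst.infEDist_le hs hM ha hrm hk rfl (by positivity) hC hFb hβ hβ0.le (hR k hk).1
      (hR k hk).2 (hgap k hk).1 (hgap k hk).2
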